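/- An edge-labeled graph is a pair $G=(V,E)$ with $V$ a finite set of nodes and $E\subseteq V\times\Sigma\times V$, where $\Sigma$ is a finite set of labels. Regular bag expressions over an alphabet $\Delta$ are built from $\epsilon$ and the symbols $a\in\Delta$ by disjunction $\mid$, unordered concatenation $\parallel$ and unordered Kleene star ${}^*$, and define languages of finite bags (multisets) over $\Delta$: $L(\epsilon)$ contains only the empty bag, $L(a)$ only the one-element bag of $a$, $L(E_1\mid E_2)=L(E_1)\cup L(E_2)$, $L(E_1\parallel E_2)=\{u\uplus v : u\in L(E_1),\ v\in L(E_2)\}$, and $L(E^*)=\bigcup_{i\ge 0}L(E)^i$ with $L(E)^i$ the $i$-fold unordered concatenation of $L(E)$ with itself. Put $E^?=(\epsilon\mid E)$ and $E^+=(E\parallel E^*)$. The class $\mathrm{RBE}(a^M,\parallel)$ consists of the unordered concatenations (possibly empty, i.e. $\epsilon$) of expressions of the form $a$, $a^?$, $a^*$, $a^+$ with $a$ a symbol. A schema $S=(\Sigma,\Gamma,\delta)$ in $\mathrm{ShEx}(\mathrm{RBE}(a^M,\parallel))$ consists of finite sets $\Sigma$ of labels and $\Gamma$ of types, and, for every $t\in\Gamma$,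 an expression $E_t\in\mathrm{RBE}(a^M,\parallel)$ over $\Sigma\times\Gamma$, with $\delta(t)=L(E_t)$. A multi-type typing $\lambda:V\to 2^\Gamma$ of $G$ is valid with respect to $S$ if $\lambda(n)\neq\emptyset$ for every $n\in V$ and, for every $n\in V$ and $t\in\lambda(n)$, one can choose for each edge $(n,a,m)\in E$ leaving $n$ a type in $\lambda(m)$ so that the bag of the resulting pairs (label, chosen type), one for each edge leaving $n$, belongs to $\delta(t)$. Theorem. Multi-type validation for $\mathrm{ShEx}(\mathrm{RBE}(a^M,\parallel))$ is in PTIME: there is a deterministic Turing machine that, given a graph $G$ and a schema $S$ of this class (both are part of the input, and the schema is given by its expressions), decides in time polynomial in the size of the input whether $G$ has a multi-type typing that is valid with respect to $S$. -/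

import Mathlib

namespace ShExVal

/-! ### Bags and regular bag expressions -/

/-- Unordered concatenation of two bag languages: all bag unions `u ⊎ v`. -/
def bagConc {Δ : Type} (A B : Set (Multiset Δ)) : Set (Multiset Δ) :=
  {w | ∃ u ∈ A, ∃ v ∈ B, w = u + v}

/-- The `i`-fold unordered concatenation of a bag language with itself. -/
def bagPow {Δ : Type} (A : Set (Multiset Δ)) : ℕ → Set (Multiset Δ)
  | 0 => {0}
  | i + 1 => bagConc A (bagPow A i)

/-- Regular bag expressions over `Δ`. -/
inductive RBE (Δ : Type) : Type
  | eps : RBE Δ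
  | sym : Δ → RBE Δ
  | star : RBE Δ → RBE Δ
  | alt : RBE Δ → RBE Δ → RBE Δ
  | conc : RBE Δ → RBE Δ → RBE Δ

namespace RBE

/-- The macro `E? := (ε | E)`. -/
def opt {Δ : Type} (e : RBE Δ) : RBE Δ := alt eps e

/-- The macro `E⁺ := (E ∥ E*)`. -/
def plus {Δ : Type} (e : RBE Δ) : RBE Δ := conc e (star e)

/-- The bag language defined by an expression. -/
def lang {Δ : Type} : RBE Δ → Set (Multiset Δ)
  | eps => {0}
  | sym a => {{a}}
  | star e => ⋃ i : ℕ, bagPow (lang e) i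
  | alt e f => lang e ∪ lang f
  | conc e f => bagConc (lang e) (lang f)

/-- Membership in the class `RBE(a^M, ∥)`: multiplicities among `1, ?, *, +` may be used,
on symbols only, and the only operator is unordered concatenation (the empty concatenation
`ε` is included). -/
inductive IsMultConc {Δ : Type} : RBE Δ → Prop
  | eps : IsMultConc eps
  | one (a : Δ) : IsMultConc (sym a)
  | opt (a : Δ) : IsMultConc (sym a).opt
  | star (a : Δ) : IsMultConc (sym a).star
  | plus (a : Δ) : IsMultConc (sym a).plus
  | conc {e f : RBE Δ} : IsMultConc e → IsMultConc f → IsMultConc (conc e f)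

end RBE

/-- A class of regular bag expressions: a set of expressions over every alphabet. -/
abbrev RBEClass := ∀ Δ : Type, Set (RBE Δ)

/-- The class `RBE(a^M, ∥)`. -/
def rbeMultConc : RBEClass := fun Δ => {e : RBE Δ | e.IsMultConc}

/-! ### Graphs, schemas and multi-type typings -/

/-- An edge-labelled graph with node set `V` and edge labels in `A`: a set of triples
`(n, a, m)`. -/
structure EdgeLabeledGraph (V A : Type) where
  edges : Finset (V × A × V)

/-- A shape expression schema with edge labels `A` and types `T`: one rule `t → E` for
every type `t`, where `E` is a regular bag expression over `A × T`. -/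
structure Schema (A T : Type) where
  rule : T → RBE (A × T)

/-- The type definition function `δ` of a schema. -/
def Schema.typeDef {A T : Type} (S : Schema A T) (t : T) : Set (Multiset (A × T)) :=
  (S.rule t).lang

/-- The labelled and typed out-neighbourhood of the node `n` with respect to the m-typing `ty`:
the bag of all `(a, ty m)`, one occurrence for every edge `(n, a, m)`. -/
def EdgeLabeledGraph.outLabType {V A T : Type} [DecidableEq V] (G : EdgeLabeledGraph V A) (ty : V → Set T) (n : V) :
    Multiset (A × Set T) :=
  (G.edges.filter (fun e => e.1 = n)).val.map (fun e => (e.2.1, ty e.2.2))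

/-- `u` is a flattening of the bag `w` over `A × 2^T`: it is obtained by choosing one type
from every occurrence of every set in `w`. -/
def IsFlattening {A T : Type} (w : Multiset (A × Set T)) (u : Multiset (A × T)) : Prop :=
  Multiset.Rel (fun p q => p.1 = q.1 ∧ q.2 ∈ p.2) w u

/-- The m-typing `ty` of `G` is valid with respect to `S`: every node has at least one type, and
every node satisfies the type definition of each of its types. -/
def IsValidMTyping {V A T : Type} [DecidableEq V] (G : EdgeLabeledGraph V A) (S : Schema A T)
    (ty : V → Set T) : Prop :=
  (∀ n, (ty n).Nonempty) ∧
    ∀ n, ∀ t ∈ ty n, ∃ u, IsFlattening (G.outLabType ty n) u ∧ u ∈ S.typeDef t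

/-- `G` satisfies `S` under the multi-type semantics. -/
def MValid {V A T : Type} [DecidableEq V] (G : EdgeLabeledGraph V A) (S : Schema A T) : Prop :=
  ∃ ty : V → Set T, IsValidMTyping G S ty

/-! ### The validation problem as a computational problem -/

/-- An input of validation for `ShEx(C)`. Nodes, labels and types are numbered; the edges are
listed in an arbitrary order without repetition; the graph, the label set, the type set and the
rules are all part of the input. -/
structure ValidationInput (C : RBEClass) where
  numNodes : ℕ
  numLabels : ℕ
  numTypes : ℕ
  edgeList : List (Fin numNodes × Fin numLabels × Fin numNodes)
  edgeList_nodup : edgeList.Nodup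
  rule : Fin numTypes → RBE (Fin numLabels × Fin numTypes)
  rule_mem : ∀ t, rule t ∈ C (Fin numLabels × Fin numTypes)

/-- The graph of an input. -/
def ValidationInput.graph {C : RBEClass} (I : ValidationInput C) :
    EdgeLabeledGraph (Fin I.numNodes) (Fin I.numLabels) :=
  ⟨I.edgeList.toFinset⟩

/-- The schema of an input. -/
def ValidationInput.schema {C : RBEClass} (I : ValidationInput C) :
    Schema (Fin I.numLabels) (Fin I.numTypes) :=
  ⟨I.rule⟩

/-- The input alphabet: a unary digit, the end mark of a number, the beginning of an edge and of
a rule, and the five constructors of expressions. -/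
inductive Token : Type
  | digit
  | endNum
  | edge
  | rule
  | eps
  | sym
  | star
  | alt
  | conc

/-- A number in unary. Only cardinalities of the node, label and type sets and members of these
sets are written in this way, so that all numbers are at most the number of objects in the
input. -/
def encodeNum (n : ℕ) : List Token := List.replicate n Token.digit ++ [Token.endNum]

/-- Expressions are written in prefix notation. -/
def encodeRBE {k l : ℕ} : RBE (Fin k × Fin l) → List Token
  | .eps => [Token.eps]
  | .sym p => Token.sym :: (encodeNum p.1 ++ encodeNum p.2)
  | .star e => Token.star :: encodeRBE e
  | .alt e f => Token.alt :: (encodeRBE e ++ encodeRBE f)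
  | .conc e f => Token.conc :: (encodeRBE e ++ encodeRBE f)

/-- One edge `(n, a, m)`. -/
def encodeEdge {n k : ℕ} (e : Fin n × Fin k × Fin n) : List Token :=
  Token.edge :: (encodeNum e.1 ++ encodeNum e.2.1 ++ encodeNum e.2.2)

/-- The word over `Token` that presents an input: the numbers of nodes, labels and types, then
the edges, then the rules in the order of the types. -/
def ValidationInput.encode {C : RBEClass} (I : ValidationInput C) : List Token :=
  encodeNum I.numNodes ++ encodeNum I.numLabels ++ encodeNum I.numTypes ++
    I.edgeList.flatMap encodeEdge ++
    (List.finRange I.numTypes).flatMap (fun t => Token.rule :: encodeRBE (I.rule t))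

/-- The decision problem `P`, with inputs presented by `enc`, is in PTIME: some Turing machine
computes the truth value of `P x` from `enc x`, for every input `x`, in a number of steps bounded
by a polynomial in the length of `enc x`. -/
def InPTIME {α Γ : Type} (enc : α → List Γ) (P : α → Prop) : Prop :=
  open Classical in
  Nonempty (Turing.TM2ComputableInPolyTime enc Computability.encodeBool (fun x => decide (P x)))

end ShExVal

/-! Satisfaction of a type is monotone: a node that satisfies `t` when its successors offer few
types still does when they offer more. Hence every valid typing survives the following process:
start with all types at every node and repeatedly remove the pairs `(v, t)` such that `v` does not
satisfy `t`. The process is stationary after at most as many rounds as there are pairs, and the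
graph is valid if and only if every node then keeps a type (`ValidationInput.mValid_iff`).

One round is a matching problem. An expression of the class is a concatenation of atoms `a`, `a?`,
`a*`, where `a⁺` counts as `a ∥ a*`. A node satisfies it if its edges can be distributed over atoms
of fitting label and type so that an atom without star gets at most one edge, and exactly one if it
is not optional. Put the edges and the atoms without star on both sides of a bipartite graph. Join
an edge to the fitting atoms without star, and to itself if some starred atom can take it; join an
atom to the fitting edges, and to itself if it is optional. Distributions correspond to perfect
matchings (`exists_isAssignment_iff_matching`, `ValidationInput.exists_flattening_iff_hasMatching`).

Perfect matchings are found by an auction: an unserved person bids for a cheapest acceptable object,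
whose price grows by one and whose former owner is displaced. The sum of the prices stays below `N *
N`, so the auction ends in time. If somebody remains unserved, a gap in the prices yields a
violation of Hall's condition (`Auction.Invariant.owns_iff`, `Auction.owns_iff_of_iterate`). A bid,
unlike an augmenting path, is first-order definable from the current state.

The complexity bound therefore reduces to a general fact: whatever is computed by first-order
definable assignments to relations over the positions of the input word, iterated as often as there
are positions, with nesting, is in PTIME (`StackProg.inPTIME_of_relProg`). Relations are kept on
stacks as bit tables and formulas are evaluated by exhaustive search. The programs are written in a
small structured language with a timed semantics that agrees step by step with a multi-stack machine
(`StackProg.Runs.steps`). The validation algorithm is the relational program `Tab.validate`. -/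

namespace ShExVal

open Function

/-! ### Structured stack programs -/

/-- Structured programs over stacks indexed by `K` with symbols in `A`. The internal state is the
symbol popped last (`none` if the stack was empty). -/
inductive StackProg (K A : Type) : Type
  | push (k : K) (f : Option A → A) : StackProg K A
  | pop (k : K) : StackProg K A
  | seq (p q : StackProg K A) : StackProg K A
  | ite (c : Option A → Bool) (p q : StackProg K A) : StackProg K A
  | loop (c : Option A → Bool) (p : StackProg K A) : StackProg K A

namespace StackProg

variable {K A : Type} [DecidableEq K]

/-- Timed big-step semantics: `Runs p v S v' S' t` means that `p`, started with internal state `v`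
and stacks `S`, ends after `t` steps with internal state `v'` and stacks `S'`. -/
inductive Runs : StackProg K A → Option A → (K → List A) → Option A → (K → List A) → ℕ → Prop
  | push (k : K) (f : Option A → A) (v : Option A) (S : K → List A) :
      Runs (push k f) v S v (update S k (f v :: S k)) 1
  | pop (k : K) (v : Option A) (S : K → List A) :
      Runs (pop k) v S (S k).head? (update S k (S k).tail) 1
  | seq {p q : StackProg K A} {v S v' S' v'' S'' t t'} :
      Runs p v S v' S' t → Runs q v' S' v'' S'' t' → Runs (seq p q) v S v'' S'' (t + t')
  | ite_true {c : Option A → Bool} {p : StackProg K A} (q : StackProg K A) {v S v' S' t} :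
      c v = true → Runs p v S v' S' t → Runs (ite c p q) v S v' S' (t + 1)
  | ite_false {c : Option A → Bool} (p : StackProg K A) {q : StackProg K A} {v S v' S' t} :
      c v = false → Runs q v S v' S' t → Runs (ite c p q) v S v' S' (t + 1)
  | loop_true {c : Option A → Bool} {p : StackProg K A} {v S v' S' v'' S'' t t'} :
      c v = true → Runs p v S v' S' t → Runs (loop c p) v' S' v'' S'' t' →
        Runs (loop c p) v S v'' S'' (t + t' + 1)
  | loop_false {c : Option A → Bool} (p : StackProg K A) {v} (S : K → List A) :
      c v = false → Runs (loop c p) v S v S 1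

omit [DecidableEq K] in
/-- The labels of the compiled program. -/
def Lab : StackProg K A → Type
  | push _ _ => Unit
  | pop _ => Unit
  | seq p q => Lab p ⊕ Lab q
  | ite _ p q => Option (Lab p ⊕ Lab q)
  | loop _ p => Option (Lab p)

/-- The label at which the compiled program starts. -/
def entry : (p : StackProg K A) → Lab p
  | push _ _ => ()
  | pop _ => ()
  | seq p _ => Sum.inl (entry p)
  | ite _ _ _ => none
  | loop _ _ => none

/-- A program has finitely many labels. -/
@[reducible]
def labFintype : (p : StackProg K A) → Fintype (Lab p)
  | push _ _ => inferInstanceAs (Fintype Unit)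
  | pop _ => inferInstanceAs (Fintype Unit)
  | seq p q => @instFintypeSum _ _ (labFintype p) (labFintype q)
  | ite _ p q => @instFintypeOption _ (@instFintypeSum _ _ (labFintype p) (labFintype q))
  | loop _ p => @instFintypeOption _ (labFintype p)

/-- The alphabets of the machine: an output stack `none` of Booleans is added. -/
@[reducible]
def Alph (K A : Type) : Option K → Type
  | none => Bool
  | some _ => A

/-- The code of a program, whose labels are embedded by `emb` and which continues at `exit`. -/
def code {Λ : Type} : (p : StackProg K A) → (Lab p → Λ) → Λ → Lab p →
    Turing.TM2.Stmt (Alph K A) Λ (Option A)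
  | push k f, _, exit, _ => .push (some k) f (.goto fun _ => exit)
  | pop k, _, exit, _ => .pop (some k) (fun _ a => a) (.goto fun _ => exit)
  | seq p q, emb, _, Sum.inl l => code p (fun l => emb (Sum.inl l)) (emb (Sum.inr (entry q))) l
  | seq _ q, emb, exit, Sum.inr l => code q (fun l => emb (Sum.inr l)) exit l
  | ite c p q, emb, _, none =>
      .branch c (.goto fun _ => emb (some (Sum.inl (entry p))))
        (.goto fun _ => emb (some (Sum.inr (entry q))))
  | ite _ p _, emb, exit, some (Sum.inl l) => code p (fun l => emb (some (Sum.inl l))) exit l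
  | ite _ _ q, emb, exit, some (Sum.inr l) => code q (fun l => emb (some (Sum.inr l))) exit l
  | loop c p, emb, exit, none =>
      .branch c (.goto fun _ => emb (some (entry p))) (.goto fun _ => exit)
  | loop _ p, emb, _, some l => code p (fun l => emb (some l)) (emb none) l

/-- The stacks of the machine, with output stack `o`. -/
def machineStacks (o : List Bool) (S : K → List A) : ∀ k : Option K, List (Alph K A k)
  | none => o
  | some k => S k

lemma update_machineStacks (o : List Bool) (S : K → List A) (k : K) (l : List A) :
    update (machineStacks o S) (some k) l = machineStacks o (update S k l) := by
  funext k'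
  rcases k' with _ | k'
  · rfl
  · by_cases h : k' = k
    · subst h
      exact (update_self _ _ _).trans (update_self (f := S) _ _).symm
    · exact (update_of_ne (by simpa using h) _ _).trans (update_of_ne h _ _).symm

/-- Every label carries a statement that ends in a jump, so visiting a label costs one machine step
and the time of the semantics is the exact number of steps. `seq` is free because its first part
jumps directly to the entry of the second. The generality in `emb` and `exit` lets the induction
pass to subprograms. -/
lemma Runs.steps {Λ : Type} {M : Λ → Turing.TM2.Stmt (Alph K A) Λ (Option A)}
    {p : StackProg K A} {v S v' S' t} (h : Runs p v S v' S' t) :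
    ∀ (emb : Lab p → Λ) (exit : Λ), (∀ l, M (emb l) = code p emb exit l) →
      (flip bind (Turing.TM2.step M))^[t]
          (some ⟨some (emb (entry p)), v, machineStacks [] S⟩) =
        some ⟨some exit, v', machineStacks [] S'⟩ := by
  have one (l : Λ) (v : Option A) (S : K → List A) :
      flip bind (Turing.TM2.step M) (some ⟨some l, v, machineStacks [] S⟩) =
        some (Turing.TM2.stepAux (M l) v (machineStacks [] S)) := rfl
  induction h with
  | push k f v S =>
    intro emb exit hM
    rw [iterate_one, one, hM, ← update_machineStacks]
    rfl
  | pop k v S =>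
    intro emb exit hM
    rw [iterate_one, one, hM, ← update_machineStacks]
    rfl
  | @seq p q v S v' S' v'' S'' t t' hp hq ihp ihq =>
    intro emb exit hM
    rw [Nat.add_comm, iterate_add_apply]
    exact (congrArg _ (ihp (fun l => emb (Sum.inl l)) (emb (Sum.inr (entry q)))
      (fun l => hM (Sum.inl l)))).trans
      (ihq (fun l => emb (Sum.inr l)) exit (fun l => hM (Sum.inr l)))
  | @ite_true c p q v S v' S' t hc hp ih =>
    intro emb exit hM
    rw [iterate_succ_apply, one, hM]
    refine Eq.trans (congrArg _ ?_)
      (ih (fun l => emb (some (Sum.inl l))) exit (fun l => hM (some (Sum.inl l))))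
    exact congrArg some ((congrArg (fun b => cond b _ _) hc).trans rfl)
  | @ite_false c p q v S v' S' t hc hp ih =>
    intro emb exit hM
    rw [iterate_succ_apply, one, hM]
    refine Eq.trans (congrArg _ ?_)
      (ih (fun l => emb (some (Sum.inr l))) exit (fun l => hM (some (Sum.inr l))))
    exact congrArg some ((congrArg (fun b => cond b _ _) hc).trans rfl)
  | @loop_true c p v S v' S' v'' S'' t t' hc hp hl ihp ihl =>
    intro emb exit hM
    rw [iterate_succ_apply, Nat.add_comm t, iterate_add_apply, one, hM]
    refine Eq.trans (congrArg _ (Eq.trans (congrArg _ ?_)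
      (ihp (fun l => emb (some l)) (emb none) (fun l => hM (some l))))) (ihl emb exit hM)
    exact congrArg some ((congrArg (fun b => cond b _ _) hc).trans rfl)
  | @loop_false c p v S hc =>
    intro emb exit hM
    rw [iterate_one, one, hM]
    exact congrArg some ((congrArg (fun b => cond b _ _) hc).trans rfl)

/-- The machine of a program: after the program, the top of the stack `kout` is compared with `tt`
and the result of the comparison is the output. -/
def machine [Fintype K] [Fintype A] [DecidableEq A] (p : StackProg K A) (kin kout : K) (tt : A) :
    Turing.FinTM2 where
  K := Option K
  k₀ := some kin
  k₁ := none
  Γ := Alph K A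
  Λ := Option (Lab p)
  main := some (entry p)
  ΛFin := @instFintypeOption _ (labFintype p)
  σ := Option A
  initialState := none
  Γk₀Fin := inferInstanceAs (Fintype A)
  m
    | some l => code p some none l
    | none => .pop (some kout) (fun _ a => a) <|
        .push none (fun v : Option A => (decide (v = some tt) : Bool)) <|
        .load (fun _ => none) .halt

/-- A halting configuration that presents an output has the initial internal state and empty stacks
apart from the output. Hence `p` has to leave nothing but `[b]`, and the closing block, which
accounts for the one step added to `T`, resets the state. -/
theorem inPTIME_of_runs [Fintype K] [Fintype A] [DecidableEq A] {α : Type} {enc : α → List A}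
    {P : α → Prop} (p : StackProg K A) (kin kout : K) (tt : A) (T : Polynomial ℕ)
    (h : ∀ x, ∃ v b t, t ≤ T.eval (enc x).length ∧
      Runs p none (update (fun _ => []) kin (enc x)) v (update (fun _ => []) kout [b]) t ∧
      (b = tt ↔ P x)) :
    InPTIME enc P := by
  classical
  refine ⟨⟨⟨machine p kin kout tt, Equiv.refl _, Equiv.refl _⟩, T + 1, fun x => ?_⟩⟩
  refine Classical.choice ?_
  obtain ⟨v, b, t, ht, hr, hb⟩ := h x
  refine ⟨⟨⟨t + 1, ?_⟩, by simpa using ht⟩⟩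
  have key := hr.steps (M := (machine p kin kout tt).m) some none (fun l => rfl)
  have hin : Turing.initList (machine p kin kout tt)
      (List.map (Equiv.refl ((machine p kin kout tt).Γ (machine p kin kout tt).k₀)).invFun
        (enc x)) =
      ⟨some (some (entry p)), none, machineStacks [] (update (fun _ => []) kin (enc x))⟩ := by
    refine congrArg (Turing.TM2.Cfg.mk _ _) ?_
    funext k
    rcases k with _ | k
    · exact dif_neg (by simp [machine])
    · by_cases hk : k = kin
      · subst hk
        refine (dif_pos rfl).trans ?_
        refine Eq.trans ?_ (update_self (f := fun _ => ([] : List A)) k (enc x)).symm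
        exact List.map_id (enc x)
      · refine (dif_neg (by simpa [machine] using hk)).trans ?_
        exact (update_of_ne (f := fun _ => ([] : List A)) hk (enc x)).symm
  rw [Nat.add_comm, iterate_add_apply]
  refine (congrArg (flip bind (machine p kin kout tt).step)
    ((congrArg (fun c => (flip bind (machine p kin kout tt).step)^[t] (some c)) hin).trans
      key)).trans ?_
  refine congrArg some (congrArg (Turing.TM2.Cfg.mk _ _) ?_)
  funext k
  rcases k with _ | k
  · refine (update_self _ _ _).trans (Eq.trans ?_ (dif_pos rfl).symm)
    have hd : (decide ((update (fun _ => []) kout [b] kout).head? = some tt) : Bool) =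
        decide (P x) := by
      simp [hb]
    exact congrArg (fun c => [c]) hd
  · refine (update_of_ne (Option.some_ne_none k) _ _).trans
      (Eq.trans ?_ (dif_neg (by simp [machine])).symm)
    have hS : update (update (fun _ => []) kout [b]) kout
        (update (fun _ => []) kout [b] kout).tail k = ([] : List A) := by
      simp
    exact (congrFun (update_machineStacks [] (update (fun _ => []) kout [b]) kout
      (update (fun _ => []) kout [b] kout).tail) (some k)).trans hS

end StackProg

end ShExVal

/-! ### Time bounds for elementary stack programs -/

namespace ShExVal

open Function

namespace StackProg

variable {K A : Type} [DecidableEq K]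

/-- `p` leads from the stacks `S` to the stacks `S'` within time `T`, whatever the internal state
is. -/
def Does (p : StackProg K A) (S S' : K → List A) (T : ℕ) : Prop :=
  ∀ v, ∃ v' t, t ≤ T ∧ Runs p v S v' S' t

lemma Does.mono {p : StackProg K A} {S S' : K → List A} {T T' : ℕ} (h : Does p S S' T)
    (hT : T ≤ T') : Does p S S' T' := fun v =>
  let ⟨v', t, ht, hr⟩ := h v
  ⟨v', t, ht.trans hT, hr⟩

lemma Does.congr {p : StackProg K A} {S S' S'' : K → List A} {T T' : ℕ} (h : Does p S S' T)
    (hS : S' = S'') (hT : T ≤ T') : Does p S S'' T' :=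
  hS ▸ h.mono hT

lemma Does.seq {p q : StackProg K A} {S S' S'' : K → List A} {T T' : ℕ} (hp : Does p S S' T)
    (hq : Does q S' S'' T') : Does (seq p q) S S'' (T + T') := fun v =>
  let ⟨v', t, ht, hr⟩ := hp v
  let ⟨v'', t', ht', hr'⟩ := hq v'
  ⟨v'', t + t', Nat.add_le_add ht ht', hr.seq hr'⟩

lemma does_push_const (k : K) (a : A) (S : K → List A) :
    Does (push k fun _ => a) S (update S k (a :: S k)) 1 :=
  fun v => ⟨_, 1, le_rfl, .push k _ v S⟩

/-- The pop overwrites the internal state, so the rest of the program need only be understood from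
one known state. -/
lemma does_pop_seq {k : K} {p : StackProg K A} {S S' : K → List A} {T : ℕ}
    (h : ∃ v' t, t ≤ T ∧ Runs p (S k).head? (update S k (S k).tail) v' S' t) :
    Does (seq (pop k) p) S S' (T + 1) := fun v =>
  let ⟨v', t, ht, hr⟩ := h
  ⟨v', 1 + t, by omega, .seq (.pop k v S) hr⟩

/-- The program that does nothing. -/
def skip (k : K) : StackProg K A := loop (fun _ => false) (pop k)

lemma runs_skip (k : K) (v : Option A) (S : K → List A) : Runs (skip k) v S v S 1 :=
  .loop_false _ _ rfl

/-- Pop `k` until it is empty and execute `b` after every pop of a symbol. -/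
def whilePop (k : K) (b : StackProg K A) : StackProg K A :=
  seq (pop k) (loop Option.isSome (seq b (pop k)))

lemma does_whilePop_nil {k : K} (b : StackProg K A) {S : K → List A} (h : S k = []) :
    Does (whilePop k b) S S 2 := fun v => by
  have h1 := Runs.pop k v S
  rw [h, List.tail_nil, ← h, update_eq_self, h] at h1
  exact ⟨_, _, le_rfl, h1.seq (.loop_false _ _ rfl)⟩

/-- Each round of the inner loop ends with a pop, just as `whilePop` begins with one. A run on the
remaining stack can thus be cut after its first pop and reassembled behind one execution of `b`. -/
lemma does_whilePop_cons {k : K} {b : StackProg K A} {S S₁ S' : K → List A} {a : A} {l : List A}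
    {T T' : ℕ} (h : S k = a :: l)
    (hb : ∃ v' t, t ≤ T ∧ Runs b (some a) (update S k l) v' S₁ t)
    (hw : Does (whilePop k b) S₁ S' T') : Does (whilePop k b) S S' (T + T' + 2) := fun v => by
  obtain ⟨v₁, t, ht, hb⟩ := hb
  obtain ⟨v', t', ht', hw⟩ := hw v₁
  have h1 := Runs.pop k v S
  rw [h, List.tail_cons, List.head?_cons] at h1
  cases hw with
  | @seq _ _ _ _ _ _ _ _ t₁ t₂ hp hl =>
    exact ⟨v', _, by omega, h1.seq (.loop_true rfl (hb.seq hp) hl)⟩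

lemma does_whilePop_cons' {k : K} {b : StackProg K A} {S S₁ S' : K → List A} {a : A} {l : List A}
    {T T' : ℕ} (h : S k = a :: l) (hb : Does b (update S k l) S₁ T)
    (hw : Does (whilePop k b) S₁ S' T') : Does (whilePop k b) S S' (T + T' + 2) :=
  does_whilePop_cons h (hb _) hw

/-- Pop all symbols of `k`. -/
def clear (k : K) : StackProg K A := whilePop k (skip k)

lemma does_clear (k : K) (S : K → List A) :
    Does (clear k) S (update S k []) (3 * (S k).length + 2) := by
  generalize hl : S k = l
  induction l generalizing S with
  | nil => exact (does_whilePop_nil (skip k) hl).congr (by rw [← hl]; simp) le_rfl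
  | cons a l ih =>
    refine (does_whilePop_cons hl ⟨_, _, le_rfl, runs_skip _ _ _⟩ (ih _ (by simp))).congr ?_ ?_
    · simp
    · simp only [List.length_cons]; omega

/-- Move all symbols of `k` to `k'`, which reverses their order. -/
def moveTo [Inhabited A] (k k' : K) : StackProg K A := whilePop k (push k' fun v => v.getD default)

lemma does_moveTo [Inhabited A] {k k' : K} (hk : k ≠ k') (S : K → List A) :
    Does (moveTo k k') S (update (update S k []) k' ((S k).reverse ++ S k'))
      (3 * (S k).length + 2) := by
  generalize hl : S k = l
  induction l generalizing S with
  | nil => exact (does_whilePop_nil _ hl).congr (by rw [← hl, update_eq_self, hl]; simp) le_rfl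
  | cons a l ih =>
    refine (does_whilePop_cons hl ⟨_, _, le_rfl, .push _ _ _ _⟩ (ih _ ?_)).congr ?_ ?_
    · simp [hk]
    · funext k₁
      simp only [update_apply]
      split_ifs <;> simp_all
    · simp only [List.length_cons]; omega

/-- Put a copy of `k` on top of `k'`, with the help of the empty stack `t`. -/
def copyTo [Inhabited A] (k k' t : K) : StackProg K A :=
  seq (moveTo k t)
    (whilePop t (seq (push k fun v => v.getD default) (push k' fun v => v.getD default)))

/-- The detour over `t` reverses the symbols twice, so `k` is restored and the copy has the same
order. -/
lemma does_copyTo [Inhabited A] {k k' t : K} (hk : k ≠ k') (hkt : k ≠ t) (hkt' : k' ≠ t)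
    {S : K → List A} (ht : S t = []) :
    Does (copyTo k k' t) S (update S k' (S k ++ S k')) (7 * (S k).length + 4) := by
  have h1 := does_moveTo hkt S
  have h2 : ∀ (l : List A) (S : K → List A), S t = l →
      Does (whilePop t (seq (push k fun v => v.getD default) (push k' fun v => v.getD default))) S
        (update (update (update S t []) k (l.reverse ++ S k)) k' (l.reverse ++ S k'))
        (4 * l.length + 2) := by
    intro l
    induction l with
    | nil => exact fun S hS => (does_whilePop_nil _ hS).congr (by rw [← hS, update_eq_self, hS]; simp) le_rfl
    | cons a l ih =>
      intro S hS
      refine (does_whilePop_cons hS ⟨_, _, le_rfl, .seq (.push _ _ _ _) (.push _ _ _ _)⟩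
        (ih _ ?_)).congr ?_ ?_
      · simp [hkt.symm, hkt'.symm]
      · funext k₁
        simp only [update_apply]
        split_ifs <;> simp_all
      · simp only [List.length_cons]; omega
  refine (h1.seq (h2 (S k).reverse _ ?_)).congr ?_ ?_
  · simp [ht]
  · funext k₁
    simp only [update_apply]
    split_ifs <;> simp_all
  · simp only [List.length_reverse]; omega

end StackProg

end ShExVal

namespace ShExVal

open Function

instance : DecidableEq Token := fun a b => decidable_of_iff (a.ctorIdx = b.ctorIdx) <| by
  cases a <;> cases b <;> simp [Token.ctorIdx]

instance : Fintype Token :=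
  Fintype.ofList [.digit, .endNum, .edge, .rule, .eps, .sym, .star, .alt, .conc]
    (by intro x; cases x <;> simp)

instance : Inhabited Token := ⟨.digit⟩

/-- The symbol for a truth value. -/
def bit (b : Bool) : Token := if b then .digit else .endNum

/-! ### First-order formulas over words and relations -/

/-- First-order formulas with variables in `V` over a word of tokens and relations named by `R`. -/
inductive Fml (V R : Type) : Type
  | tok (a : Token) (i : V) : Fml V R
  | lt (i j : V) : Fml V R
  | rel (x : R) (vs : List V) : Fml V R
  | not (φ : Fml V R) : Fml V R
  | and (φ ψ : Fml V R) : Fml V R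
  | ex (i : V) (φ : Fml V R) : Fml V R

/-- Programs over relations: assignment of a definable relation, composition, and iteration, as
often as the domain has elements. -/
inductive RelProg (V R : Type) : Type
  | assign (x : R) (vs : List V) (φ : Fml V R) : RelProg V R
  | seq (p q : RelProg V R) : RelProg V R
  | loop (p : RelProg V R) : RelProg V R

section semantics

variable {V R : Type} [DecidableEq V] [DecidableEq R]

/-- Truth of a formula over the word `w`, with quantifiers ranging over `0, …, n - 1`. -/
def Fml.eval (w : List Token) (n : ℕ) (s : R → List ℕ → Prop) : Fml V R → (V → ℕ) → Prop
  | tok a i, e => w[e i]? = some a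
  | lt i j, e => e i < e j
  | rel x vs, e => s x (vs.map e)
  | not φ, e => ¬ φ.eval w n s e
  | and φ ψ, e => φ.eval w n s e ∧ ψ.eval w n s e
  | ex i φ, e => ∃ x < n, φ.eval w n s (update e i x)

/-- The assignment of the numbers of a list to variables; the other variables are `0`. -/
def assignEnv : List V → List ℕ → V → ℕ
  | v :: vs, x :: xs => update (assignEnv vs xs) v x
  | _, _ => fun _ => 0

/-- The effect of a program on the relations. -/
def RelProg.run (w : List Token) (n : ℕ) : RelProg V R → (R → List ℕ → Prop) → R → List ℕ → Prop
  | assign x vs φ, s => update s x fun l => φ.eval w n s (assignEnv vs l)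
  | seq p q, s => q.run w n (p.run w n s)
  | loop p, s => (p.run w n)^[n] s

/-- The formula respects the arities, and binds no variable in scope again. -/
def Fml.Wf (ar : R → ℕ) : Fml V R → List V → Prop
  | tok _ _, _ => True
  | lt _ _, _ => True
  | rel x vs, _ => vs.length = ar x
  | not φ, sc => φ.Wf ar sc
  | and φ ψ, sc => φ.Wf ar sc ∧ ψ.Wf ar sc
  | ex i φ, sc => i ∉ sc ∧ φ.Wf ar (i :: sc)

/-- The formulas of the program respect the arities, and bind no variable in scope again. -/
def RelProg.Wf (ar : R → ℕ) : RelProg V R → Prop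
  | assign x vs φ => vs.length = ar x ∧ vs.Nodup ∧ φ.Wf ar vs
  | seq p q => p.Wf ar ∧ q.Wf ar
  | loop p => p.Wf ar

end semantics

/-! ### Evaluation of formulas by stack programs -/

/-- The stacks used for programs over relations: the word, the size of the domain in unary, five
auxiliary stacks, loop counters, truth values of subformulas, a relation under construction, the
values of the variables in unary, and the relations, listed by bits. -/
inductive Stk (V R : Type) : Type
  | word | size | tmp | idx | idx' | buf | ctl | bools | new
  | reg (i : V)
  | rel (x : R)
  deriving DecidableEq, Fintype

namespace StackProg

variable {V R : Type} [DecidableEq V] [DecidableEq R]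

/-- Stack programs for programs over relations. -/
abbrev RProg (V R : Type) := StackProg (Stk V R) Token

/-- The contents of the stacks of `RProg`. -/
abbrev RStacks (V R : Type) := Stk V R → List Token

/-- A number in unary. -/
abbrev unary (n : ℕ) : List Token := List.replicate n .digit

/-- Execute `b` as often as the domain has elements. -/
def forSize (b : RProg V R) : RProg V R :=
  seq (push .ctl fun _ => .endNum) <| seq (copyTo .size .ctl .tmp) <| seq (pop .ctl) <|
    loop (fun v => decide (v = some .digit)) (seq b (pop .ctl))

/-- `F i` describes the stacks after `i` passes. The counter lies on `ctl` above an end mark, so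
loops can be nested on the same stack; in return `b` must work above any content `l` of `ctl` and
give it back. -/
lemma does_forSize {b : RProg V R} {n B : ℕ} (F : ℕ → RStacks V R)
    (hsize : F 0 .size = unary n) (htmp : F 0 .tmp = [])
    (hb : ∀ i < n, ∀ l, Does b (update (F i) .ctl l) (update (F (i + 1)) .ctl l) B) :
    Does (forSize b) (F 0) (update (F n) .ctl (F 0 .ctl)) (n * (B + 9) + 9) := by
  set c := F 0 .ctl with hc
  -- Here `i` passes are done and `j` remain. The statement begins with a pop because each pass of
  -- the loop ends with one.
  have key : ∀ j i, i + j = n → ∀ v, ∃ v' t, t ≤ j * (B + 2) + 2 ∧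
      Runs (seq (pop .ctl) (loop (fun v => decide (v = some Token.digit)) (seq b (pop .ctl)))) v
        (update (F i) .ctl (unary j ++ .endNum :: c)) v' (update (F n) .ctl c) t := by
    intro j
    induction j with
    | zero =>
      intro i hi v
      obtain rfl : i = n := by omega
      have h1 : Runs (pop .ctl) v (update (F i) .ctl (unary 0 ++ .endNum :: c)) (some .endNum)
          (update (F i) .ctl c) 1 := by
        simpa using Runs.pop .ctl v (update (F i) .ctl (unary 0 ++ .endNum :: c))
      exact ⟨_, _, by omega, h1.seq (.loop_false _ _ rfl)⟩
    | succ j ih =>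
      intro i hi v
      have h1 : Runs (pop .ctl) v (update (F i) .ctl (unary (j + 1) ++ .endNum :: c))
          (some .digit) (update (F i) .ctl (unary j ++ .endNum :: c)) 1 := by
        simpa [List.replicate_succ] using
          Runs.pop .ctl v (update (F i) .ctl (unary (j + 1) ++ .endNum :: c))
      obtain ⟨v₁, t₁, ht₁, hr₁⟩ := hb i (by omega) (unary j ++ .endNum :: c) (some .digit)
      obtain ⟨v', t', ht', hr'⟩ := ih (i + 1) (by omega) v₁
      cases hr' with
      | @seq _ _ _ _ _ _ _ _ t₂ t₃ hp hl =>
        have : (j + 1) * (B + 2) = j * (B + 2) + (B + 2) := by ring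
        exact ⟨v', _, by omega, h1.seq (.loop_true rfl (hr₁.seq hp) hl)⟩
  refine ((does_push_const _ _ _).seq ((does_copyTo (by simp) (by simp) (by simp) ?_).seq
    fun v => (?_ : ∃ v' t, t ≤ n * (B + 2) + 2 ∧ _))).mono ?_
  · simpa using htmp
  · obtain ⟨v', t, ht, hr⟩ := key n 0 (by omega) v
    refine ⟨v', t, ht, ?_⟩
    convert hr using 1
    simp [hsize, hc]
  · simp [hsize]
    ring_nf
    omega

end StackProg

end ShExVal

/-! ### Numbering of tuples and random access to stacks -/

namespace ShExVal

open Function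

/-- The position of a tuple over `0, …, n - 1` in the enumeration of all tuples of its length. -/
def tupleIndex (n : ℕ) : List ℕ → ℕ
  | [] => 0
  | x :: l => tupleIndex n l * n + x

/-- The index is the number whose base `n` digits form the tuple, least significant digit first. -/
lemma tupleIndex_lt {n : ℕ} {l : List ℕ} (h : ∀ x ∈ l, x < n) :
    tupleIndex n l < n ^ l.length := by
  induction l with
  | nil => simp [tupleIndex]
  | cons x l ih =>
    have h1 := ih fun y hy => h y (List.mem_cons_of_mem _ hy)
    have h2 := h x List.mem_cons_self
    calc tupleIndex n l * n + x < tupleIndex n l * n + n := by omega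
      _ = (tupleIndex n l + 1) * n := by ring
      _ ≤ n ^ l.length * n := Nat.mul_le_mul_right _ h1
      _ = n ^ (x :: l).length := by rw [List.length_cons, pow_succ]

namespace StackProg

variable {V R : Type} [DecidableEq V] [DecidableEq R]

/-- Put the index of the tuple of the values of the variables on the stack `idx`. -/
def pushIndex : List V → RProg V R
  | [] => clear .idx
  | i :: vs => seq (pushIndex vs) <| seq (moveTo .idx .idx') <|
      seq (whilePop .idx' (copyTo .size .idx .tmp)) (copyTo (.reg i) .idx .tmp)

/-- The stacks represent the word `w`, the size `n`, and the values `e` of the variables, and the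
auxiliary stacks are empty. -/
structure Ready (w : List Token) (n : ℕ) (e : V → ℕ) (S : RStacks V R) : Prop where
  word : S .word = w
  size : S .size = unary n
  tmp : S .tmp = []
  idx : S .idx = []
  idx' : S .idx' = []
  buf : S .buf = []
  reg : ∀ i, S (.reg i) = unary (e i)

/-- Multiplication by repeated addition: every digit of `idx'` contributes one copy of `size`. -/
lemma does_mulSize (n m k : ℕ) (S : RStacks V R) (hs : S .size = unary n) (ht : S .tmp = [])
    (hm : S .idx' = unary m) (hk : S .idx = unary k) :
    Does (whilePop .idx' (copyTo .size .idx .tmp)) S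
      (update (update S .idx' []) .idx (unary (m * n + k))) (m * (7 * n + 6) + 2) := by
  induction m generalizing S k with
  | zero =>
    refine (does_whilePop_nil _ (by simpa using hm)).congr ?_ (by omega)
    funext x
    cases x <;> simp_all
  | succ m ih =>
    rw [unary, List.replicate_succ] at hm
    refine (does_whilePop_cons' hm (does_copyTo (by simp) (by simp) (by simp) (by simpa))
      (ih (n + k) _ ?_ ?_ ?_ ?_)).congr ?_ ?_
    · simpa
    · simpa
    · simp
    · simp [hs, hk]
    · funext x
      have : m * n + (n + k) = (m + 1) * n + k := by ring
      cases x <;> simp_all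
    · simp [hs]
      ring_nf
      omega

/-- Horner's scheme in base `n`. The polynomial depends only on the list of variables; it bounds the
time because indices stay below `n ^ vs.length`. -/
lemma does_pushIndex (vs : List V) : ∃ P : Polynomial ℕ, ∀ (w : List Token) (n : ℕ) (e : V → ℕ)
    (S : RStacks V R), Ready w n e S → (∀ i, e i < n) →
    Does (pushIndex vs) S (update S .idx (unary (tupleIndex n (vs.map e)))) (P.eval n) := by
  induction vs with
  | nil =>
    refine ⟨2, fun w n e S hS he => ?_⟩
    refine (does_clear _ _).congr ?_ ?_
    · simp [tupleIndex]
    · simp [hS.idx]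
  | cons i vs ih =>
    obtain ⟨P, hP⟩ := ih
    refine ⟨P + (10 * Polynomial.X + 10) * (Polynomial.X ^ vs.length + 1), fun w n e S hS he => ?_⟩
    have hlt : tupleIndex n (vs.map e) < n ^ vs.length := by
      simpa using tupleIndex_lt (n := n) (l := vs.map e) (by simpa using fun a _ => he a)
    refine ((hP w n e S hS he).seq ((does_moveTo (by simp) _).seq
      ((does_mulSize n (tupleIndex n (vs.map e)) 0 _ ?_ ?_ ?_ ?_).seq
        (does_copyTo (by simp) (by simp) (by simp) ?_)))).congr ?_ ?_
    · simp [hS.size]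
    · simp [hS.tmp]
    · simp [hS.idx']
    · simp
    · simp [hS.tmp]
    · funext x
      have := hS.idx'
      have := hS.reg i
      cases x <;> simp_all [tupleIndex, Nat.add_comm]
    · have h1 := he i
      simp [hS.reg i]
      generalize tupleIndex n (vs.map e) = m at *
      generalize n ^ vs.length = N at *
      have : m * (7 * n + 6) ≤ N * (7 * n + 6) := Nat.mul_le_mul_right _ hlt.le
      nlinarith

/-- Read the entry of the stack `k` at the depth given by `idx`, and push the truth value of `c`
for this entry. -/
def readAt (k : Stk V R) (c : Option Token → Bool) : RProg V R :=
  seq (whilePop .idx <| seq (pop k) <|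
      ite Option.isSome (push .buf fun v => v.getD default) (skip .tmp)) <|
    seq (seq (pop k) <| seq (push .bools fun v => bit (c v)) <|
      ite Option.isSome (push k fun v => v.getD default) (skip .tmp)) (moveTo .buf k)

/-- The test after the pop matters if `k` has fewer than `m` entries: the remaining rounds then only
consume the counter. -/
lemma does_shift {k : Stk V R} (hk : k ≠ .idx) (hk' : k ≠ .buf) (m : ℕ) (S : RStacks V R)
    (hm : S .idx = unary m) :
    Does (whilePop .idx <| seq (pop k) <|
      ite Option.isSome (push .buf fun v => v.getD default) (skip .tmp)) S
      (update (update (update S .idx []) k ((S k).drop m)) .buf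
        (((S k).take m).reverse ++ S .buf)) (m * 5 + 2) := by
  induction m generalizing S with
  | zero =>
    refine (does_whilePop_nil _ (by simpa using hm)).congr ?_ (by omega)
    funext x
    simp only [update_apply]
    split_ifs <;> simp_all
  | succ m ih =>
    rw [unary, List.replicate_succ] at hm
    rcases hl : S k with _ | ⟨a, l⟩
    · have hd : update S .idx (unary m) k = [] := by simp [hk, hl]
      have hb : Runs (ite Option.isSome (push .buf fun v => v.getD default) (skip .tmp))
          (update S .idx (unary m) k).head?
          (update (update S .idx (unary m)) k (update S .idx (unary m) k).tail) none
          (update S .idx (unary m)) 2 := by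
        rw [hd, List.tail_nil, ← hd, update_eq_self, hd]
        exact .ite_false _ rfl (runs_skip _ _ _)
      refine (does_whilePop_cons' (T := 3) hm (does_pop_seq ⟨_, 2, le_rfl, hb⟩)
        (ih _ ?_)).congr ?_ ?_
      · simp
      · funext x
        simp only [update_apply]
        split_ifs <;> simp_all
      · omega
    · refine (does_whilePop_cons' (T := 3) hm
        (does_pop_seq ⟨_, 2, le_rfl, .ite_true _ ?_ (.push _ _ _ _)⟩) (ih _ ?_)).congr ?_ ?_
      · simp [hk, hl]
      · simp [hk.symm]
      · funext x
        simp only [update_apply]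
        split_ifs <;> simp_all
      · omega

/-- The entries above the wanted one are parked on `buf` and moved back afterwards, so `k` is
unchanged. A position beyond the end is read as `none`. -/
lemma does_readAt {k : Stk V R} (hk : k ≠ .idx) (hk' : k ≠ .buf) (hk'' : k ≠ .bools)
    (c : Option Token → Bool) (m : ℕ) (S : RStacks V R) (hm : S .idx = unary m)
    (hbuf : S .buf = []) :
    Does (readAt k c) S (update (update S .idx []) .bools (bit (c (S k)[m]?) :: S .bools))
      (m * 8 + 10) := by
  have h1 := does_shift hk hk' m S hm
  set S₁ := update (update (update S .idx []) k ((S k).drop m)) .buf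
    (((S k).take m).reverse ++ S .buf) with hS₁
  have h2 : Does (seq (pop k) <| seq (push .bools fun v => bit (c v)) <|
      (ite Option.isSome (push k fun v => v.getD default) (skip .tmp))) S₁
      (update S₁ .bools (bit (c (S k)[m]?) :: S .bools)) 4 := by
    have hd : S₁ k = (S k).drop m := by simp [hS₁, hk']
    refine does_pop_seq ?_
    have hh : (S₁ k).head? = (S k)[m]? := by rw [hd, List.head?_drop]
    rw [hh]
    have hb : S₁ .bools = S .bools := by simp [hS₁, hk''.symm]
    rcases hv : (S k)[m]? with _ | a
    · have hd' : S₁ k = [] := by rw [hd]; simpa using hv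
      refine ⟨none, 3, le_rfl, ?_⟩
      rw [hd', List.tail_nil, ← hd', update_eq_self, ← hb]
      exact (Runs.push _ _ _ _).seq (.ite_false _ rfl (runs_skip _ _ _))
    · have hd' : S₁ k = a :: (S₁ k).tail := by
        rw [← hh] at hv
        exact (List.cons_head?_tail hv).symm
      refine ⟨some a, 3, le_rfl, ?_⟩
      have hp := (Runs.push .bools (fun v => bit (c v)) (some a) (update S₁ k (S₁ k).tail)).seq
        (Runs.ite_true (c := Option.isSome) (skip .tmp) rfl
          (.push k (fun v => v.getD default) _ _))
      convert hp using 1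
      funext x
      simp only [update_apply]
      split_ifs <;> simp_all
  refine (h1.seq (h2.seq (does_moveTo hk'.symm _))).congr ?_ ?_
  · funext x
    simp only [hS₁, update_apply]
    split_ifs <;> simp_all
  · simp [hS₁, hbuf]
    omega

end StackProg

end ShExVal

/-! ### Evaluation of first-order formulas -/

namespace ShExVal

open Function

namespace StackProg

variable {V R : Type} [DecidableEq V] [DecidableEq R]

/-- Replace the two topmost truth values by their conjunction. -/
def popAnd : RProg V R :=
  seq (pop .bools) <| ite (fun v => decide (v = some .digit)) (skip .tmp) <|
    seq (pop .bools) (push .bools fun _ => .endNum)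

/-- Replace the two topmost truth values by their disjunction. -/
def popOr : RProg V R :=
  seq (pop .bools) <| ite (fun v => decide (v = some .digit))
    (seq (pop .bools) (push .bools fun _ => .digit)) (skip .tmp)

/-- Push the truth value of a formula on the stack `bools`. -/
def evalProg : Fml V R → RProg V R
  | .tok a i => seq (copyTo (.reg i) .idx .tmp) (readAt .word fun v => decide (v = some a))
  | .lt i j => seq (copyTo (.reg i) .idx .tmp) <| seq (copyTo (.reg j) .idx' .tmp) <|
      seq (readAt .idx' Option.isSome) (clear .idx')
  | .rel x vs => seq (pushIndex vs) (readAt (.rel x) fun v => decide (v = some .digit))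
  | .not φ => seq (evalProg φ) <| seq (pop .bools) <|
      push .bools fun v => bit (decide (v ≠ some .digit))
  | .and φ ψ => seq (evalProg φ) <| seq (evalProg ψ) popAnd
  | .ex i φ => seq (push .bools fun _ => .endNum) <| seq
      (forSize <| seq (evalProg φ) <| seq popOr (push (.reg i) fun _ => .digit)) (clear (.reg i))

/-- The stacks of the relations contain the relations `s` over `0, …, n - 1` in the order of the
indices of the tuples. -/
def Represents (ar : R → ℕ) (n : ℕ) (s : R → List ℕ → Prop) (S : RStacks V R) : Prop :=
  ∀ x l, l.length = ar x → (∀ a ∈ l, a < n) →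
    ((S (.rel x))[tupleIndex n l]? = some .digit ↔ s x l)

lemma bit_eq_digit {b : Bool} : bit b = .digit ↔ b = true := by cases b <;> simp [bit]

open Classical in
/-- The symbol for the truth value of a proposition. -/
noncomputable def propBit (p : Prop) : Token := bit (decide p)

lemma propBit_eq_digit {p : Prop} : propBit p = .digit ↔ p := by simp [propBit, bit_eq_digit]

lemma bit_decide (p : Prop) [Decidable p] : bit (decide p) = propBit p := by
  unfold propBit; congr

lemma propBit_congr {p q : Prop} (h : p ↔ q) : propBit p = propBit q := by rw [propext h]

lemma propBit_of {p : Prop} (h : p) : propBit p = .digit := propBit_eq_digit.2 h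

lemma propBit_of_not {p : Prop} (h : ¬ p) : propBit p = .endNum := by simp [propBit, bit, h]

lemma does_pop_bools {p : RProg V R} {S S' : RStacks V R} {a : Token} {l : List Token} {T : ℕ}
    (h : ∃ v' t, t ≤ T ∧ Runs p (some a) (update S .bools l) v' S' t) :
    Does (seq (pop .bools) p) (update S .bools (a :: l)) S' (T + 1) :=
  does_pop_seq (by simpa using h)

lemma does_popAnd (S : RStacks V R) (p q : Prop) (l : List Token) :
    Does popAnd (update S .bools (propBit q :: propBit p :: l))
      (update S .bools (propBit (p ∧ q) :: l)) 4 := by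
  refine does_pop_bools ?_
  by_cases hq : q
  · refine ⟨some (propBit q), 2, by omega, .ite_true _ (by simp [propBit_eq_digit, hq]) ?_⟩
    simpa [hq] using runs_skip .tmp (some (propBit q)) (update S .bools (propBit p :: l))
  · refine ⟨some (propBit p), 3, by omega, .ite_false _ (by simp [propBit_eq_digit, hq]) ?_⟩
    simpa [hq, propBit_of_not not_false] using (Runs.pop .bools (some (propBit q))
      (update S .bools (propBit p :: l))).seq (.push .bools (fun _ => .endNum) _ _)

lemma does_popOr (S : RStacks V R) (p q : Prop) (l : List Token) :
    Does popOr (update S .bools (propBit q :: propBit p :: l))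
      (update S .bools (propBit (p ∨ q) :: l)) 4 := by
  refine does_pop_bools ?_
  by_cases hq : q
  · refine ⟨some (propBit p), 3, by omega, .ite_true _ (by simp [propBit_eq_digit, hq]) ?_⟩
    simpa [hq, propBit_of trivial] using (Runs.pop .bools (some (propBit q))
      (update S .bools (propBit p :: l))).seq (.push .bools (fun _ => .digit) _ _)
  · refine ⟨some (propBit q), 2, by omega, .ite_false _ (by simp [propBit_eq_digit, hq]) ?_⟩
    simpa [hq] using runs_skip .tmp (some (propBit q)) (update S .bools (propBit p :: l))

lemma Ready.update_bools {w : List Token} {n : ℕ} {e : V → ℕ} {S : RStacks V R}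
    (h : Ready w n e S) (l : List Token) : Ready w n e (update S .bools l) := by
  constructor <;> simp [h.word, h.size, h.tmp, h.idx, h.idx', h.buf, h.reg]

lemma Ready.update_ctl {w : List Token} {n : ℕ} {e : V → ℕ} {S : RStacks V R}
    (h : Ready w n e S) (l : List Token) : Ready w n e (update S .ctl l) := by
  constructor <;> simp [h.word, h.size, h.tmp, h.idx, h.idx', h.buf, h.reg]

lemma Ready.update_new {w : List Token} {n : ℕ} {e : V → ℕ} {S : RStacks V R}
    (h : Ready w n e S) (l : List Token) : Ready w n e (update S .new l) := by
  constructor <;> simp [h.word, h.size, h.tmp, h.idx, h.idx', h.buf, h.reg]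

lemma Ready.update_reg {w : List Token} {n : ℕ} {e : V → ℕ} {S : RStacks V R}
    (h : Ready w n e S) (i : V) (m : ℕ) :
    Ready w n (update e i m) (update S (.reg i) (unary m)) := by
  refine ⟨by simp [h.word], by simp [h.size], by simp [h.tmp], by simp [h.idx], by simp [h.idx'],
    by simp [h.buf], fun j => ?_⟩
  by_cases hj : j = i
  · subst hj; simp
  · simp [hj, h.reg]

/-- Induction on the formula, with a polynomial that does not depend on the data. Variables out of
scope are required to be `0`: the register of a variable about to be quantified is then empty,
serves as the running value of the search, and is empty again after being cleared. This is why a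
formula must not bind a variable that is in scope. -/
lemma does_evalProg (ar : R → ℕ) (φ : Fml V R) : ∀ sc : List V, φ.Wf ar sc →
    ∃ P : Polynomial ℕ, ∀ (w : List Token) (n : ℕ) (s : R → List ℕ → Prop) (e : V → ℕ)
      (S : RStacks V R), Ready w n e S → Represents ar n s S → (∀ i, e i < n) →
      (∀ i ∉ sc, e i = 0) →
      Does (evalProg φ) S (update S .bools (propBit (φ.eval w n s e) :: S .bools)) (P.eval n) := by
  induction φ with
  | tok a i =>
    refine fun sc _ => ⟨15 * Polynomial.X + 14, fun w n s e S hS hs he hsc => ?_⟩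
    refine ((does_copyTo (by simp) (by simp) (by simp) hS.tmp).seq
      (does_readAt (by simp) (by simp) (by simp) _ (e i) _ ?_ ?_)).congr ?_ ?_
    · simp [hS.idx, hS.reg]
    · simp [hS.buf]
    · have := hS.idx
      have := hS.word
      funext x
      cases x <;> simp_all [bit_decide, Fml.eval]
    · have := he i
      simp [hS.reg i]
      omega
  | lt i j =>
    refine fun sc _ => ⟨25 * Polynomial.X + 30, fun w n s e S hS hs he hsc => ?_⟩
    refine ((does_copyTo (by simp) (by simp) (by simp) hS.tmp).seq
      ((does_copyTo (by simp) (by simp) (by simp) (by simpa using hS.tmp)).seq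
      ((does_readAt (by simp) (by simp) (by simp) _ (e i) _ ?_ ?_).seq
        (does_clear _ _)))).congr ?_ ?_
    · simp [hS.idx, hS.reg]
    · simp [hS.buf]
    · have h1 := hS.idx
      have h2 := hS.idx'
      -- Comparison is done by access: a list of length `e j` has an entry at depth `e i` exactly if
      -- `e i < e j`.
      have : bit (unary (e j))[e i]?.isSome = propBit (e i < e j) := by
        rw [← bit_decide]
        congr 1
        rw [Bool.eq_iff_iff]
        simp
      funext x
      have := hS.reg j
      cases x <;> simp_all [Fml.eval]
    · have := he i
      have := he j
      simp [hS.reg i, hS.reg j, hS.idx']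
      omega
  | rel x vs =>
    intro sc hwf
    obtain ⟨P, hP⟩ := does_pushIndex (R := R) vs
    refine ⟨P + 8 * Polynomial.X ^ vs.length + 10, fun w n s e S hS hs he hsc => ?_⟩
    refine ((hP w n e S hS he).seq
      (does_readAt (by simp) (by simp) (by simp) _ (tupleIndex n (vs.map e)) _ ?_ ?_)).congr ?_ ?_
    · simp
    · simp [hS.buf]
    · have h1 := hs x (vs.map e) (by simpa [Fml.Wf] using hwf) (by simpa using fun a _ => he a)
      have := hS.idx
      rw [bit_decide]
      funext x
      cases x <;> simp_all [Fml.eval]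
    · have hlt : tupleIndex n (vs.map e) < n ^ vs.length := by
        simpa using tupleIndex_lt (n := n) (l := vs.map e) (by simpa using fun a _ => he a)
      simp
      omega
  | not φ ih =>
    intro sc hwf
    obtain ⟨P, hP⟩ := ih sc hwf
    refine ⟨P + 2, fun w n s e S hS hs he hsc => ?_⟩
    refine ((hP w n s e S hS hs he hsc).seq
      (does_pop_bools ⟨_, _, le_rfl, .push _ _ _ _⟩)).congr ?_ ?_
    · have : bit (decide (some (propBit (φ.eval w n s e)) ≠ some .digit)) =
          propBit (¬ φ.eval w n s e) := by
        rw [bit_decide]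
        exact propBit_congr (by simp [propBit_eq_digit])
      simp only [this, Fml.eval, update_idem, update_self]
    · simp
  | and φ ψ ih ih' =>
    intro sc hwf
    obtain ⟨P, hP⟩ := ih sc hwf.1
    obtain ⟨Q, hQ⟩ := ih' sc hwf.2
    refine ⟨P + Q + 4, fun w n s e S hS hs he hsc => ?_⟩
    have h2 := hQ w n s e _ (hS.update_bools (propBit (φ.eval w n s e) :: S .bools)) (by simpa [Represents] using hs) he hsc
    refine ((hP w n s e S hS hs he hsc).seq (h2.seq ?_)).congr rfl
      (by simp only [Polynomial.eval_add]; exact (add_assoc _ _ _).symm.le)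
    simpa [Fml.eval] using does_popAnd S (φ.eval w n s e) (ψ.eval w n s e) (S .bools)
  | ex i φ ih =>
    intro sc hwf
    obtain ⟨P, hP⟩ := ih (i :: sc) hwf.2
    refine ⟨Polynomial.X * (P + 14) + 3 * Polynomial.X + 12, fun w n s e S hS hs he hsc => ?_⟩
    have hi : S (.reg i) = [] := by rw [hS.reg, hsc i hwf.1]; rfl
    -- After `m` passes the register holds the next candidate `m`, and the top of `bools` tells
    -- whether one of the candidates before it is a witness.
    set F : ℕ → RStacks V R := fun m => update (update S (.reg i) (unary m)) .bools
      (propBit (∃ x < m, φ.eval w n s (update e i x)) :: S .bools) with hF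
    have h0 : update S .bools (.endNum :: S .bools) = F 0 := by
      simp only [hF, unary, List.replicate_zero, ← hi, update_eq_self]
      rw [propBit_of_not (by simp)]
    have key := does_forSize (n := n) (B := P.eval n + 5)
      (b := seq (evalProg φ) <| seq popOr (push (.reg i) fun _ => .digit)) F
      (by simp [hF, hS.size]) (by simp [hF, hS.tmp]) ?_
    · rw [← h0] at key
      refine ((does_push_const _ _ _).seq (key.seq (does_clear _ _))).congr ?_ ?_
      · funext x
        simp only [hF, update_apply, Fml.eval]
        split_ifs <;> simp_all
      · simp [hF]
        ring_nf
        omega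
    · intro m hm l
      have hS' : Ready w n (update e i m) (update (F m) .ctl l) :=
        ((hS.update_reg i m).update_bools _).update_ctl l
      have he' : ∀ j, update e i m j < n := by
        intro j
        by_cases hj : j = i
        · subst hj; simpa
        · simpa [hj] using he j
      have hsc' : ∀ j ∉ i :: sc, update e i m j = 0 := by
        intro j hj
        rw [List.mem_cons, not_or] at hj
        simpa [hj.1] using hsc j hj.2
      have h1 := hP w n s _ _ hS' (by simpa [Represents, hF] using hs)
        he' hsc'
      have h2 : (∃ x < m + 1, φ.eval w n s (update e i x)) ↔
          (∃ x < m, φ.eval w n s (update e i x)) ∨ φ.eval w n s (update e i m) := by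
        simp only [Nat.lt_succ_iff_lt_or_eq, or_and_right, exists_or, exists_eq_left]
      have h3 := does_popOr (update (F m) .ctl l) (∃ x < m, φ.eval w n s (update e i x))
        (φ.eval w n s (update e i m)) (S .bools)
      rw [← propBit_congr h2] at h3
      refine (h1.seq (Does.seq (T := 4) (S' := update (update (F m) .ctl l) .bools
        (propBit (∃ x < m + 1, φ.eval w n s (update e i x)) :: S .bools)) ?_
        (does_push_const _ _ _))).congr ?_ le_rfl
      · convert h3 using 2
        simp [hF]
      · funext x
        rcases x with _ | _ | _ | _ | _ | _ | _ | _ | _ | j | _ <;>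
          simp [hF, List.replicate_succ, update_apply]
        split_ifs <;> rfl

end StackProg

end ShExVal

/-! ### Assignment of relations and programs over relations -/

namespace ShExVal

open Function

/-- The tuple of length `k` with a given index. -/
def tupleOf (n : ℕ) : ℕ → ℕ → List ℕ
  | 0, _ => []
  | k + 1, m => (m % n) :: tupleOf n k (m / n)

lemma tupleOf_tupleIndex {n : ℕ} {l : List ℕ} (h : ∀ x ∈ l, x < n) :
    tupleOf n l.length (tupleIndex n l) = l := by
  induction l with
  | nil => rfl
  | cons x l ih =>
    have hx := h x List.mem_cons_self
    have hn : 0 < n := by omega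
    simp only [List.length_cons, tupleOf, tupleIndex]
    rw [Nat.add_comm, Nat.add_mul_mod_self_right, Nat.mod_eq_of_lt hx,
      Nat.add_mul_div_right _ _ hn, Nat.div_eq_of_lt hx, Nat.zero_add,
      ih fun y hy => h y (List.mem_cons_of_mem _ hy)]

/-- Division with remainder turns a single run through all indices into two nested loops; this is
the step from `vs` to `i :: vs` in `does_forVars`. -/
lemma flatMap_reverse_range_mul {β : Type} (m n : ℕ) (h : ℕ → ℕ → List β) :
    (List.range (m * n)).reverse.flatMap (fun i => h (i / n) (i % n)) =
      (List.range m).reverse.flatMap fun a => (List.range n).reverse.flatMap (h a) := by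
  induction m with
  | zero => simp
  | succ m ih =>
    rw [Nat.succ_mul, List.range_add, List.reverse_append, List.flatMap_append, ih,
      List.range_succ, List.reverse_append, List.flatMap_append]
    congr 1
    rw [← List.map_reverse, List.flatMap_map]
    simp only [List.reverse_singleton, List.flatMap_singleton]
    apply List.flatMap_congr
    intro i hi
    have hi' : i < n := by simpa using hi
    have hn : 0 < n := by omega
    rw [Nat.add_comm, Nat.add_mul_mod_self_right, Nat.mod_eq_of_lt hi',
      Nat.add_mul_div_right _ _ hn, Nat.div_eq_of_lt hi', Nat.zero_add]

namespace StackProg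

variable {V R : Type} [DecidableEq V] [DecidableEq R]

/-- Execute `b` for all values of the variable `i`. -/
def forVar (i : V) (b : RProg V R) : RProg V R :=
  seq (forSize (seq b (push (.reg i) fun _ => .digit))) (clear (.reg i))

/-- Execute `b` for all values of some variables. -/
def forVars : List V → RProg V R → RProg V R
  | [], b => b
  | i :: vs, b => forVars vs (forVar i b)

/-- A time bound for `forVars` with `k` variables, if the body takes time `B`. -/
def forVarsTime (n : ℕ) : ℕ → ℕ → ℕ
  | 0, B => B
  | k + 1, B => forVarsTime n k (n * (B + 13) + 11)

lemma exists_forVarsTime_eq (k : ℕ) (P : Polynomial ℕ) :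
    ∃ Q : Polynomial ℕ, ∀ n, forVarsTime n k (P.eval n) = Q.eval n := by
  induction k generalizing P with
  | zero => exact ⟨P, fun _ => rfl⟩
  | succ k ih =>
    obtain ⟨Q, hQ⟩ := ih (Polynomial.X * (P + 13) + 11)
    exact ⟨Q, fun n => by rw [← hQ]; simp [forVarsTime]⟩

lemma does_forVar {w : List Token} {n B : ℕ} {i : V} {b : RProg V R} {e : V → ℕ}
    {S : RStacks V R} (g : (V → ℕ) → List Token) (hS : Ready w n e S) (hi : e i = 0)
    (hb : ∀ m < n, ∀ l l', Does b (update (update (update S (.reg i) (unary m)) .new l') .ctl l)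
      (update (update (update S (.reg i) (unary m)) .new (g (update e i m) ++ l')) .ctl l) B) :
    Does (forVar i b) S (update S .new
      ((List.range n).reverse.flatMap (fun m => g (update e i m)) ++ S .new))
      (n * (B + 13) + 11) := by
  set F : ℕ → RStacks V R := fun m => update (update S (.reg i) (unary m)) .new
    ((List.range m).reverse.flatMap (fun m => g (update e i m)) ++ S .new) with hF
  have hi' : S (.reg i) = [] := by rw [hS.reg, hi]; rfl
  have h0 : S = F 0 := by
    simp [hF, ← hi']
  have key := does_forSize (n := n) (B := B + 1) (b := seq b (push (.reg i) fun _ => .digit)) F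
    (by simp [hF, hS.size]) (by simp [hF, hS.tmp]) ?_
  · rw [← h0] at key
    refine (key.seq (does_clear _ _)).congr ?_ ?_
    · funext x
      rcases x with _ | _ | _ | _ | _ | _ | _ | _ | _ | j | _ <;> simp [hF, update_apply]
      by_cases h : j = i
      · simp [h, hi']
      · simp [h]
    · simp [hF]
      ring_nf
      omega
  · intro m hm l
    refine ((hb m hm l ((List.range m).reverse.flatMap (fun m => g (update e i m)) ++ S .new)).seq
      (does_push_const _ _ _)).congr ?_ le_rfl
    funext x
    rcases x with _ | _ | _ | _ | _ | _ | _ | _ | _ | j | _ <;>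
      simp [hF, update_apply, List.range_succ, List.replicate_succ]
    split_ifs <;> rfl

/-- The head of the list is the innermost loop, in accordance with `tupleIndex`, whose least
significant digit is the head. The results are pushed in increasing order of the index, so they lie
on `new` in decreasing order. -/
lemma does_forVars {ar : R → ℕ} {w : List Token} {n : ℕ} {s : R → List ℕ → Prop} (hn : 0 < n)
    (vs : List V) : ∀ (B : ℕ) (b : RProg V R) (g : (V → ℕ) → List Token), vs.Nodup →
    (∀ e S, Ready w n e S → Represents ar n s S → (∀ i, e i < n) → (∀ i ∉ vs, e i = 0) →
      Does b S (update S .new (g e ++ S .new)) B) → ∀ S, Ready w n (fun _ => 0) S →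
    Represents ar n s S → Does (forVars vs b) S (update S .new
      ((List.range (n ^ vs.length)).reverse.flatMap
        (fun m => g (assignEnv vs (tupleOf n vs.length m))) ++ S .new))
      (forVarsTime n vs.length B) := by
  induction vs with
  | nil =>
    intro B b g _ hb S hS hs
    simpa [assignEnv, forVars, forVarsTime] using hb _ S hS hs (fun _ => hn) (fun _ _ => rfl)
  | cons i vs ih =>
    intro B b g hvs hb S hS hs
    rw [List.nodup_cons] at hvs
    have := ih (n * (B + 13) + 11) (forVar i b)
      (fun e => (List.range n).reverse.flatMap fun m => g (update e i m)) hvs.2 ?_ S hS hs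
    · refine this.congr ?_ le_rfl
      congr 2
      rw [← flatMap_reverse_range_mul (n ^ vs.length) n
        (fun a c => g (update (assignEnv vs (tupleOf n vs.length a)) i c)), List.length_cons,
        pow_succ]
      rfl
    · intro e S hS hs he hsc
      refine does_forVar g hS (hsc i hvs.1) fun m hm l l' => ?_
      refine (hb (update e i m) _ (((hS.update_reg i m).update_new l').update_ctl l)
        (by simpa [Represents] using hs) ?_ ?_).congr ?_ le_rfl
      · intro j
        by_cases hj : j = i
        · subst hj; simpa
        · simpa [hj] using he j
      · intro j hj
        rw [List.mem_cons, not_or] at hj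
        simpa [hj.1] using hsc j hj.2
      · funext x
        cases x <;> simp

/-- Assign a relation. -/
def assignProg (x : R) (vs : List V) (φ : Fml V R) : RProg V R :=
  seq (forVars vs <| seq (evalProg φ) <| seq (pop .bools) (push .new fun v => v.getD default)) <|
    seq (clear (.rel x)) (moveTo .new (.rel x))

/-- Stack programs for programs over relations. -/
def relProg : RelProg V R → RProg V R
  | .assign x vs φ => assignProg x vs φ
  | .seq p q => seq (relProg p) (relProg q)
  | .loop p => forSize (relProg p)

/-- The stacks between the steps of a program over relations. -/
def baseStacks (w : List Token) (n : ℕ) (rels : R → List Token) (ctl : List Token) : RStacks V R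
  | .word => w
  | .size => unary n
  | .ctl => ctl
  | .rel x => rels x
  | _ => []

omit [DecidableEq R] [DecidableEq V] in
lemma ready_baseStacks (w : List Token) (n : ℕ) (rels : R → List Token) (ctl : List Token) :
    Ready (V := V) w n (fun _ => 0) (baseStacks w n rels ctl) := by
  constructor <;> simp [baseStacks]

/-- The lists `rels` represent the relations `s` over `0, …, n - 1`. -/
def Lists (ar : R → ℕ) (n : ℕ) (s : R → List ℕ → Prop) (rels : R → List Token) : Prop :=
  (∀ x l, l.length = ar x → (∀ a ∈ l, a < n) →
    ((rels x)[tupleIndex n l]? = some .digit ↔ s x l)) ∧ ∀ x, (rels x).length ≤ n ^ ar x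

/-- The table is completed on `new` before the old one is discarded, so `φ` may refer to `x` itself.
The final move reverses `new` into the order of the indices. The length bound in `Lists` pays for
clearing the old table. -/
lemma does_assignProg (ar : R → ℕ) (x : R) (vs : List V) (φ : Fml V R)
    (hp : (RelProg.assign x vs φ).Wf ar) : ∃ P : Polynomial ℕ, ∀ (w : List Token) (n : ℕ)
      (s : R → List ℕ → Prop) (rels : R → List Token), 0 < n → Lists ar n s rels →
      ∃ rels', Lists ar n ((RelProg.assign x vs φ).run w n s) rels' ∧ ∀ l,
        Does (assignProg x vs φ) (baseStacks w n rels l) (baseStacks w n rels' l) (P.eval n) := by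
  obtain ⟨hlen, hnd, hφ⟩ := hp
  obtain ⟨P, hP⟩ := does_evalProg ar φ vs hφ
  obtain ⟨Q, hQ⟩ := exists_forVarsTime_eq vs.length (P + 2)
  refine ⟨Q + 6 * Polynomial.X ^ ar x + 4, fun w n s rels hn hs => ?_⟩
  set L : List Token := (List.range (n ^ vs.length)).map fun m =>
    propBit (φ.eval w n s (assignEnv vs (tupleOf n vs.length m))) with hL
  refine ⟨update rels x L, ⟨fun y l hl hln => ?_, fun y => ?_⟩, fun l => ?_⟩
  · by_cases hy : y = x
    · subst hy
      have h1 := tupleIndex_lt hln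
      have h2 := tupleOf_tupleIndex hln
      rw [hl, ← hlen] at h1 h2
      simp [hL, h1, h2, propBit_eq_digit, RelProg.run]
    · simpa [hy, RelProg.run] using hs.1 y l hl hln
  · by_cases hy : y = x
    · subst hy
      simp [hL, hlen]
    · simpa [hy] using hs.2 y
  · have h1 := does_forVars (V := V) (ar := ar) (w := w) (s := s) hn vs ((P + 2).eval n)
      (seq (evalProg φ) <| seq (pop .bools) (push .new fun v => v.getD default))
      (fun e => [propBit (φ.eval w n s e)]) hnd ?_ (baseStacks w n rels l)
      (ready_baseStacks w n rels l) (by simpa [Represents, baseStacks] using hs.1)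
    · refine (h1.seq ((does_clear _ _).seq (does_moveTo (by simp) _))).congr ?_ ?_
      · have hL' : (List.range (n ^ vs.length)).reverse.flatMap (fun m =>
            [propBit (φ.eval w n s (assignEnv vs (tupleOf n vs.length m)))]) = L.reverse := by
          rw [hL, ← List.map_reverse, List.map_eq_flatMap]
        rw [hL']
        funext y
        rcases y with _ | _ | _ | _ | _ | _ | _ | _ | _ | j | y <;>
          simp [baseStacks, update_apply]
        split_ifs <;> rfl
      · have := hs.2 x
        rw [hQ]
        simp [baseStacks, hlen]
        omega
    · intro e S hS hs he hsc
      refine ((hP w n s e S hS hs he hsc).seq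
        (does_pop_bools ⟨_, _, le_rfl, .push _ _ _ _⟩)).congr ?_ ?_
      · funext y
        cases y <;> simp
      · simp

lemma does_relProg (ar : R → ℕ) (p : RelProg V R) (hp : p.Wf ar) :
    ∃ P : Polynomial ℕ, ∀ (w : List Token) (n : ℕ)
      (s : R → List ℕ → Prop) (rels : R → List Token), 0 < n → Lists ar n s rels →
      ∃ rels', Lists ar n (p.run w n s) rels' ∧ ∀ l,
        Does (relProg p) (baseStacks w n rels l) (baseStacks w n rels' l) (P.eval n) := by
  induction p with
  | assign x vs φ => exact does_assignProg ar x vs φ hp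
  | seq p q ihp ihq =>
    obtain ⟨P, hP⟩ := ihp hp.1
    obtain ⟨Q, hQ⟩ := ihq hp.2
    refine ⟨P + Q, fun w n s rels hn hs => ?_⟩
    obtain ⟨rels₁, h₁, hd₁⟩ := hP w n s rels hn hs
    obtain ⟨rels₂, h₂, hd₂⟩ := hQ w n _ rels₁ hn h₁
    exact ⟨rels₂, h₂, fun l => ((hd₁ l).seq (hd₂ l)).mono (by simp)⟩
  | loop p ih =>
    obtain ⟨P, hP⟩ := ih hp
    refine ⟨Polynomial.X * (P + 9) + 9, fun w n s rels hn hs => ?_⟩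
    have hP' := fun s rels hs => hP w n s rels hn hs
    -- The tables after a pass are chosen independently of the content of `ctl`, which differs from
    -- pass to pass; iterating the choice gives the sequence of tables for `does_forSize`.
    choose! f hf using hP'
    let g : ℕ → R → List Token := fun m => m.rec rels fun i r => f ((p.run w n)^[i] s) r
    have hg : ∀ i, Lists ar n ((p.run w n)^[i] s) (g i) := by
      intro i
      induction i with
      | zero => exact hs
      | succ i ih =>
        rw [iterate_succ_apply']
        exact (hf _ _ ih).1
    refine ⟨g n, hg n, fun l => ?_⟩
    have hu : ∀ (rels : R → List Token) l l', update (baseStacks (V := V) w n rels l) .ctl l' =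
        baseStacks w n rels l' := by
      intro rels l l'
      funext y
      cases y <;> simp [baseStacks]
    refine (does_forSize (n := n) (B := P.eval n) (fun i => baseStacks w n (g i) l) rfl rfl
      ?_).congr ?_ ?_
    · intro i hi l'
      simp only [hu]
      exact (hf _ _ (hg i)).2 l'
    · exact hu _ _ _
    · simp

end StackProg

end ShExVal

/-! ### From programs over relations to polynomial time -/

namespace ShExVal

open Function

namespace StackProg

variable {V R : Type} [DecidableEq V] [DecidableEq R]

/-- Write one more than the length of the word in unary. -/
def initProg : RProg V R :=
  seq (moveTo .word .buf) <|
    seq (whilePop .buf <| seq (push .word fun v => v.getD default) (push .size fun _ => .digit))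
      (push .size fun _ => .digit)

/-- The domain has one element more than the word has letters: positions just behind an infix then
belong to it, and it contains an element at which no letter stands. -/
lemma does_initProg (w : List Token) :
    Does (initProg (V := V) (R := R)) (update (fun _ => []) .word w)
      (baseStacks w (w.length + 1) (fun _ => []) []) (7 * w.length + 5) := by
  have h : ∀ (l : List Token) (S : RStacks V R), S .buf = l →
      Does (whilePop .buf <| seq (push .word fun v => v.getD default) (push .size fun _ => .digit))
        S (update (update (update S .buf []) .word (l.reverse ++ S .word)) .size
          (unary l.length ++ S .size)) (4 * l.length + 2) := by
    intro l
    induction l with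
    | nil =>
      exact fun S hS => (does_whilePop_nil _ hS).congr
        (by rw [← hS, update_eq_self, hS]; simp) le_rfl
    | cons a l ih =>
      intro S hS
      refine (does_whilePop_cons hS ⟨_, _, le_rfl, .seq (.push _ _ _ _) (.push _ _ _ _)⟩
        (ih _ ?_)).congr ?_ ?_
      · simp
      · funext x
        rcases x with _ | _ | _ | _ | _ | _ | _ | _ | _ | j | y <;>
          simp [unary, List.replicate_succ']
      · simp only [List.length_cons]; omega
  refine ((does_moveTo (by simp) _).seq ((h w.reverse _ ?_).seq (does_push_const _ _ _))).congr
    ?_ ?_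
  · simp
  · funext x
    rcases x with _ | _ | _ | _ | _ | _ | _ | _ | _ | j | y <;>
      simp [baseStacks, List.replicate_succ]
  · simp
    omega

/-- Empty some stacks. -/
def clearAll : List (Stk V R) → RProg V R
  | [] => clear .tmp
  | k :: ks => seq (clear k) (clearAll ks)

lemma does_clearAll (ks : List (Stk V R)) (B : ℕ) (S : RStacks V R) (ht : S .tmp = [])
    (hB : ∀ k, (S k).length ≤ B) :
    Does (clearAll ks) S (fun k => if k ∈ ks then [] else S k) (ks.length * (3 * B + 2) + 2) := by
  induction ks generalizing S with
  | nil => exact (does_clear _ _).congr (by simp [← ht]) (by simp [ht])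
  | cons k ks ih =>
    refine ((does_clear k S).seq (ih (update S k []) ?_ fun k' => ?_)).congr ?_ ?_
    · by_cases h : Stk.tmp = k
      · subst h; simp
      · simpa [h] using ht
    · by_cases h : k' = k
      · subst h; simp
      · simpa [h] using hB k'
    · funext k'
      by_cases h : k' = k
      · subst h; simp
      · simp [h]
    · have := hB k
      rw [List.length_cons]
      ring_nf
      omega

/-- Properties of words that are definable by a program over relations and a formula over the
resulting relations can be decided in polynomial time. -/
theorem inPTIME_of_relProg [Fintype V] [Fintype R] (ar : R → ℕ) (p : RelProg V R) (φ : Fml V R)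
    (hp : p.Wf ar) (hφ : φ.Wf ar []) {α : Type} {enc : α → List Token} {P : α → Prop}
    (h : ∀ x, P x ↔ φ.eval (enc x) ((enc x).length + 1)
      (p.run (enc x) ((enc x).length + 1) fun _ _ => False) fun _ => 0) :
    InPTIME enc P := by
  obtain ⟨P₁, hP₁⟩ := does_relProg ar p hp
  obtain ⟨P₂, hP₂⟩ := does_evalProg ar φ [] hφ
  -- Everything except the truth value has to be erased, as `inPTIME_of_runs` requires.
  let ks : List (Stk V R) := (Finset.univ.erase .bools).toList
  have hks : ∀ k, k ∈ ks ↔ k ≠ .bools := fun k => by simp [ks]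
  -- A common bound for the lengths of all stacks at the end, as a polynomial in the size of the
  -- domain; the sum accounts for the tables.
  let Q : Polynomial ℕ := 2 * Polynomial.X + 2 + ∑ x : R, Polynomial.X ^ ar x
  refine inPTIME_of_runs (K := Stk V R)
    (seq initProg <| seq (relProg p) <| seq (evalProg φ) (clearAll ks)) .word .bools .digit
    (7 * Polynomial.X + 5 + (P₁.comp (Polynomial.X + 1) + (P₂.comp (Polynomial.X + 1) +
      ((ks.length : Polynomial ℕ) * (3 * Q.comp (Polynomial.X + 1) + 2) + 2)))) fun x => ?_
  set w := enc x
  set n := w.length + 1 with hn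
  set s := p.run w n fun _ _ => False with hs
  obtain ⟨rels, hr, hd⟩ := hP₁ w n (fun _ _ => False) (fun _ => []) (by omega)
    ⟨by simp, by simp⟩
  have h1 := does_initProg (V := V) (R := R) w
  have h2 := hP₂ w n s _ _ (ready_baseStacks w n rels []) hr.1 (fun _ => by omega) (fun _ _ => rfl)
  have h3 := does_clearAll ks (Q.eval n)
    (update (baseStacks w n rels []) .bools [propBit (φ.eval w n s fun _ => 0)])
    (by simp [baseStacks]) ?_
  · obtain ⟨v, t, ht, hrun⟩ := (h1.seq ((hd []).seq (h2.seq h3))) none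
    refine ⟨v, propBit (φ.eval w n s fun _ => 0), t, ?_, ?_, ?_⟩
    · simpa using ht
    · convert hrun using 1
      funext k
      by_cases hk : k = .bools
      · subst hk; simp [hks]
      · simp [hks, hk]
    · rw [propBit_eq_digit, h x]
  · have hsum : ∀ x : R, (rels x).length ≤ ∑ x : R, n ^ ar x := fun x =>
      (hr.2 x).trans (Finset.single_le_sum (f := fun x => n ^ ar x) (fun _ _ => Nat.zero_le _)
        (Finset.mem_univ x))
    have hQ : Q.eval n = 2 * n + 2 + ∑ x : R, n ^ ar x := by simp [Q, Polynomial.eval_finsetSum]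
    rw [hQ]
    intro k
    rcases k with _ | _ | _ | _ | _ | _ | _ | _ | _ | j | y <;> simp [baseStacks]
    all_goals first
      | omega
      | exact (hsum _).trans (by omega)

end StackProg

end ShExVal

namespace ShExVal

open Function

/-! ### Perfect matchings by an auction

Persons and objects are numbers below `N` with `X`, and `A p q` says that the person `p` accepts the
object `q`. The prices are given by `Lv q c`, which says that the price of `q` is more than `c`, and
`Ow q p` says that `p` owns `q`. -/

namespace Auction

/-- The person `p` owns no object and accepts an object whose price is not yet maximal. -/
def Eligible (N : ℕ) (X : ℕ → Prop) (A Lv Ow : ℕ → ℕ → Prop) (p : ℕ) : Prop :=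
  X p ∧ (¬ ∃ q < N, Ow q p) ∧ ∃ q < N, A p q ∧ ∃ c < N, ¬ Lv q c

/-- The object `q` is one of the cheapest objects that `p` accepts. -/
def Cheapest (N : ℕ) (A Lv : ℕ → ℕ → Prop) (p q : ℕ) : Prop :=
  A p q ∧ ∀ q' < N, A p q' → ∀ c < N, Lv q c → Lv q' c

/-- The first eligible person `p` bids for the first of the cheapest objects `q` it accepts. -/
def Bid (N : ℕ) (X : ℕ → Prop) (A Lv Ow : ℕ → ℕ → Prop) (p q : ℕ) : Prop :=
  (Eligible N X A Lv Ow p ∧ ∀ p' < N, p' < p → ¬ Eligible N X A Lv Ow p') ∧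
    Cheapest N A Lv p q ∧ ∀ q' < N, q' < q → ¬ Cheapest N A Lv p q'

/-- The prices after a bid. -/
def nextLv (N : ℕ) (Lv B : ℕ → ℕ → Prop) (q c : ℕ) : Prop :=
  Lv q c ∨ ((∃ p < N, B p q) ∧ ∀ c' < N, c' < c → Lv q c')

/-- The owners after a bid. -/
def nextOw (N : ℕ) (Ow B : ℕ → ℕ → Prop) (q p : ℕ) : Prop :=
  B p q ∨ (Ow q p ∧ ¬ ∃ p' < N, B p' q)

/-- The properties of prices `pr` and owners that are preserved by bids. -/
structure Invariant (N : ℕ) (A Lv Ow : ℕ → ℕ → Prop) (pr : ℕ → ℕ) : Prop where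
  level : ∀ q < N, ∀ c < N, Lv q c ↔ c < pr q
  le : ∀ q, pr q ≤ N
  accepts : ∀ q < N, ∀ p < N, Ow q p → A p q
  owner : ∀ q < N, ∀ p < N, ∀ p' < N, Ow q p → Ow q p' → p = p'
  object : ∀ q < N, ∀ q' < N, ∀ p < N, Ow q p → Ow q' p → q = q'
  owned : ∀ q < N, 0 < pr q → ∃ p < N, Ow q p
  cheap : ∀ q < N, ∀ p < N, Ow q p → ∀ q' < N, A p q' → pr q ≤ pr q' + 1

variable {N : ℕ} {X : ℕ → Prop} {A Lv Ow : ℕ → ℕ → Prop} {pr : ℕ → ℕ}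

lemma invariant_zero (hLv : ∀ q < N, ∀ c < N, ¬ Lv q c) (hOw : ∀ q < N, ∀ p < N, ¬ Ow q p) :
    Invariant N A Lv Ow fun _ => 0 := by
  constructor
  · simpa using hLv
  · simp
  · exact fun q hq p hp h => absurd h (hOw q hq p hp)
  · exact fun q hq p hp _ _ h => absurd h (hOw q hq p hp)
  · exact fun q hq _ _ p hp h => absurd h (hOw q hq p hp)
  · simp
  · simp

/-- If a person is eligible, then there is exactly one bid, for an object whose price is not
maximal. -/
lemma exists_bid (hX : ∀ p, X p → p < N) (h : Invariant N A Lv Ow pr)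
    (he : ∃ p, Eligible N X A Lv Ow p) :
    ∃ i < N, ∃ j < N, Bid N X A Lv Ow i j ∧ (∀ p < N, ∀ q < N, Bid N X A Lv Ow p q → p = i ∧ q = j) ∧
      pr j < N ∧ A i j ∧ (∀ q < N, ¬ Ow q i) ∧ ∀ q < N, A i q → pr j ≤ pr q := by
  classical
  set i := Nat.find he with hi
  have hei : Eligible N X A Lv Ow i := Nat.find_spec he
  have hiN : i < N := hX _ hei.1
  obtain ⟨-, hno, q₀, hq₀, hA₀, c₀, hc₀, hL₀⟩ := hei
  have hex : ∃ q, q < N ∧ A i q ∧ ∀ q' < N, A i q' → pr q ≤ pr q' := by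
    obtain ⟨q, hq, hmin⟩ := Finset.exists_min_image ((Finset.range N).filter (A i)) pr
      ⟨q₀, by simp [hq₀, hA₀]⟩
    simp only [Finset.mem_filter, Finset.mem_range] at hq hmin
    exact ⟨q, hq.1, hq.2, fun q' h h' => hmin q' ⟨h, h'⟩⟩
  -- Comparison of levels is comparison of prices: if `pr q' < pr q`, then `q` but not `q'` lies
  -- above the level `pr q'`.
  have hch : ∀ q < N, Cheapest N A Lv i q ↔ (A i q ∧ ∀ q' < N, A i q' → pr q ≤ pr q') := by
    intro q hq
    refine and_congr_right fun _ => forall₃_congr fun q' hq' hA' => ?_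
    constructor
    · intro hc
      by_contra! hlt
      have h1 := h.le q
      have := hc (pr q') (by omega) ((h.level q hq _ (by omega)).2 hlt)
      rw [h.level q' hq' _ (by omega)] at this
      omega
    · intro hle c hc
      rw [h.level q hq c hc, h.level q' hq' c hc]
      omega
  set j := Nat.find hex with hj
  obtain ⟨hjN, hAj, hmin⟩ : j < N ∧ A i j ∧ ∀ q' < N, A i q' → pr j ≤ pr q' := Nat.find_spec hex
  have hbid : Bid N X A Lv Ow i j := by
    refine ⟨⟨Nat.find_spec he, fun p' _ hp' => Nat.find_min he hp'⟩,
      (hch j hjN).2 ⟨hAj, hmin⟩, fun q' hq' hlt hc => ?_⟩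
    exact Nat.find_min hex hlt ⟨hq', (hch q' hq').1 hc⟩
  refine ⟨i, hiN, j, hjN, hbid, ?_, ?_, hAj, fun q hq ho => hno ⟨q, hq, ho⟩, hmin⟩
  · intro p hp q hq hb
    have hpi : p = i := by
      refine le_antisymm ?_ (Nat.find_min' he hb.1.1)
      by_contra! hlt
      exact hb.1.2 i hiN hlt hbid.1.1
    subst hpi
    refine ⟨rfl, le_antisymm ?_ (Nat.find_min' hex ⟨hq, (hch q hq).1 hb.2.1⟩)⟩
    by_contra! hlt
    exact hb.2.2 j hjN hlt hbid.2.1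
  · rw [h.level q₀ hq₀ c₀ hc₀] at hL₀
    have := hmin q₀ hq₀ hA₀
    omega

/-- Only the object `j` of the bid changes. Its new price exceeds the least price among the objects
its new owner accepts by exactly one, which is the slack that `cheap` allows; for other owners
`cheap` persists because prices never fall. The bidder owned nothing before, so nobody gets two
objects. -/
lemma Invariant.step (hX : ∀ p, X p → p < N) (h : Invariant N A Lv Ow pr)
    (he : ∃ p, Eligible N X A Lv Ow p) :
    ∃ j < N, Invariant N A (nextLv N Lv (Bid N X A Lv Ow)) (nextOw N Ow (Bid N X A Lv Ow))
      (update pr j (pr j + 1)) := by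
  obtain ⟨i, hi, j, hj, hb, huniq, hprj, hAij, hno, hmin⟩ := exists_bid hX h he
  have hbid : ∀ q < N, (∃ p < N, Bid N X A Lv Ow p q) ↔ q = j := fun q hq =>
    ⟨fun ⟨p, hp, hpq⟩ => (huniq p hp q hq hpq).2, fun hq => ⟨i, hi, hq ▸ hb⟩⟩
  have how : ∀ q < N, ∀ p < N, nextOw N Ow (Bid N X A Lv Ow) q p ↔
      (q = j ∧ p = i) ∨ (q ≠ j ∧ Ow q p) := by
    intro q hq p hp
    rw [nextOw, hbid q hq]
    constructor
    · rintro (h | ⟨h, h'⟩)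
      · exact .inl (huniq p hp q hq h).symm
      · exact .inr ⟨h', h⟩
    · rintro (⟨rfl, rfl⟩ | ⟨h, h'⟩)
      · exact .inl hb
      · exact .inr ⟨h', h⟩
  have hle : ∀ q, pr q ≤ update pr j (pr j + 1) q := by
    intro q
    by_cases hq : q = j
    · subst hq; simp
    · simp [hq]
  refine ⟨j, hj, ⟨?_, ?_, ?_, ?_, ?_, ?_, ?_⟩⟩
  · intro q hq c hc
    rw [nextLv, hbid q hq]
    by_cases hqj : q = j
    · subst hqj
      simp only [true_and, update_self, h.level q hq c hc]
      constructor
      · rintro (h' | h')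
        · omega
        · by_contra! hlt
          have := h' (pr q) hprj (by omega)
          rw [h.level q hq _ hprj] at this
          omega
      · intro hlt
        refine .inr fun c' hc' hcc => ?_
        rw [h.level q hq c' hc']
        omega
    · simp [hqj, h.level q hq c hc]
  · intro q
    by_cases hq : q = j
    · subst hq; simpa
    · simpa [hq] using h.le q
  · intro q hq p hp ho
    rcases (how q hq p hp).1 ho with ⟨rfl, rfl⟩ | ⟨_, ho⟩
    · exact hAij
    · exact h.accepts q hq p hp ho
  · intro q hq p hp p' hp' ho ho'
    rcases (how q hq p hp).1 ho with ⟨rfl, rfl⟩ | ⟨hne, ho⟩ <;>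
      rcases (how q hq p' hp').1 ho' with ⟨h1, h2⟩ | ⟨hne', ho'⟩
    · exact h2.symm
    · exact absurd rfl hne'
    · exact absurd h1 hne
    · exact h.owner q hq p hp p' hp' ho ho'
  · intro q hq q' hq' p hp ho ho'
    rcases (how q hq p hp).1 ho with ⟨rfl, rfl⟩ | ⟨hne, ho⟩ <;>
      rcases (how q' hq' p hp).1 ho' with ⟨h1, h2⟩ | ⟨hne', ho'⟩
    · exact h1.symm
    · exact absurd ho' (hno q' hq')
    · subst h2; exact absurd ho (hno q hq)
    · exact h.object q hq q' hq' p hp ho ho'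
  · intro q hq hpos
    by_cases hqj : q = j
    · exact ⟨i, hi, (how q hq i hi).2 (.inl ⟨hqj, rfl⟩)⟩
    · obtain ⟨p, hp, ho⟩ := h.owned q hq (by simpa [hqj] using hpos)
      exact ⟨p, hp, (how q hq p hp).2 (.inr ⟨hqj, ho⟩)⟩
  · intro q hq p hp ho q' hq' hA
    have h1 := hle q'
    rcases (how q hq p hp).1 ho with ⟨rfl, rfl⟩ | ⟨hne, ho⟩
    · have := hmin q' hq' hA
      rw [update_self]
      omega
    · have := h.cheap q hq p hp ho q' hq' hA
      rw [update_of_ne hne]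
      omega

/-- Without eligible persons nothing is changed. -/
lemma Invariant.stable (h : Invariant N A Lv Ow pr) (he : ¬ ∃ p, Eligible N X A Lv Ow p) :
    Invariant N A (nextLv N Lv (Bid N X A Lv Ow)) (nextOw N Ow (Bid N X A Lv Ow)) pr ∧
      ¬ ∃ p, Eligible N X A (nextLv N Lv (Bid N X A Lv Ow)) (nextOw N Ow (Bid N X A Lv Ow)) p := by
  have hb : ∀ p q, ¬ Bid N X A Lv Ow p q := fun p q hb => he ⟨p, hb.1.1⟩
  have h1 : nextLv N Lv (Bid N X A Lv Ow) = Lv := by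
    funext q c
    simp [nextLv, hb]
  have h2 : nextOw N Ow (Bid N X A Lv Ow) = Ow := by
    funext q c
    simp [nextOw, hb]
  rw [h1, h2]
  exact ⟨h, he⟩

/-- All prices are at most `N`, and an object outside `X` is accepted by nobody, so it is never
owned and its price is `0`. This makes the inequality strict. -/
lemma Invariant.sum_le (hcard : ∃ a < N, ¬ X a) (hA : ∀ p q, A p q → X q)
    (h : Invariant N A Lv Ow pr) : ∑ q ∈ Finset.range N, pr q < N * N := by
  obtain ⟨a, ha, hXa⟩ := hcard
  have h0 : pr a = 0 := by
    by_contra! hne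
    obtain ⟨p, hp, ho⟩ := h.owned a ha (by omega)
    exact hXa (hA _ _ (h.accepts a ha p hp ho))
  calc ∑ q ∈ Finset.range N, pr q < ∑ q ∈ Finset.range N, N :=
        Finset.sum_lt_sum (fun q _ => h.le q) ⟨a, Finset.mem_range.2 ha, by omega⟩
    _ = N * N := by simp

/-- If no person is eligible, then every person owns an object if and only if there is an injective
assignment of accepted objects. -/
lemma Invariant.owns_iff (hX : ∀ p, X p → p < N) (hcard : ∃ a < N, ¬ X a)
    (hA : ∀ p q, A p q → X p ∧ X q) (h : Invariant N A Lv Ow pr)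
    (he : ¬ ∃ p, Eligible N X A Lv Ow p) :
    (∀ p, X p → ∃ q < N, Ow q p) ↔
      ∃ f : ℕ → ℕ, (∀ p, X p → A p (f p)) ∧ Set.InjOn f {p | X p} := by
  classical
  constructor
  · intro hall
    choose! f hf hf' using hall
    refine ⟨f, fun p hp => h.accepts _ (hf p hp) p (hX p hp) (hf' p hp), fun p hp p' hp' hpp => ?_⟩
    exact h.owner _ (hf p hp) p (hX p hp) p' (hX p' hp') (hf' p hp) (hpp ▸ hf' p' hp')
  · rintro ⟨f, hf, hinj⟩ i hi
    by_contra hno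
    -- An unserved person that is not eligible accepts only objects of maximal price.
    have hmax : ∀ q < N, A i q → N ≤ pr q := by
      intro q hq hAq
      by_contra! hlt
      exact he ⟨i, hi, hno, q, hq, hAq, pr q, hlt, by rw [h.level q hq _ hlt]; omega⟩
    set Xs := (Finset.range N).filter X with hXs
    have hmem : ∀ q, q ∈ Xs ↔ X q := fun q => by
      simp only [hXs, Finset.mem_filter, Finset.mem_range]
      exact ⟨And.right, fun hq => ⟨hX q hq, hq⟩⟩
    have hXcard : Xs.card < N := by
      obtain ⟨a, ha, hXa⟩ := hcard
      have : Xs ⊂ Finset.range N :=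
        ⟨Finset.filter_subset _ _, fun hsub => hXa ((hmem a).1 (hsub (Finset.mem_range.2 ha)))⟩
      simpa using Finset.card_lt_card this
    -- There are fewer than `N` objects in `X`, so some level `L < N` is the price of none of them.
    obtain ⟨L, hL, hgap⟩ : ∃ L ∈ Finset.range N, L ∉ Xs.image pr :=
      Finset.exists_mem_notMem_of_card_lt_card
        (by rw [Finset.card_range]; exact Finset.card_image_le.trans_lt hXcard)
    rw [Finset.mem_range] at hL
    have hgap' : ∀ q, X q → pr q ≠ L := fun q hq hqL =>
      hgap (Finset.mem_image.2 ⟨q, (hmem q).2 hq, hqL⟩)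
    set S := Xs.filter (fun q => L < pr q) with hS
    have hSmem : ∀ q, q ∈ S ↔ X q ∧ L < pr q := fun q => by
      rw [hS, Finset.mem_filter, hmem]
    have hown : ∀ q ∈ S, ∃ p < N, Ow q p := fun q hq =>
      h.owned q (hX q ((hSmem q).1 hq).1) (by have := ((hSmem q).1 hq).2; omega)
    choose! o ho ho' using hown
    have hSN : ∀ q ∈ S, q < N := fun q hq => hX q ((hSmem q).1 hq).1
    have hinjo : Set.InjOn o S := fun q hq q' hq' hqq =>
      h.object q (hSN q hq) q' (hSN q' hq') (o q) (ho q hq) (ho' q hq) (hqq ▸ ho' q' hq')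
    have hni : i ∉ S.image o := by
      rw [Finset.mem_image]
      rintro ⟨q, hq, rfl⟩
      exact hno ⟨q, hSN q hq, ho' q hq⟩
    -- The contradiction to Hall's condition. All objects dearer than `L` are owned. Their owners
    -- accept only objects of price at least `L` by `cheap`, hence dearer than `L` by the gap, and
    -- so does `i` by `hmax`. Thus `f` would inject `S.card + 1` persons into `S`.
    have hle : (insert i (S.image o)).card ≤ S.card := by
      refine Finset.card_le_card_of_injOn f ?_ ?_
      · intro p hp
        rw [Finset.mem_coe, Finset.mem_insert, Finset.mem_image] at hp
        rw [Finset.mem_coe, hSmem]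
        rcases hp with rfl | ⟨q, hq, rfl⟩
        · have hA' := hf p hi
          have hXf := (hA _ _ hA').2
          exact ⟨hXf, lt_of_lt_of_le hL (hmax _ (hX _ hXf) hA')⟩
        · have hXp := (hA _ _ (h.accepts q (hSN q hq) _ (ho q hq) (ho' q hq))).1
          have hA' := hf _ hXp
          have hXf := (hA _ _ hA').2
          have h1 := h.cheap q (hSN q hq) _ (ho q hq) (ho' q hq) _ (hX _ hXf) hA'
          have h2 := ((hSmem q).1 hq).2
          have h3 := hgap' _ hXf
          exact ⟨hXf, by omega⟩
      · refine hinj.mono fun p hp => ?_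
        rw [Finset.mem_coe, Finset.mem_insert, Finset.mem_image] at hp
        rcases hp with rfl | ⟨q, hq, rfl⟩
        · exact hi
        · exact (hA _ _ (h.accepts q (hSN q hq) _ (ho q hq) (ho' q hq))).1
    rw [Finset.card_insert_of_notMem hni, Finset.card_image_of_injOn hinjo] at hle
    omega

/-- After `N * N` bids, every person owns an object if and only if there is an injective assignment
of accepted objects. -/
theorem owns_iff_of_iterate (hX : ∀ p, X p → p < N) (hcard : ∃ a < N, ¬ X a)
    (hA : ∀ p q, A p q → X p ∧ X q) (Lv Ow : ℕ → ℕ → ℕ → Prop)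
    (hLv0 : ∀ q < N, ∀ c < N, ¬ Lv 0 q c) (hOw0 : ∀ q < N, ∀ p < N, ¬ Ow 0 q p)
    (hLv : ∀ k, Lv (k + 1) = nextLv N (Lv k) (Bid N X A (Lv k) (Ow k)))
    (hOw : ∀ k, Ow (k + 1) = nextOw N (Ow k) (Bid N X A (Lv k) (Ow k))) :
    (∀ p, X p → ∃ q < N, Ow (N * N) q p) ↔
      ∃ f : ℕ → ℕ, (∀ p, X p → A p (f p)) ∧ Set.InjOn f {p | X p} := by
  -- Until the auction stops, the sum of the prices counts the bids; `N * N` bids are excluded by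
  -- `sum_le`.
  have key : ∀ k, ∃ pr, Invariant N A (Lv k) (Ow k) pr ∧
      ((¬ ∃ p, Eligible N X A (Lv k) (Ow k) p) ∨ ∑ q ∈ Finset.range N, pr q = k) := by
    intro k
    induction k with
    | zero => exact ⟨_, invariant_zero hLv0 hOw0, .inr (by simp)⟩
    | succ k ih =>
      obtain ⟨pr, hinv, hor⟩ := ih
      rw [hLv, hOw]
      by_cases he : ∃ p, Eligible N X A (Lv k) (Ow k) p
      · obtain ⟨j, hj, hinv'⟩ := hinv.step hX he
        refine ⟨_, hinv', .inr ?_⟩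
        rw [Finset.sum_update_of_mem (Finset.mem_range.2 hj)]
        have hs := hor.resolve_left (not_not.2 he)
        rw [← Finset.add_sum_erase _ _ (Finset.mem_range.2 hj)] at hs
        rw [← Finset.erase_eq]
        omega
      · exact ⟨pr, (hinv.stable he).1, .inl (hinv.stable he).2⟩
  obtain ⟨pr, hinv, hor⟩ := key (N * N)
  refine hinv.owns_iff hX hcard hA (hor.resolve_right ?_)
  exact (hinv.sum_le hcard fun p q h => (hA p q h).2).ne

end Auction

end ShExVal

namespace ShExVal

open Function

/-! ### Languages of unordered concatenations of atoms -/

section languages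

variable {Δ : Type}

/-- The bags of an atom `a`, `a?` (`op` holds) or `a*` (`st` holds). -/
def atomBags (st op : Prop) (a : Δ) : Set (Multiset Δ) :=
  {u | (∀ b ∈ u, b = a) ∧ (¬ st → u.card ≤ 1) ∧ (¬ st → ¬ op → u ≠ 0)}

/-- The unordered concatenation of a list of bag languages. -/
def bagProd (l : List (Set (Multiset Δ))) : Set (Multiset Δ) := l.foldr bagConc {0}

lemma bagConc_zero_left (A : Set (Multiset Δ)) : bagConc {0} A = A := by
  ext w
  simp [bagConc]

lemma bagConc_zero_right (A : Set (Multiset Δ)) : bagConc A {0} = A := by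
  ext w
  simp [bagConc]

lemma bagConc_assoc (A B C : Set (Multiset Δ)) :
    bagConc (bagConc A B) C = bagConc A (bagConc B C) := by
  ext w
  constructor
  · rintro ⟨_, ⟨u, hu, v, hv, rfl⟩, x, hx, rfl⟩
    exact ⟨u, hu, _, ⟨v, hv, x, hx, rfl⟩, add_assoc _ _ _⟩
  · rintro ⟨u, hu, _, ⟨v, hv, x, hx, rfl⟩, rfl⟩
    exact ⟨_, ⟨u, hu, v, hv, rfl⟩, x, hx, (add_assoc _ _ _).symm⟩

lemma bagProd_append (l l' : List (Set (Multiset Δ))) :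
    bagProd (l ++ l') = bagConc (bagProd l) (bagProd l') := by
  induction l with
  | nil => exact (bagConc_zero_left _).symm
  | cons A l ih =>
    rw [List.cons_append]
    change bagConc A (bagProd (l ++ l')) = bagConc (bagConc A (bagProd l)) _
    rw [ih, bagConc_assoc]

lemma bagProd_singleton (A : Set (Multiset Δ)) : bagProd [A] = A := bagConc_zero_right A

lemma bagPow_singleton (a : Δ) (i : ℕ) : bagPow {{a}} i = {Multiset.replicate i a} := by
  induction i with
  | zero => rfl
  | succ i ih =>
    ext w
    rw [bagPow, ih]
    simp [bagConc, Multiset.replicate_succ]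

lemma lang_sym (a : Δ) : (RBE.sym a).lang = atomBags False False a := by
  ext u
  simp only [RBE.lang, atomBags, Set.mem_singleton_iff, Set.mem_ofPred_eq, not_false_eq_true,
    true_implies]
  constructor
  · rintro rfl
    simp
  · rintro ⟨h1, h2, h3⟩
    have : u.card = 1 := le_antisymm h2 (Multiset.card_pos.2 h3)
    obtain ⟨b, rfl⟩ := Multiset.card_eq_one.1 this
    rw [h1 b (Multiset.mem_singleton_self b)]

lemma lang_opt (a : Δ) : (RBE.sym a).opt.lang = atomBags False True a := by
  ext u
  simp only [RBE.lang, RBE.opt, atomBags, Set.mem_union, Set.mem_singleton_iff, Set.mem_ofPred_eq,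
    not_false_eq_true, true_implies, not_true_eq_false, false_implies, and_true]
  constructor
  · rintro (rfl | rfl) <;> simp
  · rintro ⟨h1, h2⟩
    rcases Nat.le_one_iff_eq_zero_or_eq_one.1 h2 with h | h
    · exact .inl (Multiset.card_eq_zero.1 h)
    · obtain ⟨b, rfl⟩ := Multiset.card_eq_one.1 h
      exact .inr (by rw [h1 b (Multiset.mem_singleton_self b)])

lemma lang_star (a : Δ) : (RBE.sym a).star.lang = atomBags True False a := by
  ext u
  simp only [RBE.lang, atomBags, bagPow_singleton, Set.mem_iUnion, Set.mem_singleton_iff,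
    Set.mem_ofPred_eq, not_true_eq_false, false_implies, and_true]
  exact ⟨fun ⟨i, h⟩ b hb => Multiset.eq_of_mem_replicate (h ▸ hb),
    fun h => ⟨u.card, Multiset.eq_replicate_card.2 h⟩⟩

end languages

/-! ### Flattenings as choice functions -/

/-- A relation between bags only pairs occurrences. If `s` has no repetitions, the pairing is a
function on its elements; it is built up by `update`, which does not disturb the values chosen
before. -/
lemma exists_map_of_rel {α β : Type} [DecidableEq α] {r : α → β → Prop} {s : Multiset α}
    {u : Multiset β} (h : Multiset.Rel r s u) (hs : s.Nodup) (b₀ : α → β) :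
    ∃ f : α → β, u = s.map f ∧ ∀ a ∈ s, r a (f a) := by
  induction h with
  | zero => exact ⟨b₀, by simp⟩
  | @cons a b s u hab _ ih =>
    rw [Multiset.nodup_cons] at hs
    obtain ⟨f, rfl, hf⟩ := ih hs.2
    refine ⟨update f a b, ?_, fun c hc => ?_⟩
    · rw [Multiset.map_cons, update_self]
      congr 1
      exact Multiset.map_congr rfl fun c hc =>
        (update_of_ne (fun h : c = a => hs.1 (h ▸ hc)) _ _).symm
    · by_cases hca : c = a
      · subst hca; simpa
      · rw [update_of_ne hca]
        exact hf c ((Multiset.mem_cons.1 hc).resolve_left hca)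

lemma rel_map_right_self {α β : Type} {r : α → β → Prop} {s : Multiset α} {f : α → β}
    (h : ∀ a ∈ s, r a (f a)) : Multiset.Rel r s (s.map f) := by
  induction s using Multiset.induction_on with
  | empty => simp
  | cons a s ih =>
    rw [Multiset.map_cons]
    exact .cons (h a (Multiset.mem_cons_self a s)) (ih fun b hb => h b (Multiset.mem_cons_of_mem hb))

/-- Induction on `u`: each of its elements is the image of some element of `E`, which is removed. -/
lemma exists_subset_of_map_eq_add {α β : Type} [DecidableEq α] (E : Finset α) (f : α → β)
    (u v : Multiset β) (h : E.val.map f = u + v) :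
    ∃ F ⊆ E, F.val.map f = u ∧ (E \ F).val.map f = v := by
  induction u using Multiset.induction_on generalizing E with
  | empty => exact ⟨∅, by simp, by simp, by simpa using h⟩
  | cons b u ih =>
    have hb : b ∈ E.val.map f := by rw [h]; simp
    obtain ⟨a, ha, rfl⟩ := Multiset.mem_map.1 hb
    have hE : E.val.map f = f a ::ₘ ((E.erase a).val.map f) := by
      rw [← Multiset.map_cons, Finset.erase_val, Multiset.cons_erase ha]
    rw [hE, Multiset.cons_add, Multiset.cons_inj_right] at h
    obtain ⟨F, hF, h1, h2⟩ := ih (E.erase a) h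
    have haF : a ∉ F := fun h => by simpa using hF h
    refine ⟨insert a F, ?_, ?_, ?_⟩
    · exact Finset.insert_subset ha (hF.trans (Finset.erase_subset _ _))
    · rw [Finset.insert_val_of_notMem haF, Multiset.map_cons, h1]
    · rw [← h2]
      congr 2
      ext x
      simp only [Finset.mem_sdiff, Finset.mem_insert, Finset.mem_erase]
      tauto

/-! ### Assignments of edges to atoms -/

section assignment

variable {Δ : Type} (E : Finset ℕ) (ok : ℕ → Δ → Prop) (st op : ℕ → Prop) (smb : ℕ → Δ)

/-- `k` assigns the edges `E` to atoms of the list `l`, as the multiplicities require it. -/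
def IsAssignment (l : List ℕ) (k : ℕ → ℕ) : Prop :=
  (∀ e ∈ E, k e ∈ l ∧ ok e (smb (k e))) ∧
    ∀ q ∈ l, ¬ st q → (∀ e ∈ E, ∀ e' ∈ E, k e = q → k e' = q → e = e') ∧
      (¬ op q → ∃ e ∈ E, k e = q)

/-- The languages of the atoms of a list. -/
def atomLangs (l : List ℕ) : List (Set (Multiset Δ)) :=
  l.map fun q => atomBags (st q) (op q) (smb q)

variable {E ok st op smb}

/-- The bag of chosen symbols splits into shares of the atoms. Pulling back the share of the first
atom gives the edges assigned to it, and the induction treats the others. -/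
lemma exists_isAssignment {l : List ℕ} (hl : l.Nodup) {h : ℕ → Δ} (hok : ∀ e ∈ E, ok e (h e))
    (hmem : E.val.map h ∈ bagProd (atomLangs st op smb l)) :
    ∃ k, IsAssignment E ok st op smb l k := by
  induction l generalizing E with
  | nil =>
    have : E = ∅ := by simpa [bagProd, atomLangs] using hmem
    subst this
    exact ⟨id, by simp [IsAssignment]⟩
  | cons q l ih =>
    rw [List.nodup_cons] at hl
    obtain ⟨u, ⟨hu1, hu2, hu3⟩, v, hv, huv⟩ := hmem
    obtain ⟨F, hF, rfl, rfl⟩ := exists_subset_of_map_eq_add E h u v huv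
    obtain ⟨k, hk1, hk2⟩ := ih hl.2 (fun e he => hok e (Finset.mem_sdiff.1 he).1) hv
    have hkF : ∀ e ∈ F, (if e ∈ F then q else k e) = q := fun e he => if_pos he
    have hq : ∀ e ∈ E, (if e ∈ F then q else k e) = q → e ∈ F := by
      intro e he hke
      by_contra hne
      rw [if_neg hne] at hke
      exact hl.1 (hke ▸ (hk1 e (Finset.mem_sdiff.2 ⟨he, hne⟩)).1)
    have hne : ∀ q' ∈ l, ∀ e ∈ E, (if e ∈ F then q else k e) = q' → e ∉ F ∧ k e = q' := by
      intro q' hq' e he hke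
      by_cases heF : e ∈ F
      · rw [if_pos heF] at hke
        exact absurd (hke ▸ hq') hl.1
      · rw [if_neg heF] at hke
        exact ⟨heF, hke⟩
    refine ⟨fun e => if e ∈ F then q else k e, fun e he => ?_, fun q' hq' hst => ?_⟩
    · by_cases heF : e ∈ F
      · simp only [if_pos heF]
        refine ⟨List.mem_cons_self, ?_⟩
        rw [← hu1 (h e) (Multiset.mem_map_of_mem h heF)]
        exact hok e he
      · simp only [if_neg heF]
        have := hk1 e (Finset.mem_sdiff.2 ⟨he, heF⟩)
        exact ⟨List.mem_cons_of_mem _ this.1, this.2⟩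
    · rcases List.mem_cons.1 hq' with rfl | hq'
      · constructor
        · intro e he e' he' hke hke'
          have hc := hu2 hst
          rw [Multiset.card_map] at hc
          exact Finset.card_le_one.1 hc e (hq e he hke) e' (hq e' he' hke')
        · intro hop
          obtain ⟨e, he⟩ : F.Nonempty := by
            rw [Finset.nonempty_iff_ne_empty]
            rintro rfl
            exact hu3 hst hop (by simp)
          exact ⟨e, hF he, if_pos he⟩
      · obtain ⟨h1, h2⟩ := hk2 q' hq' hst
        constructor
        · intro e he e' he' hke hke'
          obtain ⟨heF, hke⟩ := hne q' hq' e he hke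
          obtain ⟨heF', hke'⟩ := hne q' hq' e' he' hke'
          exact h1 e (Finset.mem_sdiff.2 ⟨he, heF⟩) e' (Finset.mem_sdiff.2 ⟨he', heF'⟩) hke hke'
        · intro hop
          obtain ⟨e, he, hke⟩ := h2 hop
          obtain ⟨he, heF⟩ := Finset.mem_sdiff.1 he
          exact ⟨e, he, by simpa [heF] using hke⟩

/-- Conversely, the fibre of `k` over an atom is its share of the bag. -/
lemma IsAssignment.mem_bagProd {l : List ℕ} (hl : l.Nodup) {k : ℕ → ℕ}
    (hk : IsAssignment E ok st op smb l k) :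
    E.val.map (fun e => smb (k e)) ∈ bagProd (atomLangs st op smb l) := by
  induction l generalizing E with
  | nil =>
    have : E = ∅ := Finset.eq_empty_of_forall_notMem fun e he => by simpa using (hk.1 e he).1
    subst this
    rfl
  | cons q l ih =>
    rw [List.nodup_cons] at hl
    obtain ⟨hk1, hk2⟩ := hk
    have hsplit : E.val.map (fun e => smb (k e)) =
        (E.filter fun e => k e = q).val.map (fun e => smb (k e)) +
          (E.filter fun e => ¬ k e = q).val.map (fun e => smb (k e)) := by
      rw [← Multiset.map_add, Finset.filter_val, Finset.filter_val, Multiset.filter_add_not]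
    refine ⟨_, ⟨?_, ?_, ?_⟩, _, ih hl.2 ⟨?_, ?_⟩, hsplit⟩
    · intro b hb
      obtain ⟨e, he, rfl⟩ := Multiset.mem_map.1 hb
      rw [(Finset.mem_filter.1 he).2]
    · intro hst
      rw [Multiset.card_map]
      refine Finset.card_le_one.2 fun e he e' he' => ?_
      rw [Finset.mem_filter] at he he'
      exact (hk2 q List.mem_cons_self hst).1 e he.1 e' he'.1 he.2 he'.2
    · intro hst hop h0
      obtain ⟨e, he, hke⟩ := (hk2 q List.mem_cons_self hst).2 hop
      have h1 := Multiset.map_eq_zero.1 h0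
      have h2 : e ∈ (E.filter fun e => k e = q).val := Finset.mem_filter.2 ⟨he, hke⟩
      rw [h1] at h2
      exact absurd h2 (Multiset.notMem_zero e)
    · intro e he
      rw [Finset.mem_filter] at he
      exact ⟨(List.mem_cons.1 (hk1 e he.1).1).resolve_left he.2, (hk1 e he.1).2⟩
    · intro q' hq' hst
      have hne : q' ≠ q := fun h => hl.1 (h ▸ hq')
      obtain ⟨h1, h2⟩ := hk2 q' (List.mem_cons_of_mem _ hq') hst
      constructor
      · intro e he e' he'
        exact h1 e (Finset.mem_filter.1 he).1 e' (Finset.mem_filter.1 he').1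
      · intro hop
        obtain ⟨e, he, hke⟩ := h2 hop
        exact ⟨e, Finset.mem_filter.2 ⟨he, hke ▸ hne⟩, hke⟩

/-- Assignments of edges to atoms are perfect matchings in a bipartite graph which contains every
edge and every atom without star on both sides. -/
lemma exists_isAssignment_iff_matching {l : List ℕ} (hdis : ∀ e ∈ E, e ∉ l) :
    (∃ k, IsAssignment E ok st op smb l k) ↔
      ∃ f : ℕ → ℕ,
        (∀ p, (p ∈ E ∨ (p ∈ l ∧ ¬ st p)) →
          (p ∈ E ∧ (f p ∈ l ∧ ¬ st (f p)) ∧ ok p (smb (f p))) ∨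
          (p ∈ E ∧ f p = p ∧ ∃ r ∈ l, st r ∧ ok p (smb r)) ∨
          ((p ∈ l ∧ ¬ st p) ∧ op p ∧ f p = p) ∨
          ((p ∈ l ∧ ¬ st p) ∧ f p ∈ E ∧ ok (f p) (smb p))) ∧
        Set.InjOn f {p | p ∈ E ∨ (p ∈ l ∧ ¬ st p)} := by
  classical
  constructor
  · rintro ⟨k, hk1, hk2⟩
    have hex : ∀ q, ∃ e, (∃ e' ∈ E, k e' = q) → e ∈ E ∧ k e = q := by
      intro q
      by_cases h : ∃ e' ∈ E, k e' = q
      · obtain ⟨e, he, hke⟩ := h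
        exact ⟨e, fun _ => ⟨he, hke⟩⟩
      · exact ⟨0, fun h' => absurd h' h⟩
    choose g hg using hex
    -- Every edge at an atom without star is swapped with that atom; edges at starred atoms and
    -- unused atoms are fixed.
    set f : ℕ → ℕ := fun p =>
      if p ∈ E then (if st (k p) then p else k p)
      else if ∃ e ∈ E, k e = p then g p else p with hf
    have hf1 : ∀ p ∈ E, st (k p) → f p = p := fun p hp h => by simp [hf, hp, h]
    have hf2 : ∀ p ∈ E, ¬ st (k p) → f p = k p := fun p hp h => by simp [hf, hp, h]
    have hf3 : ∀ p ∈ l, (∃ e ∈ E, k e = p) → f p ∈ E ∧ k (f p) = p := fun p hp h => by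
      have hpE : p ∉ E := fun h => hdis p h hp
      have : f p = g p := by simp only [hf, if_neg hpE, if_pos h]
      rw [this]
      exact hg p h
    have hf4 : ∀ p ∈ l, (¬ ∃ e ∈ E, k e = p) → f p = p := fun p hp h => by
      have hpE : p ∉ E := fun h => hdis p h hp
      simp only [hf, if_neg hpE, if_neg h]
    refine ⟨f, ?_, ?_⟩
    · rintro p (hp | ⟨hp, hst⟩)
      · obtain ⟨hkl, hok⟩ := hk1 p hp
        by_cases hs : st (k p)
        · exact .inr (.inl ⟨hp, hf1 p hp hs, k p, hkl, hs, hok⟩)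
        · rw [hf2 p hp hs]
          exact .inl ⟨hp, ⟨hkl, hs⟩, hok⟩
      · by_cases hc : ∃ e ∈ E, k e = p
        · obtain ⟨h1, h2⟩ := hf3 p hp hc
          have := (hk1 (f p) h1).2
          rw [h2] at this
          exact .inr (.inr (.inr ⟨⟨hp, hst⟩, h1, this⟩))
        · refine .inr (.inr (.inl ⟨⟨hp, hst⟩, ?_, hf4 p hp hc⟩))
          by_contra hop
          exact hc ((hk2 p hp hst).2 hop)
    · rintro p (hp | ⟨hp, hst⟩) p' (hp' | ⟨hp', hst'⟩) hpp
      · by_cases hs : st (k p) <;> by_cases hs' : st (k p')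
        · rwa [hf1 p hp hs, hf1 p' hp' hs'] at hpp
        · rw [hf1 p hp hs, hf2 p' hp' hs'] at hpp
          exact absurd (hpp ▸ (hk1 p' hp').1) (hdis p hp)
        · rw [hf2 p hp hs, hf1 p' hp' hs'] at hpp
          exact absurd (hpp ▸ (hk1 p hp).1) (hdis p' hp')
        · rw [hf2 p hp hs, hf2 p' hp' hs'] at hpp
          exact (hk2 _ (hk1 p hp).1 hs).1 p hp p' hp' rfl hpp.symm
      · by_cases hc : ∃ e ∈ E, k e = p'
        · obtain ⟨h1, h2⟩ := hf3 p' hp' hc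
          by_cases hs : st (k p)
          · rw [hf1 p hp hs] at hpp
            rw [← hpp] at h2
            exact absurd (h2 ▸ hs) hst'
          · rw [hf2 p hp hs] at hpp
            exact absurd (hk1 p hp).1 (hdis _ (hpp ▸ h1))
        · rw [hf4 p' hp' hc] at hpp
          by_cases hs : st (k p)
          · rw [hf1 p hp hs] at hpp
            exact absurd hp' (hdis _ (hpp ▸ hp))
          · rw [hf2 p hp hs] at hpp
            exact absurd ⟨p, hp, hpp⟩ hc
      · by_cases hc : ∃ e ∈ E, k e = p
        · obtain ⟨h1, h2⟩ := hf3 p hp hc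
          by_cases hs : st (k p')
          · rw [hf1 p' hp' hs] at hpp
            rw [hpp] at h2
            exact absurd (h2 ▸ hs) hst
          · rw [hf2 p' hp' hs] at hpp
            exact absurd (hk1 p' hp').1 (hdis _ (hpp ▸ h1))
        · rw [hf4 p hp hc] at hpp
          by_cases hs : st (k p')
          · rw [hf1 p' hp' hs] at hpp
            exact absurd hp (hdis _ (hpp ▸ hp'))
          · rw [hf2 p' hp' hs] at hpp
            exact absurd ⟨p', hp', hpp.symm⟩ hc
      · by_cases hc : ∃ e ∈ E, k e = p <;> by_cases hc' : ∃ e ∈ E, k e = p'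
        · rw [← (hf3 p hp hc).2, hpp, (hf3 p' hp' hc').2]
        · have h1 := (hf3 p hp hc).1
          rw [hpp, hf4 p' hp' hc'] at h1
          exact absurd hp' (hdis _ h1)
        · have h1 := (hf3 p' hp' hc').1
          rw [← hpp, hf4 p hp hc] at h1
          exact absurd hp (hdis _ h1)
        · rwa [hf4 p hp hc, hf4 p' hp' hc'] at hpp
  · rintro ⟨f, hf, hinj⟩
    have hstar : ∀ e, ∃ r, (∃ r ∈ l, st r ∧ ok e (smb r)) → r ∈ l ∧ st r ∧ ok e (smb r) := by
      intro e
      by_cases h : ∃ r ∈ l, st r ∧ ok e (smb r)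
      · obtain ⟨r, hr⟩ := h
        exact ⟨r, fun _ => hr⟩
      · exact ⟨0, fun h' => absurd h' h⟩
    choose g hg using hstar
    have hE : ∀ e ∈ E, ((f e ∈ l ∧ ¬ st (f e)) ∧ ok e (smb (f e))) ∨
        (f e = e ∧ ∃ r ∈ l, st r ∧ ok e (smb r)) := by
      intro e he
      rcases hf e (.inl he) with h | h | h | h
      · exact .inl h.2
      · exact .inr h.2
      · exact absurd h.1.1 (hdis e he)
      · exact absurd h.1.1 (hdis e he)
    -- An edge that is not matched to an atom is matched to itself, and goes to a starred atom that
    -- fits.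
    set k : ℕ → ℕ := fun e => if f e ∈ l then f e else g e with hk
    have hk1 : ∀ e ∈ E, f e ∈ l → k e = f e := fun e _ h => if_pos h
    have hk2 : ∀ e ∈ E, f e ∉ l → k e ∈ l ∧ st (k e) ∧ ok e (smb (k e)) := by
      intro e he h
      have h' : k e = g e := if_neg h
      rw [h']
      rcases hE e he with h1 | h1
      · exact absurd h1.1.1 h
      · exact hg e h1.2
    refine ⟨k, fun e he => ?_, fun q hq hst => ⟨fun e he e' he' hke hke' => ?_, fun hop => ?_⟩⟩
    · by_cases h : f e ∈ l
      · rw [hk1 e he h]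
        rcases hE e he with h1 | h1
        · exact ⟨h, h1.2⟩
        · exact absurd (h1.1 ▸ h) (hdis e he)
      · exact ⟨(hk2 e he h).1, (hk2 e he h).2.2⟩
    · have hfk : ∀ e ∈ E, k e = q → f e = q := by
        intro e he hke
        by_cases h : f e ∈ l
        · rw [← hk1 e he h, hke]
        · exact absurd (hke ▸ (hk2 e he h).2.1) hst
      exact hinj (.inl he) (.inl he') ((hfk e he hke).trans (hfk e' he' hke').symm)
    · set X : Finset ℕ := E ∪ l.toFinset.filter (fun p => ¬ st p) with hX
      have hXmem : ∀ p, p ∈ X ↔ (p ∈ E ∨ (p ∈ l ∧ ¬ st p)) := fun p => by simp [hX]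
      have hmaps : Set.MapsTo f X X := by
        intro p hp
        rw [Finset.mem_coe, hXmem] at hp ⊢
        rcases hf p hp with h | h | h | h
        · exact .inr h.2.1
        · rw [h.2.1]; exact hp
        · rw [h.2.2]; exact hp
        · exact .inl h.2.1
      have hinj' : Set.InjOn f X := hinj.mono fun p hp => (hXmem p).1 hp
      -- An injective map of the finite set `X` to itself is surjective. So an atom that is not
      -- optional is hit, and only an edge can hit it; the lower bounds on multiplicities come from
      -- this.
      have hsurj := Finset.surjOn_of_injOn_of_card_le f hmaps hinj' le_rfl
      obtain ⟨p, hp, hpq⟩ := hsurj ((hXmem q).2 (.inr ⟨hq, hst⟩) : q ∈ (X : Set ℕ))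
      rcases hf p ((hXmem p).1 hp) with h | h | h | h
      · exact ⟨p, h.1, by rw [hk1 p h.1 (hpq ▸ hq), hpq]⟩
      · exact absurd hq (hdis _ (by rw [← hpq, h.2.1]; exact h.1))
      · exact absurd (by rw [← hpq, h.2.2]; exact h.2.1) hop
      · exact absurd hq (hdis _ (by rw [← hpq]; exact h.2.1))

end assignment

end ShExVal

namespace ShExVal

open Function

/-! ### Reading the word of an input -/

/-- In the word `w`, an edge `(u, a, v)` begins at `p`. -/
def EdgeAt (w : List Token) (p u a v : ℕ) : Prop :=
  (Token.edge :: (encodeNum u ++ encodeNum a ++ encodeNum v)) <+: w.drop p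

/-- In the word `w`, a symbol `(a, s)` begins at `p`. -/
def SymAt (w : List Token) (p a s : ℕ) : Prop :=
  (Token.sym :: (encodeNum a ++ encodeNum s)) <+: w.drop p

/-- In the word `w`, a star stands before the position `p`. -/
def StarAt (w : List Token) (p : ℕ) : Prop := ∃ p', p = p' + 1 ∧ w[p']? = some .star

/-- In the word `w`, a disjunction with `ε` stands before the position `p`. -/
def OptAt (w : List Token) (p : ℕ) : Prop :=
  ∃ p', p = p' + 2 ∧ w[p']? = some .alt ∧ w[p' + 1]? = some .eps

/-- The number of rules that begin before the position `p`. -/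
def ruleCount (w : List Token) (p : ℕ) : ℕ := (w.take p).count .rule

/-- No multiplicity precedes the end of the word `A`. -/
def PlainEnd (A : List Token) : Prop :=
  ¬ StarAt A A.length ∧ ¬ OptAt A A.length ∧ ∀ p, A.length = p + 1 → A[p]? ≠ some .alt

lemma prefix_append_iff {α : Type} (l₁ l₂ l : List α) :
    l₁ ++ l₂ <+: l ↔ l₁ <+: l ∧ l₂ <+: l.drop l₁.length := by
  constructor
  · rintro ⟨m, rfl⟩
    refine ⟨⟨l₂ ++ m, by simp⟩, ⟨m, by simp⟩⟩
  · rintro ⟨⟨m, rfl⟩, h⟩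
    rw [List.drop_left] at h
    obtain ⟨m', rfl⟩ := h
    exact ⟨m', by simp⟩

lemma getElem?_of_prefix_drop {α : Type} {w l : List α} {a : α} {p : ℕ}
    (h : (a :: l) <+: w.drop p) : w[p]? = some a := by
  obtain ⟨m, hm⟩ := h
  have := List.getElem?_drop (xs := w) (i := p) (j := 0)
  rw [← hm] at this
  simpa using this.symm

lemma cons_prefix_drop_iff {α : Type} {w l : List α} {a : α} {p : ℕ} :
    (a :: l) <+: w.drop p ↔ w[p]? = some a ∧ l <+: w.drop (p + 1) := by
  constructor
  · intro h
    refine ⟨getElem?_of_prefix_drop h, ?_⟩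
    have := (prefix_append_iff [a] l _).1 h
    simpa [Nat.add_comm] using this.2
  · rintro ⟨h1, h2⟩
    obtain ⟨hp, hw⟩ := List.getElem?_eq_some_iff.1 h1
    rw [List.drop_eq_getElem_cons hp, hw]
    exact List.cons_prefix_cons.2 ⟨rfl, h2⟩

@[simp]
lemma length_encodeNum (n : ℕ) : (encodeNum n).length = n + 1 := by simp [encodeNum]

lemma encodeNum_succ (n : ℕ) : encodeNum (n + 1) = .digit :: encodeNum n := by
  simp [encodeNum, List.replicate_succ]

/-- The end mark makes the code of numbers prefix-free, so whatever is read at a position is unique.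
-/
lemma encodeNum_prefix_inj {m n : ℕ} {l : List Token} (hm : encodeNum m <+: l)
    (hn : encodeNum n <+: l) : m = n := by
  induction m generalizing n l with
  | zero =>
    cases n with
    | zero => rfl
    | succ n =>
      rcases l with _ | ⟨b, l⟩
      · simp [encodeNum] at hm
      · rw [encodeNum_succ, List.cons_prefix_cons] at hn
        simp [encodeNum, ← hn.1] at hm
  | succ m ih =>
    rcases l with _ | ⟨b, l⟩
    · simp [encodeNum] at hm
    · rw [encodeNum_succ, List.cons_prefix_cons] at hm
      cases n with
      | zero => simp [encodeNum, ← hm.1] at hn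
      | succ n =>
        rw [encodeNum_succ, List.cons_prefix_cons] at hn
        rw [ih hm.2 hn.2]

lemma mem_encodeNum {n : ℕ} {a : Token} (h : a ∈ encodeNum n) : a = .digit ∨ a = .endNum := by
  simp only [encodeNum, List.mem_append, List.mem_replicate, List.mem_singleton] at h
  tauto

lemma EdgeAt.inj {w : List Token} {p u a v u' a' v' : ℕ} (h : EdgeAt w p u a v)
    (h' : EdgeAt w p u' a' v') : u = u' ∧ a = a' ∧ v = v' := by
  rw [EdgeAt, cons_prefix_drop_iff, prefix_append_iff, prefix_append_iff] at h h'
  obtain ⟨-, ⟨h1, h2⟩, h3⟩ := h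
  obtain ⟨-, ⟨h1', h2'⟩, h3'⟩ := h'
  obtain rfl := encodeNum_prefix_inj h1 h1'
  obtain rfl := encodeNum_prefix_inj h2 h2'
  exact ⟨rfl, rfl, encodeNum_prefix_inj h3 h3'⟩

lemma SymAt.inj {w : List Token} {p a s a' s' : ℕ} (h : SymAt w p a s)
    (h' : SymAt w p a' s') : a = a' ∧ s = s' := by
  rw [SymAt, cons_prefix_drop_iff, prefix_append_iff] at h h'
  obtain ⟨-, h1, h2⟩ := h
  obtain ⟨-, h1', h2'⟩ := h'
  obtain rfl := encodeNum_prefix_inj h1 h1'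
  exact ⟨rfl, encodeNum_prefix_inj h2 h2'⟩

lemma getElem?_infix {α : Type} (A m B : List α) (i : ℕ) (hi : i < m.length) :
    (A ++ m ++ B)[A.length + i]? = m[i]? := by
  rw [List.append_assoc, List.getElem?_append_right (by omega), Nat.add_sub_cancel_left,
    List.getElem?_append_left hi]

/-- The positions of a symbol inside an infix. -/
lemma mem_infix_iff {α : Type} {A m B : List α} {p : ℕ} {x : α} :
    (A.length ≤ p ∧ p < A.length + m.length ∧ (A ++ m ++ B)[p]? = some x) ↔
      ∃ i, p = A.length + i ∧ m[i]? = some x := by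
  constructor
  · rintro ⟨h1, h2, h3⟩
    refine ⟨p - A.length, by omega, ?_⟩
    rw [← getElem?_infix A m B _ (by omega), Nat.add_sub_cancel' h1, h3]
  · rintro ⟨i, rfl, hi⟩
    have := (List.getElem?_eq_some_iff.1 hi).1
    exact ⟨by omega, by omega, by rw [getElem?_infix A m B i this, hi]⟩

lemma getElem?_cons_eq_some_of_notMem {α : Type} {x : α} {l : List α} (hx : x ∉ l) (i : ℕ) :
    (x :: l)[i]? = some x ↔ i = 0 := by
  cases i with
  | zero => simp
  | succ i =>
    simp only [List.getElem?_cons_succ, Nat.add_eq_zero_iff, one_ne_zero, and_false, iff_false]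
    exact fun h => hx (List.mem_of_getElem? h)

/-! ### The atoms of a rule -/

lemma plainEnd_concat (A : List Token) {x : Token} (h1 : x ≠ .star) (h2 : x ≠ .alt)
    (h3 : x ≠ .eps) : PlainEnd (A ++ [x]) := by
  refine ⟨?_, ?_, ?_⟩
  · rintro ⟨p, hp, hs⟩
    have : p = A.length := by simpa using hp.symm
    subst this
    simp at hs
    exact h1 hs
  · rintro ⟨p, hp, -, hs⟩
    have : p + 1 = A.length := by simpa using hp.symm
    rw [this] at hs
    simp at hs
    exact h3 hs
  · intro p hp hs
    have : p = A.length := by simpa using hp.symm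
    subst this
    simp at hs
    exact h2 hs

lemma plainEnd_append_encodeNum (A : List Token) (n : ℕ) : PlainEnd (A ++ encodeNum n) := by
  rw [encodeNum, ← List.append_assoc]
  exact plainEnd_concat _ (by simp) (by simp) (by simp)

/-- The last clause of `PlainEnd` is needed here: an `alt` at the end of `A` would combine with the
new `eps` to a spurious `?`. -/
lemma plainEnd_append_eps {A : List Token} (hA : PlainEnd A) : PlainEnd (A ++ [Token.eps]) := by
  refine ⟨?_, ?_, ?_⟩
  · rintro ⟨p, hp, hs⟩
    have : p = A.length := by simpa using hp.symm
    subst this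
    simp at hs
  · rintro ⟨p, hp, hs, -⟩
    have hp' : A.length = p + 1 := by simpa using hp
    rw [List.getElem?_append_left (by omega)] at hs
    exact hA.2.2 p hp' hs
  · intro p hp hs
    have : p = A.length := by simpa using hp.symm
    subst this
    simp at hs

/-- Multiplicities are read off the one or two tokens before a symbol. This lemma ensures that the
end of one factor is never mistaken for a multiplicity of the next. -/
lemma plainEnd_append_encodeRBE {k l : ℕ} {e : RBE (Fin k × Fin l)} (he : e.IsMultConc)
    {A : List Token} (hA : PlainEnd A) : PlainEnd (A ++ encodeRBE e) := by
  induction he generalizing A with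
  | eps => exact plainEnd_append_eps hA
  | one a | opt a | star a | plus a =>
    simp only [encodeRBE, RBE.opt, RBE.plus, List.append_assoc,
      List.cons_append, List.nil_append]
    simp only [← List.append_assoc, ← List.cons_append]
    exact plainEnd_append_encodeNum _ _
  | @conc e f _ _ ihe ihf =>
    have h := ihf (ihe (plainEnd_concat A (x := .conc) (by simp) (by simp) (by simp)))
    simpa [encodeRBE] using h

lemma starAt_append_left {A B : List Token} {p : ℕ} (hp : p ≤ A.length) :
    StarAt (A ++ B) p ↔ StarAt A p := by
  refine exists_congr fun p' => and_congr_right fun h => ?_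
  rw [List.getElem?_append_left (by omega)]

lemma optAt_append_left {A B : List Token} {p : ℕ} (hp : p ≤ A.length) :
    OptAt (A ++ B) p ↔ OptAt A p := by
  refine exists_congr fun p' => and_congr_right fun h => ?_
  rw [List.getElem?_append_left (by omega), List.getElem?_append_left (by omega)]

/-- The positions `L` of symbols of a word, which stand for the symbols `smb`, represent the
expression `e` between the words `A` and `B`. -/
def AtomsAt {k l : ℕ} (A : List Token) (e : RBE (Fin k × Fin l)) (B : List Token) (L : List ℕ)
    (smb : ℕ → Fin k × Fin l) : Prop :=
  L.Nodup ∧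
    e.lang = bagProd (atomLangs (StarAt (A ++ encodeRBE e ++ B)) (OptAt (A ++ encodeRBE e ++ B))
      smb L) ∧
    (∀ p, p ∈ L ↔ A.length ≤ p ∧ p < A.length + (encodeRBE e).length ∧
      (A ++ encodeRBE e ++ B)[p]? = some .sym) ∧
    ∀ p ∈ L, SymAt (A ++ encodeRBE e ++ B) p (smb p).1 (smb p).2

/-- A symbol with a multiplicity that is written as `M`. -/
lemma atomsAt_atom {k l : ℕ} (A B M : List Token) (e : RBE (Fin k × Fin l)) (a : Fin k × Fin l)
    (st op : Prop) (hM : .sym ∉ M)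
    (he : encodeRBE e = M ++ .sym :: (encodeNum a.1 ++ encodeNum a.2))
    (hlang : e.lang = atomBags st op a) (hst : StarAt (A ++ M) (A.length + M.length) ↔ st)
    (hop : OptAt (A ++ M) (A.length + M.length) ↔ op) :
    AtomsAt A e B [A.length + M.length] fun _ => a := by
  have hlen : (A ++ M).length = A.length + M.length := List.length_append
  refine ⟨List.nodup_singleton _, ?_, fun p => ?_, fun p hp => ?_⟩
  · simp only [atomLangs, List.map_singleton, bagProd_singleton]
    rw [hlang, he, ← List.append_assoc, List.append_assoc (A ++ M), starAt_append_left hlen.ge,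
      optAt_append_left hlen.ge, propext hst, propext hop]
  · have hnum : ∀ n, Token.sym ∉ encodeNum n := fun n h => by
      rcases mem_encodeNum h with h | h <;> simp at h
    rw [mem_infix_iff, List.mem_singleton, he]
    constructor
    · rintro rfl
      exact ⟨M.length, rfl, by simp⟩
    · rintro ⟨i, rfl, hi⟩
      congr 1
      rcases lt_or_ge i M.length with h | h
      · rw [List.getElem?_append_left h] at hi
        exact absurd (List.mem_of_getElem? hi) hM
      · rw [List.getElem?_append_right h, getElem?_cons_eq_some_of_notMem] at hi
        · omega
        · simp [hnum]
  · rw [List.mem_singleton] at hp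
    subst hp
    refine ⟨B, ?_⟩
    rw [he, ← hlen, ← List.append_assoc, List.append_assoc (A ++ M), List.drop_left]

/-- Each factor sees the other as part of its context. The positions of the two factors are
separated by the beginning of the second, where the symbol maps are glued. -/
lemma AtomsAt.conc {k l : ℕ} {A B : List Token} {e f : RBE (Fin k × Fin l)} {L L' : List ℕ}
    {smb smb' : ℕ → Fin k × Fin l} (he : AtomsAt (A ++ [Token.conc]) e (encodeRBE f ++ B) L smb)
    (hf : AtomsAt (A ++ [Token.conc] ++ encodeRBE e) f B L' smb') :
    AtomsAt A (.conc e f) B (L ++ L') fun p =>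
      if p < (A ++ [Token.conc] ++ encodeRBE e).length then smb p else smb' p := by
  have hw : A ++ encodeRBE (.conc e f) ++ B =
      A ++ [Token.conc] ++ encodeRBE e ++ (encodeRBE f ++ B) := by simp [encodeRBE]
  have hw' : A ++ encodeRBE (.conc e f) ++ B =
      A ++ [Token.conc] ++ encodeRBE e ++ encodeRBE f ++ B := by simp [encodeRBE]
  obtain ⟨he1, he2, he3, he4⟩ := he
  obtain ⟨hf1, hf2, hf3, hf4⟩ := hf
  rw [← hw] at he2 he4
  simp only [← hw] at he3
  rw [← hw'] at hf2 hf4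
  simp only [← hw'] at hf3
  have hlt : ∀ p ∈ L, p < (A ++ [Token.conc] ++ encodeRBE e).length := fun p hp => by
    rw [List.length_append]
    exact ((he3 p).1 hp).2.1
  have hge : ∀ p ∈ L', ¬ p < (A ++ [Token.conc] ++ encodeRBE e).length := fun p hp =>
    not_lt.2 ((hf3 p).1 hp).1
  refine ⟨?_, ?_, fun p => ?_, fun p hp => ?_⟩
  · exact List.nodup_append.2 ⟨he1, hf1, fun p hp q hq hpq => hge q hq (hpq ▸ hlt p hp)⟩
  · rw [RBE.lang, he2, hf2]
    simp only [atomLangs, List.map_append, bagProd_append]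
    congr 2
    · exact List.map_congr_left fun p hp => by rw [if_pos (hlt p hp)]
    · exact List.map_congr_left fun p hp => by rw [if_neg (hge p hp)]
  · rw [List.mem_append, he3, hf3]
    simp only [List.length_append, encodeRBE, List.length_cons, List.length_nil]
    constructor
    · rintro (⟨h1, h2, h3⟩ | ⟨h1, h2, h3⟩)
      · exact ⟨by omega, by omega, h3⟩
      · exact ⟨by omega, by omega, h3⟩
    · rintro ⟨h1, h2, h3⟩
      rcases Nat.lt_or_ge p (A.length + 1 + (encodeRBE e).length) with h | h
      · refine .inl ⟨?_, by omega, h3⟩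
        rcases Nat.lt_or_ge A.length p with h' | h'
        · omega
        · have : p = A.length := by omega
          subst this
          simp at h3
      · exact .inr ⟨by omega, by omega, h3⟩
  · rcases List.mem_append.1 hp with hp | hp
    · simpa only [if_pos (hlt p hp)] using he4 p hp
    · simpa only [if_neg (hge p hp)] using hf4 p hp

/-- Induction on the class, with an arbitrary context after the expression and a context before it
that suggests no multiplicity. `a⁺` is the concatenation of the atoms `a` and `a*`. The alphabet
must be nonempty only to give `smb` a value in the case of `ε`. -/
lemma exists_atomsAt {k l : ℕ} {e : RBE (Fin k × Fin l)} (he : e.IsMultConc)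
    (hkl : 0 < k ∧ 0 < l) {A : List Token} (hA : PlainEnd A) (B : List Token) :
    ∃ L smb, AtomsAt A e B L smb := by
  have hone : ∀ (a : Fin k × Fin l) (A B : List Token), PlainEnd A →
      ∃ L smb, AtomsAt A (.sym a) B L smb := fun a A B hA =>
    ⟨_, _, atomsAt_atom A B [] (.sym a) a False False (by simp) (by simp [encodeRBE]) (lang_sym a)
      (by simpa using hA.1) (by simpa using hA.2.1)⟩
  have hstar : ∀ (a : Fin k × Fin l) (A B : List Token), PlainEnd A →
      ∃ L smb, AtomsAt A (.star (.sym a)) B L smb := fun a A B hA =>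
    ⟨_, _, atomsAt_atom A B [.star] (.star (.sym a)) a True False (by simp) (by simp [encodeRBE])
      (lang_star a) (by simp [StarAt]) (by
        rw [iff_false]
        rintro ⟨p, hp, -, hs⟩
        have : p + 1 = A.length := by simpa using hp.symm
        rw [this] at hs
        simp at hs)⟩
  induction he generalizing A B with
  | eps =>
    refine ⟨[], fun _ => (⟨0, hkl.1⟩, ⟨0, hkl.2⟩), List.nodup_nil, rfl, fun p => ?_, by simp⟩
    rw [mem_infix_iff]
    simp [encodeRBE]
    intro i _
    cases i <;> simp
  | one a => exact hone a A B hA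
  | opt a =>
    refine ⟨_, _, atomsAt_atom A B [.alt, .eps] (RBE.sym a).opt a False True (by simp)
      (by simp [encodeRBE, RBE.opt]) (lang_opt a) ?_ ?_⟩
    · rw [iff_false]
      rintro ⟨p, hp, hs⟩
      have : p = A.length + 1 := by simp at hp; omega
      subst this
      simp at hs
    · rw [iff_true]
      exact ⟨A.length, by simp, by simp, by simp⟩
  | star a => exact hstar a A B hA
  | plus a =>
    have hc := plainEnd_concat A (x := .conc) (by simp) (by simp) (by simp)
    obtain ⟨L, smb, h⟩ := hone a (A ++ [Token.conc]) (encodeRBE (.star (.sym a)) ++ B) hc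
    obtain ⟨L', smb', h'⟩ := hstar a (A ++ [Token.conc] ++ encodeRBE (.sym a)) B
      (plainEnd_append_encodeRBE (.one a) hc)
    exact ⟨_, _, h.conc h'⟩
  | @conc e f he hf ihe ihf =>
    have hc := plainEnd_concat A (x := .conc) (by simp) (by simp) (by simp)
    obtain ⟨L, smb, h⟩ := ihe hc (encodeRBE f ++ B)
    obtain ⟨L', smb', h'⟩ := ihf (plainEnd_append_encodeRBE he hc) B
    exact ⟨_, _, h.conc h'⟩

end ShExVal

namespace ShExVal

open Function

/-! ### The edges of an input -/

lemma edge_notMem_encodeNum (n : ℕ) : Token.edge ∉ encodeNum n := fun h => by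
  rcases mem_encodeNum h with h | h <;> simp at h

/-- The token `edge` occurs, from the end of `H` on, only at the beginnings of encoded edges, and
what follows determines the edge. The prefix `H` absorbs the edges already treated. -/
lemma exists_edgePos {n k : ℕ} (L : List (Fin n × Fin k × Fin n)) (hL : L.Nodup)
    (H R : List Token) (hR : Token.edge ∉ R) :
    ∃ pos : Fin n × Fin k × Fin n → ℕ, (∀ e ∈ L, H.length ≤ pos e) ∧
      ∀ p, H.length ≤ p → ∀ u a v, EdgeAt (H ++ L.flatMap encodeEdge ++ R) p u a v ↔
        ∃ e ∈ L, pos e = p ∧ (e.1 : ℕ) = u ∧ (e.2.1 : ℕ) = a ∧ (e.2.2 : ℕ) = v := by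
  induction L generalizing H with
  | nil =>
    refine ⟨fun _ => 0, by simp, fun p hp u a v => ?_⟩
    simp only [List.flatMap_nil, List.append_nil, List.not_mem_nil, false_and, exists_false,
      iff_false]
    intro h
    have := getElem?_of_prefix_drop h
    rw [List.getElem?_append_right hp] at this
    exact hR (List.mem_of_getElem? this)
  | cons e₀ L ih =>
    rw [List.nodup_cons] at hL
    obtain ⟨pos, hpos, ih⟩ := ih hL.2 (H ++ encodeEdge e₀)
    have hw : H ++ (e₀ :: L).flatMap encodeEdge ++ R =
        H ++ encodeEdge e₀ ++ L.flatMap encodeEdge ++ R := by simp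
    have hw' : H ++ (e₀ :: L).flatMap encodeEdge ++ R =
        H ++ encodeEdge e₀ ++ (L.flatMap encodeEdge ++ R) := by simp
    have hlen : (H ++ encodeEdge e₀).length = H.length + (encodeEdge e₀).length :=
      List.length_append
    have hlen' : 0 < (encodeEdge e₀).length := by simp [encodeEdge]
    have h₀ : EdgeAt (H ++ (e₀ :: L).flatMap encodeEdge ++ R) H.length e₀.1 e₀.2.1 e₀.2.2 := by
      rw [hw', List.append_assoc, EdgeAt, List.drop_left]
      exact List.prefix_append _ _
    have hne : ∀ e ∈ L, e ≠ e₀ := fun e he h => hL.1 (h ▸ he)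
    classical
    refine ⟨fun e => if e = e₀ then H.length else pos e, fun e he => ?_, fun p hp u a v => ?_⟩
    · rcases List.mem_cons.1 he with rfl | he
      · simp
      · have := hpos e he
        simp only [if_neg (hne e he)]
        omega
    · have hex : (∃ e ∈ e₀ :: L, (if e = e₀ then H.length else pos e) = p ∧ (e.1 : ℕ) = u ∧
            (e.2.1 : ℕ) = a ∧ (e.2.2 : ℕ) = v) ↔
          (H.length = p ∧ (e₀.1 : ℕ) = u ∧ (e₀.2.1 : ℕ) = a ∧ (e₀.2.2 : ℕ) = v) ∨
          ∃ e ∈ L, pos e = p ∧ (e.1 : ℕ) = u ∧ (e.2.1 : ℕ) = a ∧ (e.2.2 : ℕ) = v := by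
        simp only [List.mem_cons, or_and_right, exists_or, exists_eq_left, if_true]
        refine or_congr_right (exists_congr fun e => and_congr_right fun he => ?_)
        rw [if_neg (hne e he)]
      rw [hex]
      rcases Nat.lt_or_ge p (H ++ encodeEdge e₀).length with h | h
      · have hno : ¬ ∃ e ∈ L, pos e = p ∧ (e.1 : ℕ) = u ∧ (e.2.1 : ℕ) = a ∧ (e.2.2 : ℕ) = v := by
          rintro ⟨e, he, hp, -⟩
          have := hpos e he
          omega
        rw [or_iff_left hno]
        constructor
        · intro h1
          have h2 := getElem?_of_prefix_drop h1
          rw [hw'] at h2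
          obtain ⟨i, rfl, hi⟩ := mem_infix_iff.1 ⟨hp, by omega, h2⟩
          rw [encodeEdge, getElem?_cons_eq_some_of_notMem] at hi
          · subst hi
            obtain ⟨rfl, rfl, rfl⟩ := h1.inj h₀
            exact ⟨rfl, rfl, rfl, rfl⟩
          · simp [edge_notMem_encodeNum]
        · rintro ⟨rfl, rfl, rfl, rfl⟩
          exact h₀
      · rw [hw, ih p h, or_iff_right]
        rintro ⟨hp', -⟩
        omega

/-! ### The rules of an input -/

lemma ruleCount_mono (w : List Token) {p q : ℕ} (h : p ≤ q) : ruleCount w p ≤ ruleCount w q :=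
  (List.take_prefix_take_left h).sublist.count_le _

lemma rule_notMem_encodeNum (n : ℕ) : Token.rule ∉ encodeNum n := fun h => by
  rcases mem_encodeNum h with h | h <;> simp at h

lemma notMem_encodeRBE {k l : ℕ} (e : RBE (Fin k × Fin l)) :
    Token.rule ∉ encodeRBE e ∧ Token.edge ∉ encodeRBE e := by
  induction e <;> simp_all [encodeRBE, rule_notMem_encodeNum, edge_notMem_encodeNum]

lemma ruleCount_length (A B : List Token) : ruleCount (A ++ B) A.length = A.count .rule := by
  rw [ruleCount, List.take_left]

/-- The symbols in a rule are recognized by the number of rules that begin before. -/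
lemma sym_mem_rule_iff {A m B : List Token} {c p : ℕ} (hA : (A ++ [Token.rule]).count .rule = c)
    (hm : Token.rule ∉ m) (hB : ∀ x ∈ B.head?, x = .rule) {w : List Token}
    (hw : w = A ++ [Token.rule] ++ m ++ B) :
    (w[p]? = some .sym ∧ ruleCount w p = c) ↔
      (A ++ [Token.rule]).length ≤ p ∧ p < (A ++ [Token.rule]).length + m.length ∧
        w[p]? = some .sym := by
  have hmc : m.count .rule = 0 := List.count_eq_zero.2 hm
  have h1 : ruleCount w (A ++ [Token.rule]).length = c := by
    rw [hw, List.append_assoc, ruleCount_length, hA]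
  have h2 : ruleCount w (A ++ [Token.rule] ++ m).length = c := by
    rw [hw, ruleCount_length, List.count_append, hA, hmc, add_zero]
  constructor
  · rintro ⟨hs, hc⟩
    refine ⟨?_, ?_, hs⟩
    · by_contra hlt
      -- A position up to the token `rule` of this rule counts only the rules in `A`, that is, at
      -- most `c - 1`.
      have h3 : ruleCount w p ≤ A.count .rule := by
        rw [← ruleCount_length A ([Token.rule] ++ m ++ B)]
        rw [← List.append_assoc, ← List.append_assoc, ← hw]
        refine ruleCount_mono w ?_
        simp at hlt
        omega
      rw [List.count_append] at hA
      simp at hA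
      omega
    · by_contra hge
      rw [← List.length_append, not_lt] at hge
      rcases B with _ | ⟨b, B⟩
      · rw [hw, List.append_nil, List.getElem?_eq_none hge] at hs
        simp at hs
      · obtain rfl := hB b rfl
        rcases hge.eq_or_lt with h | h
        · rw [hw, ← h, List.getElem?_append_right le_rfl] at hs
          simp at hs
        · have h3 : (A ++ [Token.rule] ++ m ++ [Token.rule]).count .rule ≤ ruleCount w p := by
            rw [← ruleCount_length _ B]
            have : A ++ [Token.rule] ++ m ++ [Token.rule] ++ B = w := by rw [hw]; simp
            rw [this]
            refine ruleCount_mono w ?_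
            rw [List.length_append]
            simpa using h
          rw [List.count_append, List.count_append, hA] at h3
          simp at h3
          omega
  · rintro ⟨hge, hlt, hs⟩
    rw [← List.length_append] at hlt
    exact ⟨hs, le_antisymm (h2 ▸ ruleCount_mono w hlt.le) (h1 ▸ ruleCount_mono w hge)⟩

namespace ValidationInput

variable {C : RBEClass} (I : ValidationInput C)

lemma rule_notMem_edges : Token.rule ∉ I.edgeList.flatMap encodeEdge := by
  rw [List.mem_flatMap]
  rintro ⟨e, -, he⟩
  simp [encodeEdge, rule_notMem_encodeNum] at he

lemma count_rule_flatMap (l : List (Fin I.numTypes)) :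
    (l.flatMap fun t => Token.rule :: encodeRBE (I.rule t)).count .rule = l.length := by
  induction l with
  | nil => rfl
  | cons s l ih => simp [ih, List.count_eq_zero.2 (notMem_encodeRBE (I.rule s)).1]

/-- The words before and after the rule of a type. -/
lemma exists_encode_eq (t : Fin I.numTypes) : ∃ A B,
    I.encode = A ++ [Token.rule] ++ encodeRBE (I.rule t) ++ B ∧
      (A ++ [Token.rule]).count .rule = t + 1 ∧ ∀ x ∈ B.head?, x = .rule := by
  set f : Fin I.numTypes → List Token := fun t => Token.rule :: encodeRBE (I.rule t) with hf
  have hsplit : List.finRange I.numTypes = (List.finRange I.numTypes).take t ++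
      t :: (List.finRange I.numTypes).drop (t + 1) := by
    conv_lhs => rw [← List.take_append_drop t (List.finRange I.numTypes)]
    rw [List.drop_eq_getElem_cons (by simp)]
    simp
  refine ⟨encodeNum I.numNodes ++ encodeNum I.numLabels ++ encodeNum I.numTypes ++
    I.edgeList.flatMap encodeEdge ++ ((List.finRange I.numTypes).take t).flatMap f,
    ((List.finRange I.numTypes).drop (t + 1)).flatMap f, ?_, ?_, ?_⟩
  · rw [encode]
    conv_lhs => rw [hsplit]
    simp [hf]
  · simp only [List.count_append, hf, I.count_rule_flatMap, List.count_eq_zero.2 (rule_notMem_encodeNum _),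
      List.count_eq_zero.2 I.rule_notMem_edges]
    simp [t.2.le]
  · intro x hx
    rcases h : (List.finRange I.numTypes).drop (t + 1) with _ | ⟨s, l⟩
    · simp [h] at hx
    · simp [h, hf] at hx
      exact hx.symm

lemma ruleCount_encode_le (p : ℕ) : ruleCount I.encode p ≤ I.numTypes := by
  refine ((List.take_sublist p I.encode).count_le _).trans ?_
  rw [encode]
  simp only [List.count_append, I.count_rule_flatMap, List.count_eq_zero.2 (rule_notMem_encodeNum _),
      List.count_eq_zero.2 I.rule_notMem_edges]
  simp

/-- The types are read off the numbers of rules. -/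
lemma exists_ruleCount_iff (t : ℕ) :
    (∃ p < I.encode.length + 1, ruleCount I.encode p = t + 1) ↔ t < I.numTypes := by
  constructor
  · rintro ⟨p, -, hp⟩
    have := I.ruleCount_encode_le p
    omega
  · intro ht
    obtain ⟨A, B, hw, hA, -⟩ := I.exists_encode_eq ⟨t, ht⟩
    refine ⟨(A ++ [Token.rule]).length, ?_, ?_⟩
    · rw [hw]
      simp
    · rw [hw, List.append_assoc _ _ B, ruleCount_length, hA]

lemma encodeNum_prefix_encode : encodeNum I.numNodes <+: I.encode := by
  rw [encode]
  simp only [List.append_assoc]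
  exact List.prefix_append _ _

lemma numNodes_le : I.numNodes ≤ I.encode.length := by
  have := I.encodeNum_prefix_encode.length_le
  rw [length_encodeNum] at this
  omega

lemma numTypes_le : I.numTypes ≤ I.encode.length := by
  simp [encode]
  omega

/-- The positions of edges. -/
lemma exists_edgeAt_iff : ∃ pos : Fin I.numNodes × Fin I.numLabels × Fin I.numNodes → ℕ,
    ∀ p u a v, EdgeAt I.encode p u a v ↔
      ∃ e ∈ I.edgeList, pos e = p ∧ (e.1 : ℕ) = u ∧ (e.2.1 : ℕ) = a ∧ (e.2.2 : ℕ) = v := by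
  obtain ⟨pos, hpos, h⟩ := exists_edgePos I.edgeList I.edgeList_nodup
    (encodeNum I.numNodes ++ encodeNum I.numLabels ++ encodeNum I.numTypes)
    ((List.finRange I.numTypes).flatMap (fun t => Token.rule :: encodeRBE (I.rule t))) (by
      rw [List.mem_flatMap]
      rintro ⟨t, -, ht⟩
      simp [(notMem_encodeRBE (I.rule t)).2] at ht)
  refine ⟨pos, fun p u a v => ?_⟩
  rcases Nat.lt_or_ge p
    (encodeNum I.numNodes ++ encodeNum I.numLabels ++ encodeNum I.numTypes).length with hp | hp
  · constructor
    · intro h1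
      have h2 := getElem?_of_prefix_drop h1
      rw [encode, List.append_assoc, List.getElem?_append_left hp] at h2
      have := List.mem_of_getElem? h2
      simp [edge_notMem_encodeNum] at this
    · rintro ⟨e, he, rfl, -⟩
      exact absurd (hpos e he) (by omega)
  · exact h p hp u a v

end ValidationInput

end ShExVal

namespace ShExVal

open Function

/-! ### Types of a node as matchings -/

/-- At `p` begins an edge that leaves `v`. -/
def EdgeFrom (w : List Token) (v p : ℕ) : Prop := ∃ a u, EdgeAt w p v a u

/-- At `p` stands a symbol of the rule of `t`. -/
def RuleSym (w : List Token) (t p : ℕ) : Prop := w[p]? = some .sym ∧ ruleCount w p = t + 1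

/-- The edges and the symbols without star, which have to be matched. -/
def ToMatch (w : List Token) (v t p : ℕ) : Prop :=
  EdgeFrom w v p ∨ (RuleSym w t p ∧ ¬ StarAt w p)

/-- The edge at `p` leaves `v`, and the symbol at `q` is possible for it with the types `T`. -/
def Fits (w : List Token) (T : ℕ → ℕ → Prop) (v p q : ℕ) : Prop :=
  ∃ a m s, EdgeAt w p v a m ∧ SymAt w q a s ∧ T m s

/-- The pairs that may be matched. -/
def MayMatch (w : List Token) (T : ℕ → ℕ → Prop) (v t p q : ℕ) : Prop :=
  (EdgeFrom w v p ∧ (RuleSym w t q ∧ ¬ StarAt w q) ∧ Fits w T v p q) ∨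
  (EdgeFrom w v p ∧ q = p ∧ ∃ r, RuleSym w t r ∧ StarAt w r ∧ Fits w T v p r) ∨
  ((RuleSym w t p ∧ ¬ StarAt w p) ∧ OptAt w p ∧ q = p) ∨
  ((RuleSym w t p ∧ ¬ StarAt w p) ∧ EdgeFrom w v q ∧ Fits w T v q p)

/-- All edges and symbols can be matched. -/
def HasMatching (w : List Token) (T : ℕ → ℕ → Prop) (v t : ℕ) : Prop :=
  ∃ f : ℕ → ℕ, (∀ p, ToMatch w v t p → MayMatch w T v t p (f p)) ∧
    Set.InjOn f {p | ToMatch w v t p}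

/-- Over an empty alphabet the expression is built from `ε` alone. This case is treated separately,
since no default symbol is available. -/
lemma zero_mem_lang_of_isEmpty {Δ : Type} [IsEmpty Δ] {e : RBE Δ} (he : e.IsMultConc) :
    0 ∈ e.lang := by
  induction he with
  | eps => rfl
  | one a | opt a | star a | plus a => exact isEmptyElim a
  | conc _ _ ihe ihf => exact ⟨0, ihe, 0, ihf, rfl⟩

lemma sym_notMem_of_isEmpty {k l : ℕ} [IsEmpty (Fin k × Fin l)] {e : RBE (Fin k × Fin l)}
    (he : e.IsMultConc) : Token.sym ∉ encodeRBE e := by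
  induction he with
  | eps => simp [encodeRBE]
  | one a | opt a | star a | plus a => exact isEmptyElim a
  | conc _ _ ihe ihf => simp [encodeRBE, ihe, ihf]

namespace ValidationInput

variable (I : ValidationInput rbeMultConc)

lemma ruleSym_iff (t : Fin I.numTypes) {A B : List Token}
    (hw : I.encode = A ++ [Token.rule] ++ encodeRBE (I.rule t) ++ B)
    (hA : (A ++ [Token.rule]).count .rule = t + 1) (hB : ∀ x ∈ B.head?, x = .rule) (p : ℕ) :
    RuleSym I.encode t p ↔ (A ++ [Token.rule]).length ≤ p ∧
      p < (A ++ [Token.rule]).length + (encodeRBE (I.rule t)).length ∧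
        I.encode[p]? = some .sym :=
  sym_mem_rule_iff hA (notMem_encodeRBE _).1 hB hw

/-- A flattening chooses a symbol for every edge that leaves the node. -/
lemma exists_flattening_iff (ty : Fin I.numNodes → Set (Fin I.numTypes)) (v : Fin I.numNodes)
    (S : Set (Multiset (Fin I.numLabels × Fin I.numTypes)))
    [Nonempty (Fin I.numLabels × Fin I.numTypes)] :
    (∃ u, IsFlattening (I.graph.outLabType ty v) u ∧ u ∈ S) ↔
      ∃ f : Fin I.numNodes × Fin I.numLabels × Fin I.numNodes → Fin I.numLabels × Fin I.numTypes,
        (I.graph.edges.filter (fun e => e.1 = v)).val.map f ∈ S ∧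
          ∀ e ∈ I.graph.edges.filter (fun e => e.1 = v),
            e.2.1 = (f e).1 ∧ (f e).2 ∈ ty e.2.2 := by
  constructor
  · rintro ⟨u, hu, huS⟩
    rw [IsFlattening, EdgeLabeledGraph.outLabType, Multiset.rel_map_left] at hu
    obtain ⟨f, rfl, hf⟩ := exists_map_of_rel hu (Finset.nodup _) (fun _ => Classical.arbitrary _)
    exact ⟨f, huS, hf⟩
  · rintro ⟨f, hfS, hf⟩
    refine ⟨_, ?_, hfS⟩
    rw [IsFlattening, EdgeLabeledGraph.outLabType, Multiset.rel_map_left]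
    exact rel_map_right_self hf

/-- A node satisfies the definition of a type if and only if its edges and the symbols of the rule
can be matched. -/
lemma exists_flattening_iff_hasMatching (T : ℕ → ℕ → Prop) (v : Fin I.numNodes)
    (t : Fin I.numTypes) :
    (∃ u, IsFlattening (I.graph.outLabType (fun m => {s : Fin I.numTypes | T m s}) v) u ∧
      u ∈ I.schema.typeDef t) ↔ HasMatching I.encode T v t := by
  classical
  obtain ⟨A, B, hw, hA, hB⟩ := I.exists_encode_eq t
  obtain ⟨pos, hpos⟩ := I.exists_edgeAt_iff
  have hedge : ∀ e, e ∈ I.edgeList → EdgeAt I.encode (pos e) e.1 e.2.1 e.2.2 := fun e he =>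
    (hpos _ _ _ _).2 ⟨e, he, rfl, rfl, rfl, rfl⟩
  -- As `t` is a type, an empty alphabet means that there are no labels, hence no edges and nothing
  -- to match; both sides hold.
  rcases isEmpty_or_nonempty (Fin I.numLabels × Fin I.numTypes) with hemp | hne
  · have hno : ∀ e : Fin I.numNodes × Fin I.numLabels × Fin I.numNodes, False := fun e =>
      hemp.elim (e.2.1, t)
    have h1 : ∀ p, ¬ ToMatch I.encode v t p := by
      rintro p (⟨a, u, h⟩ | ⟨h, -⟩)
      · obtain ⟨e, -⟩ := (hpos _ _ _ _).1 h
        exact hno e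
      · have h2 := (I.ruleSym_iff t hw hA hB p).1 h
        rw [hw] at h2
        obtain ⟨i, -, hi⟩ := mem_infix_iff.1 h2
        exact sym_notMem_of_isEmpty (I.rule_mem t) (List.mem_of_getElem? hi)
    refine iff_of_true ⟨0, ?_, zero_mem_lang_of_isEmpty (I.rule_mem t)⟩
      ⟨id, fun p hp => absurd hp (h1 p), fun p _ q _ h => h⟩
    have : I.graph.edges = ∅ := Finset.eq_empty_of_forall_notMem fun e _ => hno e
    simp [EdgeLabeledGraph.outLabType, this, IsFlattening]
  have hkl : 0 < I.numLabels ∧ 0 < I.numTypes := by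
    obtain ⟨a, s⟩ := hne
    exact ⟨a.pos, s.pos⟩
  obtain ⟨L, smb, hLnd, hlang, hL, hsmb⟩ := exists_atomsAt (I.rule_mem t) hkl
    (plainEnd_concat A (x := Token.rule) (by simp) (by simp) (by simp)) B
  rw [← hw] at hlang hsmb
  simp only [← hw, ← I.ruleSym_iff t hw hA hB] at hL
  set F := I.graph.edges.filter (fun e => e.1 = v) with hF
  have hFmem : ∀ e, e ∈ F ↔ e ∈ I.edgeList ∧ e.1 = v := fun e => by
    simp [hF, ValidationInput.graph]
  have hinj : Set.InjOn pos F := by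
    intro e he e' he' h
    have h1 := hedge e ((hFmem e).1 he).1
    rw [h] at h1
    obtain ⟨h2, h3, h4⟩ := h1.inj (hedge e' ((hFmem e').1 he').1)
    exact Prod.ext (Fin.ext h2) (Prod.ext (Fin.ext h3) (Fin.ext h4))
  have hE : ∀ p, p ∈ F.image pos ↔ EdgeFrom I.encode v p := fun p => by
    simp only [Finset.mem_image, EdgeFrom, hpos]
    constructor
    · rintro ⟨e, he, rfl⟩
      exact ⟨_, _, e, ((hFmem e).1 he).1, rfl, by rw [((hFmem e).1 he).2], rfl, rfl⟩
    · rintro ⟨a, u, e, he, rfl, hv, -⟩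
      exact ⟨e, (hFmem e).2 ⟨he, Fin.ext hv⟩, rfl⟩
  have hEval : ∀ h : ℕ → Fin I.numLabels × Fin I.numTypes,
      (F.image pos).val.map h = F.val.map fun e => h (pos e) := fun h => by
    rw [Finset.image_val_of_injOn hinj, Multiset.map_map]
    rfl
  set ok : ℕ → Fin I.numLabels × Fin I.numTypes → Prop := fun p d =>
    ∃ m, EdgeAt I.encode p v d.1 m ∧ T m d.2 with hok
  have hokF : ∀ e ∈ F, ∀ d, ok (pos e) d ↔ e.2.1 = d.1 ∧ T e.2.2 d.2 := fun e he d => by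
    have h1 := hedge e ((hFmem e).1 he).1
    rw [((hFmem e).1 he).2] at h1
    constructor
    · rintro ⟨m, hm, hT⟩
      obtain ⟨-, h2, rfl⟩ := h1.inj hm
      exact ⟨Fin.ext h2, hT⟩
    · rintro ⟨h2, hT⟩
      exact ⟨_, h2 ▸ h1, hT⟩
  have hfits : ∀ p, ∀ q ∈ L, ok p (smb q) ↔ Fits I.encode T v p q := fun p q hq => by
    constructor
    · rintro ⟨m, hm, hT⟩
      exact ⟨_, m, _, hm, hsmb q hq, hT⟩
    · rintro ⟨a, m, s, hm, hs, hT⟩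
      obtain ⟨rfl, rfl⟩ := (hsmb q hq).inj hs
      exact ⟨m, hm, hT⟩
  have hdis : ∀ p ∈ F.image pos, p ∉ L := fun p hp hpL => by
    obtain ⟨a, u, h⟩ := (hE p).1 hp
    have h1 := getElem?_of_prefix_drop h
    rw [((hL p).1 hpL).1] at h1
    simp at h1
  rw [exists_flattening_iff, Schema.typeDef, schema, hlang]
  trans ∃ k, IsAssignment (F.image pos) ok (StarAt I.encode) (OptAt I.encode) smb L k
  · constructor
    · rintro ⟨f, hfS, hf⟩
      -- The choice is transported from edges to their positions, along which `pos` is injective;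
      -- other positions get an arbitrary symbol.
      have hg : ∀ p, ∃ d, ∀ e ∈ F, pos e = p → d = f e := fun p => by
        by_cases h : ∃ e ∈ F, pos e = p
        · obtain ⟨e, he, rfl⟩ := h
          exact ⟨f e, fun e' he' h => by rw [hinj he' he h]⟩
        · exact ⟨Classical.arbitrary _, fun e he h' => absurd ⟨e, he, h'⟩ h⟩
      choose g hg using hg
      refine exists_isAssignment hLnd (h := g) (fun p hp => ?_) ?_
      · obtain ⟨e, he, rfl⟩ := Finset.mem_image.1 hp
        rw [hg _ e he rfl, hokF e he]
        exact hf e he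
      · rw [hEval, Multiset.map_congr rfl fun e he => hg _ e he rfl]
        exact hfS
    · rintro ⟨k, hk⟩
      refine ⟨fun e => smb (k (pos e)), ?_, fun e he => ?_⟩
      · rw [← hEval fun p => smb (k p)]
        exact hk.mem_bagProd hLnd
      · exact (hokF e he _).1 (hk.1 _ (Finset.mem_image_of_mem pos he)).2
  · rw [exists_isAssignment_iff_matching hdis]
    simp only [hE, hL]
    refine exists_congr fun f => and_congr_left' (forall₂_congr fun p hp => ?_)
    refine or_congr ?_ (or_congr ?_ (or_congr Iff.rfl ?_))
    · refine and_congr_right fun _ => and_congr_right fun h => ?_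
      exact hfits _ _ ((hL _).2 h.1)
    · refine and_congr_right fun _ => and_congr_right fun _ => exists_congr fun r => ?_
      exact and_congr_right fun h => and_congr_right fun _ => hfits _ _ ((hL _).2 h)
    · refine and_congr_right fun h => and_congr_right fun _ => ?_
      exact hfits _ _ ((hL _).2 h.1)

end ValidationInput

end ShExVal

namespace ShExVal

open Function

/-! ### The greatest typing -/

/-- A decreasing chain of finite sets that stays constant once it repeats loses an element in every
earlier step. -/
lemma succ_eq_of_card_le {α : Type} (S : ℕ → Finset α) (hS : ∀ k, S (k + 1) ⊆ S k)
    (hstep : ∀ k, S (k + 1) = S k → S (k + 2) = S (k + 1)) {K : ℕ} (hK : (S 0).card ≤ K) :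
    S (K + 1) = S K := by
  have key : ∀ k, S (k + 1) = S k ∨ (S k).card + k ≤ (S 0).card := by
    intro k
    induction k with
    | zero => exact .inr le_rfl
    | succ k ih =>
      by_cases h : S (k + 1) = S k
      · exact .inl (hstep k h)
      · have := Finset.card_lt_card ((hS k).ssubset_of_ne h)
        have := ih.resolve_left h
        exact .inr (by omega)
  rcases key K with h | h
  · exact h
  · have : S K = ∅ := Finset.card_eq_zero.1 (by omega)
    exact Finset.Subset.antisymm (hS K) (by rw [this]; exact Finset.empty_subset _)

/-- The types that are defined by rules, at every node. -/
def allTypes (w : List Token) (_ t : ℕ) : Prop := ∃ p < w.length + 1, ruleCount w p = t + 1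

/-- Remove the types that a node does not satisfy. -/
def refineTypes (w : List Token) (T : ℕ → ℕ → Prop) (v t : ℕ) : Prop :=
  T v t ∧ HasMatching w T v t

/-- The monotonicity behind the greatest typing: larger sets of types permit the same choices. -/
lemma IsFlattening.mono {n k l : ℕ} {G : EdgeLabeledGraph (Fin n) (Fin k)}
    {ty ty' : Fin n → Set (Fin l)} (h : ∀ m, ty m ⊆ ty' m) {v : Fin n}
    {u : Multiset (Fin k × Fin l)} (hu : IsFlattening (G.outLabType ty v) u) :
    IsFlattening (G.outLabType ty' v) u := by
  rw [IsFlattening, EdgeLabeledGraph.outLabType, Multiset.rel_map_left] at hu ⊢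
  exact hu.mono fun e _ b _ hb => ⟨hb.1, h _ hb.2⟩

/-- The graph is valid if and only if every node keeps a type, when types that are not satisfied
are removed repeatedly. -/
lemma ValidationInput.mValid_iff (I : ValidationInput rbeMultConc) :
    MValid I.graph I.schema ↔ ∀ v < I.numNodes, ∃ t < I.encode.length + 1,
      (refineTypes I.encode)^[(I.encode.length + 1) * (I.encode.length + 1)]
        (allTypes I.encode) v t := by
  classical
  set w := I.encode with hw
  set T : ℕ → ℕ → ℕ → Prop := fun k => (refineTypes w)^[k] (allTypes w) with hT
  have hsucc : ∀ k, T (k + 1) = refineTypes w (T k) := fun k => iterate_succ_apply' _ _ _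
  have hlt : ∀ k v t, T k v t → t < I.numTypes := by
    intro k
    induction k with
    | zero => exact fun v t h => (I.exists_ruleCount_iff t).1 h
    | succ k ih =>
      intro v t h
      rw [hsucc] at h
      exact ih v t h.1
  set K := (w.length + 1) * (w.length + 1) with hK
  change _ ↔ ∀ v < I.numNodes, ∃ t < w.length + 1, T K v t
  have hst : ∀ k (v : Fin I.numNodes) (t : Fin I.numTypes), T (k + 1) v t ↔ T k v t ∧
      ∃ u, IsFlattening (I.graph.outLabType (fun m => {s : Fin I.numTypes | T k m s}) v) u ∧
        u ∈ I.schema.typeDef t := fun k v t => by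
    rw [hsucc, I.exists_flattening_iff_hasMatching]
    rfl
  constructor
  · rintro ⟨ty, hne, hty⟩ v hv
    -- No type of a valid typing is ever removed.
    have hle : ∀ k v, ∀ t ∈ ty v, T k v t := by
      intro k
      induction k with
      | zero => exact fun v t _ => (I.exists_ruleCount_iff t).2 t.2
      | succ k ih =>
        intro v t ht
        obtain ⟨u, hu, hut⟩ := hty v t ht
        exact (hst k v t).2 ⟨ih v t ht, u, hu.mono fun m s hs => ih m s hs, hut⟩
    obtain ⟨t, ht⟩ := hne ⟨v, hv⟩
    exact ⟨t, (t.2.trans_le I.numTypes_le).trans (Nat.lt_succ_self _), hle K _ t ht⟩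
  · intro h
    -- Stationarity is needed, and shown, only for pairs of actual nodes and types. By `hst` the
    -- next stage of such pairs depends on the present one only, so a repetition persists.
    set S : ℕ → Finset (Fin I.numNodes × Fin I.numTypes) := fun k =>
      Finset.univ.filter fun x => T k x.1 x.2 with hS
    have hmem : ∀ k v t, (v, t) ∈ S k ↔ T k v t := fun k v t => by simp [hS]
    have hstable : S (K + 1) = S K := by
      refine succ_eq_of_card_le S (fun k x hx => ?_) (fun k hk => ?_) ?_
      · exact (hmem k x.1 x.2).2 ((hst k _ _).1 ((hmem _ _ _).1 hx)).1
      · have hty : (fun m : Fin I.numNodes => {s : Fin I.numTypes | T (k + 1) m s}) =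
            fun m : Fin I.numNodes => {s : Fin I.numTypes | T k m s} := by
          funext m
          ext s
          exact (hmem _ m s).symm.trans (by rw [hk]; exact hmem _ _ _)
        ext ⟨v, t⟩
        rw [hmem, hst, hty, ← hmem, hk, hmem, ← hst, ← hmem, hk, ← hmem]
      · refine (Finset.card_le_univ _).trans ?_
        rw [Fintype.card_prod, Fintype.card_fin, Fintype.card_fin]
        exact Nat.mul_le_mul (I.numNodes_le.trans (Nat.le_succ _))
          (I.numTypes_le.trans (Nat.le_succ _))
    refine ⟨fun m => {s | T K m s}, fun v => ?_, fun v t ht => ?_⟩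
    · obtain ⟨t, -, ht⟩ := h v v.2
      exact ⟨⟨t, hlt K v t ht⟩, ht⟩
    · have h1 : (v, t) ∈ S (K + 1) := by
        rw [hstable]
        exact (hmem _ _ _).2 ht
      exact ((hst K v t).1 ((hmem _ _ _).1 h1)).2

end ShExVal

namespace ShExVal

open Function

/-! ### Derived formulas -/

namespace Fml

variable {V R : Type}

/-- Disjunction. -/
def or (φ ψ : Fml V R) : Fml V R := not (and (not φ) (not ψ))

/-- Universal quantification. -/
def all (i : V) (φ : Fml V R) : Fml V R := not (ex i (not φ))

/-- Implication. -/
def imp (φ ψ : Fml V R) : Fml V R := not (and φ (not ψ))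

/-- Equality. -/
def same (i j : V) : Fml V R := and (not (lt i j)) (not (lt j i))

/-- `i` is zero; `k` is a bound variable. -/
def zero (k i : V) : Fml V R := not (ex k (lt k i))

/-- `j` is the successor of `i` and belongs to the domain; `k` is a bound variable. -/
def succ (k i j : V) : Fml V R :=
  and (lt i j) (and (not (ex k (and (lt i k) (lt k j)))) (ex k (same k j)))

variable [DecidableEq V] {w : List Token} {n : ℕ} {s : R → List ℕ → Prop} {e : V → ℕ}

@[simp]
lemma eval_tok (a : Token) (i : V) : (tok a i).eval w n s e ↔ w[e i]? = some a := Iff.rfl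

@[simp]
lemma eval_lt (i j : V) : (lt i j).eval w n s e ↔ e i < e j := Iff.rfl

@[simp]
lemma eval_rel (x : R) (vs : List V) : (rel x vs).eval w n s e ↔ s x (vs.map e) := Iff.rfl

@[simp]
lemma eval_not (φ : Fml V R) : φ.not.eval w n s e ↔ ¬ φ.eval w n s e := Iff.rfl

@[simp]
lemma eval_and (φ ψ : Fml V R) :
    (φ.and ψ).eval w n s e ↔ φ.eval w n s e ∧ ψ.eval w n s e := Iff.rfl

@[simp]
lemma eval_ex (i : V) (φ : Fml V R) :
    (ex i φ).eval w n s e ↔ ∃ x < n, φ.eval w n s (update e i x) := Iff.rfl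

@[simp]
lemma eval_or (φ ψ : Fml V R) :
    (φ.or ψ).eval w n s e ↔ φ.eval w n s e ∨ ψ.eval w n s e := by
  simp only [or, eval_not, eval_and]
  tauto

@[simp]
lemma eval_all (i : V) (φ : Fml V R) :
    (all i φ).eval w n s e ↔ ∀ x < n, φ.eval w n s (update e i x) := by
  simp [all]

@[simp]
lemma eval_imp (φ ψ : Fml V R) :
    (φ.imp ψ).eval w n s e ↔ (φ.eval w n s e → ψ.eval w n s e) := by
  simp [imp]

@[simp]
lemma eval_same (i j : V) : (same (R := R) i j).eval w n s e ↔ e i = e j := by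
  simp only [same, eval_not, eval_and, eval_lt]
  omega

/-- The domain must contain `0` itself, which refutes positivity. -/
lemma eval_zero {k i : V} (hk : i ≠ k) (hn : 0 < n) :
    (zero (R := R) k i).eval w n s e ↔ e i = 0 := by
  simp only [zero, eval_not, eval_ex, eval_lt, update_self, update_of_ne hk]
  constructor
  · intro h
    by_contra h0
    exact h ⟨0, hn, by omega⟩
  · rintro h ⟨x, -, hx⟩
    omega

/-- If `e i + 1 < e j < n`, then `e i + 1` is an element of the domain in between. The last conjunct
of `succ` is what bounds `e j`. -/
lemma eval_succ {k i j : V} (hi : i ≠ k) (hj : j ≠ k) :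
    (succ (R := R) k i j).eval w n s e ↔ e j = e i + 1 ∧ e j < n := by
  simp only [succ, eval_not, eval_and, eval_ex, eval_lt, eval_same, update_self, update_of_ne hi,
    update_of_ne hj]
  constructor
  · rintro ⟨h1, h2, x, hx, rfl⟩
    refine ⟨?_, hx⟩
    by_contra h
    exact h2 ⟨e i + 1, by omega, by omega, by omega⟩
  · rintro ⟨h1, h2⟩
    exact ⟨by omega, by rintro ⟨x, -, h3, h4⟩; omega, e j, h2, rfl⟩

instance decidableWf {R : Type} (ar : R → ℕ) : ∀ (φ : Fml V R) (sc : List V), Decidable (φ.Wf ar sc)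
  | tok _ _, _ => inferInstanceAs (Decidable True)
  | lt _ _, _ => inferInstanceAs (Decidable True)
  | rel _ _, _ => inferInstanceAs (Decidable (_ = _))
  | not φ, sc => decidableWf ar φ sc
  | and φ ψ, sc => @instDecidableAnd _ _ (decidableWf ar φ sc) (decidableWf ar ψ sc)
  | ex _ φ, _ => @instDecidableAnd _ _ inferInstance (decidableWf ar φ _)

end Fml

namespace RelProg

variable {V R : Type} [DecidableEq V]

instance decidableWf (ar : R → ℕ) : ∀ p : RelProg V R, Decidable (p.Wf ar)
  | assign _ _ _ => inferInstanceAs (Decidable (_ ∧ _ ∧ _))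
  | seq p q => @instDecidableAnd _ _ (decidableWf ar p) (decidableWf ar q)
  | loop p => decidableWf ar p

/-- The relations that a program assigns. -/
def targets : RelProg V R → List R
  | assign x _ _ => [x]
  | seq p q => p.targets ++ q.targets
  | loop p => p.targets

variable [DecidableEq R] {w : List Token} {n : ℕ}

@[simp]
lemma run_seq (p q : RelProg V R) (s : R → List ℕ → Prop) :
    (seq p q).run w n s = q.run w n (p.run w n s) := rfl

lemma run_loop (p : RelProg V R) (s : R → List ℕ → Prop) :
    (loop p).run w n s = (p.run w n)^[n] s := rfl

/-- Two nested loops give the `n * n` rounds that both the auction and the refinement of types need.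
-/
lemma run_loop_loop (p : RelProg V R) (s : R → List ℕ → Prop) :
    (loop (loop p)).run w n s = (p.run w n)^[n * n] s := by
  rw [iterate_mul]
  rfl

lemma run_assign_self (x : R) (vs : List V) (φ : Fml V R) (s : R → List ℕ → Prop) (l : List ℕ) :
    (assign x vs φ).run w n s x l ↔ φ.eval w n s (assignEnv vs l) := by
  rw [run, update_self]

/-- The frame rule by which facts about a relation are carried past assignments to others. -/
lemma run_of_notMem {p : RelProg V R} {x : R} (hx : x ∉ p.targets) (s : R → List ℕ → Prop) :
    p.run w n s x = s x := by
  induction p generalizing s with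
  | assign y vs φ => exact update_of_ne (by simpa [targets] using hx) _ _
  | seq p q ihp ihq =>
    simp only [targets, List.mem_append, not_or] at hx
    rw [run_seq, ihq hx.2, ihp hx.1]
  | loop p ih =>
    have : ∀ k, (p.run w n)^[k] s x = s x := fun k => by
      induction k with
      | zero => rfl
      | succ k ihk => rw [iterate_succ_apply', ih hx, ihk]
    exact this n

lemma iterate_run_of_notMem {p : RelProg V R} {x : R} (hx : x ∉ p.targets)
    (s : R → List ℕ → Prop) (k : ℕ) : (p.run w n)^[k] s x = s x := by
  induction k with
  | zero => rfl
  | succ k ihk => rw [iterate_succ_apply', run_of_notMem hx, ihk]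

end RelProg

end ShExVal

namespace ShExVal

open Function

/-! ### The relations of the validation program -/

/-- The names of relations of the validation program. -/
inductive Tab : Type
  | num | cnt | edge | sym | out | rsym | star | opt | tom | typ
  | fits | may | elig | cheap | bid | lev | own
  deriving DecidableEq

instance : Fintype Tab :=
  Fintype.ofList [.num, .cnt, .edge, .sym, .out, .rsym, .star, .opt, .tom, .typ, .fits, .may,
    .elig, .cheap, .bid, .lev, .own] (by intro x; cases x <;> simp)

/-- The arities of the relations. -/
def Tab.arity : Tab → ℕ
  | star | opt => 1
  | cnt | out | rsym | typ => 2
  | num | sym | tom | fits | elig => 3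
  | edge | may | cheap | bid | lev | own => 4

namespace Tab

open Fml RelProg

/-- The programs for validation use eight variables. -/
abbrev Prog := RelProg (Fin 8) Tab

/-- `num p v q`: the number `v` is written from `p` up to `q`. -/
def numStep : Prog :=
  assign num [0, 1, 2] <|
    or (and (tok .endNum 0) (and (zero 7 1) (succ 7 0 2)))
      (and (tok .digit 0) (ex 3 (ex 4 (and (succ 7 0 3) (and (succ 7 4 1) (rel num [3, 4, 2]))))))

/-- `cnt p c`: there are `c` rules that begin before `p`. -/
def cntStep : Prog :=
  assign cnt [0, 1] <|
    or (and (zero 7 0) (zero 7 1))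
      (ex 2 (and (succ 7 2 0)
        (or (and (tok .rule 2) (ex 3 (and (succ 7 3 1) (rel cnt [2, 3]))))
          (and (not (tok .rule 2)) (rel cnt [2, 1])))))

/-- `edge p u a v`: an edge `(u, a, v)` begins at `p`. -/
def setEdge : Prog :=
  assign edge [0, 1, 2, 3] <|
    and (tok .edge 0) (ex 4 (ex 5 (ex 6 (and (succ 7 0 4) (and (rel num [4, 1, 5])
      (and (rel num [5, 2, 6]) (ex 7 (rel num [6, 3, 7]))))))))

/-- `sym p a s`: a symbol `(a, s)` begins at `p`. -/
def setSym : Prog :=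
  assign sym [0, 1, 2] <|
    and (tok .sym 0) (ex 3 (ex 4 (and (succ 7 0 3) (and (rel num [3, 1, 4])
      (ex 5 (rel num [4, 2, 5]))))))

/-- `out v p`: an edge that leaves `v` begins at `p`. -/
def setOut : Prog := assign out [0, 1] (ex 2 (ex 3 (rel edge [1, 0, 2, 3])))

/-- `rsym t p`: a symbol in the rule of `t` begins at `p`. -/
def setRsym : Prog := assign rsym [0, 1] (and (tok .sym 1) (ex 2 (and (succ 7 0 2) (rel cnt [1, 2]))))

/-- `star p`: the symbol at `p` has a star. -/
def setStar : Prog := assign star [0] (ex 1 (and (succ 7 1 0) (tok .star 1)))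

/-- `opt p`: the symbol at `p` is optional. -/
def setOpt : Prog :=
  assign opt [0] <|
    ex 1 (ex 2 (and (succ 7 1 2) (and (succ 7 2 0) (and (tok .alt 1) (tok .eps 2)))))

/-- `tom v t p`: the edge or symbol at `p` has to be matched for the type `t` of the node `v`. -/
def setTom : Prog :=
  assign tom [0, 1, 2] (or (rel out [0, 2]) (and (rel rsym [1, 2]) (not (rel star [2]))))

/-- `typ v t`: the node `v` still has the type `t`. -/
def setTyp : Prog := assign typ [0, 1] (ex 2 (ex 3 (and (rel cnt [2, 3]) (succ 7 1 3))))

/-- The computation of the relations that do not change. -/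
def setBase : Prog :=
  seq (loop numStep) <| seq (loop cntStep) <| seq setEdge <| seq setSym <| seq setOut <|
    seq setRsym <| seq setStar <| seq setOpt <| seq setTom setTyp

/-- `fits v p q`: the symbol at `q` is possible for the edge at `p`, which leaves `v`. -/
def setFits : Prog :=
  assign fits [0, 1, 2] <|
    ex 3 (ex 4 (ex 5 (and (rel edge [1, 0, 3, 4]) (and (rel sym [2, 3, 5]) (rel typ [4, 5])))))

/-- `may v t p q`: the positions `p` and `q` may be matched. -/
def setMay : Prog :=
  assign may [0, 1, 2, 3] <|
    or (and (rel out [0, 2]) (and (and (rel rsym [1, 3]) (not (rel star [3])))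
      (rel fits [0, 2, 3]))) <|
    or (and (rel out [0, 2]) (and (same 3 2) (ex 4 (and (rel rsym [1, 4])
      (and (rel star [4]) (rel fits [0, 2, 4])))))) <|
    or (and (and (rel rsym [1, 2]) (not (rel star [2]))) (and (rel opt [2]) (same 3 2)))
      (and (and (rel rsym [1, 2]) (not (rel star [2]))) (and (rel out [0, 3])
        (rel fits [0, 3, 2])))

/-- `elig v t p`: the position `p` is eligible in the auction for `v` and `t`. -/
def setElig : Prog :=
  assign elig [0, 1, 2] <|
    and (rel tom [0, 1, 2]) (and (not (ex 3 (rel own [0, 1, 3, 2])))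
      (ex 3 (and (rel may [0, 1, 2, 3]) (ex 4 (not (rel lev [0, 1, 3, 4]))))))

/-- `cheap v t p q`: the position `q` is cheapest for `p` in the auction for `v` and `t`. -/
def setCheap : Prog :=
  assign cheap [0, 1, 2, 3] <|
    and (rel may [0, 1, 2, 3]) (all 4 (imp (rel may [0, 1, 2, 4])
      (all 5 (imp (rel lev [0, 1, 3, 5]) (rel lev [0, 1, 4, 5])))))

/-- `bid v t p q`: in the auction for `v` and `t`, the next bid is that of `p` for `q`. -/
def setBid : Prog :=
  assign bid [0, 1, 2, 3] <|
    and (and (rel elig [0, 1, 2]) (all 4 (imp (lt 4 2) (not (rel elig [0, 1, 4])))))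
      (and (rel cheap [0, 1, 2, 3]) (all 4 (imp (lt 4 3) (not (rel cheap [0, 1, 2, 4])))))

/-- `lev v t q c`: in the auction for `v` and `t`, the price of `q` is more than `c`. -/
def stepLev : Prog :=
  assign lev [0, 1, 2, 3] <|
    or (rel lev [0, 1, 2, 3]) (and (ex 4 (rel bid [0, 1, 4, 2]))
      (all 4 (imp (lt 4 3) (rel lev [0, 1, 2, 4]))))

/-- `own v t q p`: in the auction for `v` and `t`, the position `p` owns `q`. -/
def stepOwn : Prog :=
  assign own [0, 1, 2, 3] <|
    or (rel bid [0, 1, 3, 2]) (and (rel own [0, 1, 2, 3]) (not (ex 4 (rel bid [0, 1, 4, 2]))))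

/-- One bid in every auction. -/
def bidding : Prog := seq setElig <| seq setCheap <| seq setBid <| seq stepLev stepOwn

/-- Remove the types without matching. -/
def restrictTyp : Prog :=
  assign typ [0, 1] (and (rel typ [0, 1]) (all 2 (imp (rel tom [0, 1, 2])
    (ex 3 (rel own [0, 1, 3, 2])))))

/-- One round of refinement. -/
def refine : Prog :=
  seq setFits <| seq setMay <| seq (assign lev [0, 1, 2, 3] (lt 0 0)) <|
    seq (assign own [0, 1, 2, 3] (lt 0 0)) <| seq (loop (loop bidding)) restrictTyp

/-- The validation program. -/
def validate : Prog := seq setBase (loop (loop refine))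

/-- Every node has a type. -/
def accept : Fml (Fin 8) Tab :=
  all 0 (imp (ex 1 (ex 2 (and (rel num [3, 1, 2]) (lt 0 1)))) (ex 1 (rel typ [0, 1])))

lemma validate_wf : validate.Wf arity := by decide

lemma accept_wf : accept.Wf arity [] := by decide

end Tab

end ShExVal

namespace ShExVal

open Function

namespace Tab

open Fml RelProg

/-! ### The auction of the validation program -/

section auction

set_option linter.unusedSimpArgs false

variable {w : List Token} {n : ℕ} {s : Tab → List ℕ → Prop}

lemma run_setElig (v t p : ℕ) : setElig.run w n s elig [v, t, p] ↔
    Auction.Eligible n (fun p => s tom [v, t, p]) (fun p q => s may [v, t, p, q])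
      (fun q c => s lev [v, t, q, c]) (fun q p => s own [v, t, q, p]) p := by
  simp only [setElig, run_assign_self, eval_tok, eval_and, eval_or, eval_ex, eval_all, eval_imp,
    eval_rel, eval_not, eval_lt, eval_same, assignEnv, List.map_cons, List.map_nil, update_apply,
    Fin.reduceEq, ↓reduceIte, Fin.isValue, ne_eq, not_false_eq_true, eval_succ]
  rfl

lemma run_setCheap (v t p q : ℕ) : setCheap.run w n s cheap [v, t, p, q] ↔
    Auction.Cheapest n (fun p q => s may [v, t, p, q]) (fun q c => s lev [v, t, q, c]) p q := by
  simp only [setCheap, run_assign_self, eval_tok, eval_and, eval_or, eval_ex, eval_all, eval_imp,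
    eval_rel, eval_not, eval_lt, eval_same, assignEnv, List.map_cons, List.map_nil, update_apply,
    Fin.reduceEq, ↓reduceIte, Fin.isValue, ne_eq, not_false_eq_true, eval_succ]
  rfl

lemma run_setBid (v t p q : ℕ) : setBid.run w n s bid [v, t, p, q] ↔
    (s elig [v, t, p] ∧ ∀ p' < n, p' < p → ¬ s elig [v, t, p']) ∧
      s cheap [v, t, p, q] ∧ ∀ q' < n, q' < q → ¬ s cheap [v, t, p, q'] := by
  simp only [setBid, run_assign_self, eval_tok, eval_and, eval_or, eval_ex, eval_all, eval_imp,
    eval_rel, eval_not, eval_lt, eval_same, assignEnv, List.map_cons, List.map_nil, update_apply,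
    Fin.reduceEq, ↓reduceIte, Fin.isValue, ne_eq, not_false_eq_true, eval_succ]

lemma run_stepLev (v t q c : ℕ) : stepLev.run w n s lev [v, t, q, c] ↔
    Auction.nextLv n (fun q c => s lev [v, t, q, c]) (fun p q => s bid [v, t, p, q]) q c := by
  simp only [stepLev, run_assign_self, eval_tok, eval_and, eval_or, eval_ex, eval_all, eval_imp,
    eval_rel, eval_not, eval_lt, eval_same, assignEnv, List.map_cons, List.map_nil, update_apply,
    Fin.reduceEq, ↓reduceIte, Fin.isValue, ne_eq, not_false_eq_true, eval_succ]
  rfl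

lemma run_stepOwn (v t q p : ℕ) : stepOwn.run w n s own [v, t, q, p] ↔
    Auction.nextOw n (fun q p => s own [v, t, q, p]) (fun p q => s bid [v, t, p, q]) q p := by
  simp only [stepOwn, run_assign_self, eval_tok, eval_and, eval_or, eval_ex, eval_all, eval_imp,
    eval_rel, eval_not, eval_lt, eval_same, assignEnv, List.map_cons, List.map_nil, update_apply,
    Fin.reduceEq, ↓reduceIte, Fin.isValue, ne_eq, not_false_eq_true, eval_succ]
  rfl

/-- One round of the program is one round of the auction for every node and every type. -/
lemma run_bidding (v t : ℕ) :
    (fun q c => bidding.run w n s lev [v, t, q, c]) = Auction.nextLv n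
        (fun q c => s lev [v, t, q, c])
        (Auction.Bid n (fun p => s tom [v, t, p]) (fun p q => s may [v, t, p, q])
          (fun q c => s lev [v, t, q, c]) (fun q p => s own [v, t, q, p])) ∧
      (fun q p => bidding.run w n s own [v, t, q, p]) = Auction.nextOw n
        (fun q p => s own [v, t, q, p])
        (Auction.Bid n (fun p => s tom [v, t, p]) (fun p q => s may [v, t, p, q])
          (fun q c => s lev [v, t, q, c]) (fun q p => s own [v, t, q, p])) := by
  set s₁ := setElig.run w n s with hs₁
  set s₂ := setCheap.run w n s₁ with hs₂
  set s₃ := setBid.run w n s₂ with hs₃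
  set s₄ := stepLev.run w n s₃ with hs₄
  have h₁ : ∀ x ≠ elig, s₁ x = s x := fun x hx => run_of_notMem (by simpa [setElig, targets]) _
  have h₂ : ∀ x ≠ cheap, s₂ x = s₁ x := fun x hx =>
    run_of_notMem (by simpa [setCheap, targets]) _
  have h₃ : ∀ x ≠ bid, s₃ x = s₂ x := fun x hx => run_of_notMem (by simpa [setBid, targets]) _
  have h₄ : ∀ x ≠ lev, s₄ x = s₃ x := fun x hx => run_of_notMem (by simpa [stepLev, targets]) _
  -- The bid is fixed before prices and owners are updated, so both updates refer to the old state.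
  have hbid : (fun p q => s₃ bid [v, t, p, q]) =
      Auction.Bid n (fun p => s tom [v, t, p]) (fun p q => s may [v, t, p, q])
        (fun q c => s lev [v, t, q, c]) (fun q p => s own [v, t, q, p]) := by
    funext p q
    rw [hs₃, run_setBid, h₂ elig (by simp)]
    simp only [hs₂, run_setCheap, h₁ may (by simp), h₁ lev (by simp)]
    simp only [hs₁, run_setElig]
    rfl
  constructor
  · funext q c
    change stepOwn.run w n s₄ lev [v, t, q, c] = _
    rw [run_of_notMem (by simp [stepOwn, targets]), hs₄, run_stepLev, hbid, h₃ lev (by simp), h₂ lev (by simp), h₁ lev (by simp)]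
  · funext q p
    change stepOwn.run w n s₄ own [v, t, q, p] = _
    rw [run_stepOwn, h₄ bid (by simp), hbid, h₄ own (by simp), h₃ own (by simp),
      h₂ own (by simp), h₁ own (by simp)]

lemma run_setFits (v p q : ℕ) : setFits.run w n s fits [v, p, q] ↔
    ∃ a < n, ∃ m < n, ∃ r < n, s edge [p, v, a, m] ∧ s sym [q, a, r] ∧ s typ [m, r] := by
  simp only [setFits, run_assign_self, eval_tok, eval_and, eval_or, eval_ex, eval_all, eval_imp,
    eval_rel, eval_not, eval_lt, eval_same, assignEnv, List.map_cons, List.map_nil, update_apply,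
    Fin.reduceEq, ↓reduceIte, Fin.isValue, ne_eq, not_false_eq_true, eval_succ]

lemma run_setMay (v t p q : ℕ) : setMay.run w n s may [v, t, p, q] ↔
    (s out [v, p] ∧ (s rsym [t, q] ∧ ¬ s star [q]) ∧ s fits [v, p, q]) ∨
    (s out [v, p] ∧ q = p ∧ ∃ r < n, s rsym [t, r] ∧ s star [r] ∧ s fits [v, p, r]) ∨
    ((s rsym [t, p] ∧ ¬ s star [p]) ∧ s opt [p] ∧ q = p) ∨
    ((s rsym [t, p] ∧ ¬ s star [p]) ∧ s out [v, q] ∧ s fits [v, q, p]) := by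
  simp only [setMay, run_assign_self, eval_tok, eval_and, eval_or, eval_ex, eval_all, eval_imp,
    eval_rel, eval_not, eval_lt, eval_same, assignEnv, List.map_cons, List.map_nil, update_apply,
    Fin.reduceEq, ↓reduceIte, Fin.isValue, ne_eq, not_false_eq_true, eval_succ]

lemma run_restrictTyp (v t : ℕ) : restrictTyp.run w n s typ [v, t] ↔
    s typ [v, t] ∧ ∀ p < n, s tom [v, t, p] → ∃ q < n, s own [v, t, q, p] := by
  simp only [restrictTyp, run_assign_self, eval_tok, eval_and, eval_or, eval_ex, eval_all, eval_imp,
    eval_rel, eval_not, eval_lt, eval_same, assignEnv, List.map_cons, List.map_nil, update_apply,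
    Fin.reduceEq, ↓reduceIte, Fin.isValue, ne_eq, not_false_eq_true, eval_succ]

end auction

end Tab

end ShExVal

namespace ShExVal

open Function

namespace Tab

open Fml RelProg

/-! ### The rounds of refinement -/

lemma _root_.ShExVal.EdgeAt.lt {w : List Token} {p u a v : ℕ} (h : EdgeAt w p u a v) :
    p < w.length ∧ u < w.length ∧ a < w.length ∧ v < w.length := by
  have := h.length_le
  simp only [List.length_drop, List.length_cons, List.length_append, length_encodeNum] at this
  omega

lemma _root_.ShExVal.SymAt.lt {w : List Token} {p a s : ℕ} (h : SymAt w p a s) :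
    p < w.length ∧ a < w.length ∧ s < w.length := by
  have := h.length_le
  simp only [List.length_drop, List.length_cons, List.length_append, length_encodeNum] at this
  omega

lemma _root_.ShExVal.RuleSym.lt {w : List Token} {t p : ℕ} (h : RuleSym w t p) : p < w.length :=
  (List.getElem?_eq_some_iff.1 h.1).1

lemma exists_lt_iff {n : ℕ} {P : ℕ → Prop} (h : ∀ x, P x → x < n) : (∃ x < n, P x) ↔ ∃ x, P x :=
  exists_congr fun x => and_iff_right_of_imp (h x)

/-- The relations of the state `s` that describe the word. -/
structure IsBase (w : List Token) (s : Tab → List ℕ → Prop) : Prop where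
  edge : ∀ p u a v, s edge [p, u, a, v] ↔ EdgeAt w p u a v
  sym : ∀ p a r, s sym [p, a, r] ↔ SymAt w p a r
  out : ∀ v p, s out [v, p] ↔ EdgeFrom w v p
  rsym : ∀ t p, s rsym [t, p] ↔ RuleSym w t p
  star : ∀ p, s star [p] ↔ StarAt w p
  opt : ∀ p, s opt [p] ↔ OptAt w p
  tom : ∀ v t p, s tom [v, t, p] ↔ ToMatch w v t p

lemma IsBase.of_eq {w : List Token} {s s' : Tab → List ℕ → Prop} (h : IsBase w s)
    (hs : ∀ x ∉ refine.targets, s' x = s x) : IsBase w s' := by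
  constructor
  · rw [hs Tab.edge (by decide)]; exact h.edge
  · rw [hs Tab.sym (by decide)]; exact h.sym
  · rw [hs Tab.out (by decide)]; exact h.out
  · rw [hs Tab.rsym (by decide)]; exact h.rsym
  · rw [hs Tab.star (by decide)]; exact h.star
  · rw [hs Tab.opt (by decide)]; exact h.opt
  · rw [hs Tab.tom (by decide)]; exact h.tom

lemma _root_.ShExVal.ToMatch.lt {w : List Token} {v t p : ℕ} (h : ToMatch w v t p) : p < w.length := by
  rcases h with ⟨a, u, h⟩ | ⟨h, -⟩
  · exact h.lt.1
  · exact h.lt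

lemma _root_.ShExVal.MayMatch.toMatch {w : List Token} {T : ℕ → ℕ → Prop} {v t p q : ℕ}
    (h : MayMatch w T v t p q) : ToMatch w v t p ∧ ToMatch w v t q := by
  rcases h with ⟨h1, h2, -⟩ | ⟨h1, rfl, -⟩ | ⟨h1, -, rfl⟩ | ⟨h1, h2, -⟩
  · exact ⟨.inl h1, .inr h2⟩
  · exact ⟨.inl h1, .inl h1⟩
  · exact ⟨.inr h1, .inr h1⟩
  · exact ⟨.inr h1, .inl h2⟩

/-- The auctions find out which matchings exist. -/
lemma own_iff_hasMatching {w : List Token} {T : ℕ → ℕ → Prop} {s : Tab → List ℕ → Prop}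
    (htom : ∀ v t p, s tom [v, t, p] ↔ ToMatch w v t p)
    (hmay : ∀ v t p q, s may [v, t, p, q] ↔ MayMatch w T v t p q)
    (hlev : ∀ l, ¬ s lev l) (hown : ∀ l, ¬ s own l) (v t : ℕ) :
    (∀ p, ToMatch w v t p → ∃ q < w.length + 1,
      (loop (loop bidding)).run w (w.length + 1) s own [v, t, q, p]) ↔ HasMatching w T v t := by
  set n := w.length + 1 with hn
  set S : ℕ → Tab → List ℕ → Prop := fun k => (bidding.run w n)^[k] s with hS
  have hsucc : ∀ k, S (k + 1) = bidding.run w n (S k) := fun k => iterate_succ_apply' _ _ _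
  have h₁ : ∀ k, (fun p => S k tom [v, t, p]) = ToMatch w v t := fun k => by
    funext p
    exact (congrFun (iterate_run_of_notMem (by decide) s k) _).trans (propext (htom v t p))
  have h₂ : ∀ k, (fun p q => S k may [v, t, p, q]) = MayMatch w T v t := fun k => by
    funext p q
    exact (congrFun (iterate_run_of_notMem (by decide) s k) _).trans (propext (hmay v t p q))
  rw [run_loop_loop]
  refine Auction.owns_iff_of_iterate (X := ToMatch w v t) (A := MayMatch w T v t)
    (fun p hp => hp.lt.trans (Nat.lt_succ_self _))
    -- The additional element of the domain is the object outside `X` that the auction requires.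
    ⟨w.length, Nat.lt_succ_self _, fun h => h.lt.false⟩ (fun p q h => h.toMatch)
    (fun k q c => S k lev [v, t, q, c]) (fun k q p => S k own [v, t, q, p])
    (fun q _ c _ => hlev _) (fun q _ p _ => hown _) (fun k => ?_) (fun k => ?_)
  · rw [hsucc, (run_bidding v t).1, h₁, h₂]
  · rw [hsucc, (run_bidding v t).2, h₁, h₂]

/-- The auctions for all pairs of a node and a type run simultaneously, since `v` and `t` are
parameters of the tables. They all use the types from the beginning of the round. -/
lemma run_refine {w : List Token} {s : Tab → List ℕ → Prop} (h : IsBase w s) :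
    (fun v t => refine.run w (w.length + 1) s typ [v, t]) =
      refineTypes w fun v t => s typ [v, t] := by
  set n := w.length + 1 with hn
  set s₁ := setFits.run w n s with hs₁
  set s₂ := setMay.run w n s₁ with hs₂
  -- The formula `lt 0 0` is false: prices and owners left from the previous round are erased.
  set s₃ := (assign lev [0, 1, 2, 3] (lt 0 0) : Prog).run w n s₂ with hs₃
  set s₄ := (assign own [0, 1, 2, 3] (lt 0 0) : Prog).run w n s₃ with hs₄
  set s₅ := (loop (loop bidding)).run w n s₄ with hs₅
  have h₁ : ∀ x ≠ fits, s₁ x = s x := fun x hx => run_of_notMem (by simpa [setFits, targets]) _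
  have h₂ : ∀ x ≠ may, s₂ x = s₁ x := fun x hx => run_of_notMem (by simpa [setMay, targets]) _
  have h₃ : ∀ x ≠ lev, s₃ x = s₂ x := fun x hx => run_of_notMem (by simpa [targets]) _
  have h₄ : ∀ x ≠ own, s₄ x = s₃ x := fun x hx => run_of_notMem (by simpa [targets]) _
  have h₅ : ∀ x ∉ bidding.targets, s₅ x = s₄ x := fun x hx =>
    run_of_notMem (p := loop (loop bidding)) hx _
  have hfits : ∀ v p q, s₁ fits [v, p, q] ↔ Fits w (fun v t => s typ [v, t]) v p q := by
    intro v p q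
    rw [hs₁, run_setFits]
    simp only [h.edge, h.sym]
    constructor
    · rintro ⟨a, -, m, -, r, -, h⟩
      exact ⟨a, m, r, h⟩
    · rintro ⟨a, m, r, h1, h2, h3⟩
      have h4 := h1.lt
      have h5 := h2.lt
      exact ⟨a, by omega, m, by omega, r, by omega, h1, h2, h3⟩
  have hmay : ∀ v t p q, s₂ may [v, t, p, q] ↔
      MayMatch w (fun v t => s typ [v, t]) v t p q := by
    intro v t p q
    rw [hs₂, run_setMay]
    simp only [hfits, h₁ out (by simp), h₁ rsym (by simp), h₁ star (by simp), h₁ opt (by simp),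
      h.out, h.rsym, h.star, h.opt]
    rw [exists_lt_iff fun r hr => hr.1.lt.trans (Nat.lt_succ_self _)]
    rfl
  have key := own_iff_hasMatching (w := w) (T := fun v t => s typ [v, t]) (s := s₄)
    (fun v t p => by
      rw [h₄ tom (by simp), h₃ tom (by simp), h₂ tom (by simp), h₁ tom (by simp), h.tom])
    (fun v t p q => by rw [h₄ may (by simp), h₃ may (by simp), hmay])
    (fun l hl => by
      rw [h₄ lev (by simp), hs₃, run_assign_self] at hl
      exact lt_irrefl _ hl)
    (fun l hl => by
      rw [hs₄, run_assign_self] at hl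
      exact lt_irrefl _ hl)
  funext v t
  change restrictTyp.run w n s₅ typ [v, t] = _
  rw [run_restrictTyp, refineTypes, ← key v t, h₅ typ (by decide), h₄ typ (by simp),
    h₃ typ (by simp), h₂ typ (by simp), h₁ typ (by simp), h₅ tom (by decide), h₄ tom (by simp),
    h₃ tom (by simp), h₂ tom (by simp), h₁ tom (by simp)]
  simp only [h.tom]
  exact propext (and_congr_right fun _ =>
    ⟨fun h p hp => h p (hp.lt.trans (Nat.lt_succ_self _)) hp, fun h p _ hp => h p hp⟩)

end Tab

end ShExVal

namespace ShExVal

open Function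

namespace Tab

open Fml RelProg

/-! ### The computation of the relations that describe the word -/

section base

set_option linter.unusedSimpArgs false

variable {w : List Token} {n : ℕ} {s : Tab → List ℕ → Prop}

lemma run_numStep (hn : 0 < n) (p v q : ℕ) : numStep.run w n s num [p, v, q] ↔
    (w[p]? = some .endNum ∧ v = 0 ∧ q = p + 1 ∧ q < n) ∨
      (w[p]? = some .digit ∧ ∃ p' < n, ∃ v' < n, (p' = p + 1 ∧ p' < n) ∧ (v = v' + 1 ∧ v < n) ∧
        s num [p', v', q]) := by
  simp only [numStep, run_assign_self, eval_tok, eval_and, eval_or, eval_ex, eval_all, eval_imp,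
    eval_rel, eval_not, eval_lt, eval_same, assignEnv, List.map_cons, List.map_nil, update_apply,
    Fin.reduceEq, ↓reduceIte, Fin.isValue, ne_eq, not_false_eq_true, eval_succ, eval_zero, hn]

/-- A number is read from its end mark backwards, one digit per round, so `k` rounds find the
numbers below `k`. As a number is shorter than the word that contains it, `w.length + 1` rounds find
all of them. -/
lemma iterate_numStep (h : ∀ l, ¬ s num l) (k p v q : ℕ) :
    (numStep.run w (w.length + 1))^[k] s num [p, v, q] ↔
      v < k ∧ encodeNum v <+: w.drop p ∧ q = p + v + 1 := by
  induction k generalizing p v q with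
  | zero => simpa using h _
  | succ k ih =>
    rw [iterate_succ_apply', run_numStep (Nat.succ_pos _)]
    simp only [ih]
    have hlt : ∀ x, w[p]? = some x → p < w.length := fun x hx =>
      (List.getElem?_eq_some_iff.1 hx).1
    cases v with
    | zero =>
      have h0 : encodeNum 0 = [.endNum] := rfl
      rw [h0, cons_prefix_drop_iff]
      constructor
      · rintro (⟨h1, -, h2, -⟩ | ⟨-, p', -, v', -, -, ⟨h1, -⟩, -⟩)
        · exact ⟨by omega, ⟨h1, List.nil_prefix⟩, h2⟩
        · omega
      · rintro ⟨-, ⟨h1, -⟩, h2⟩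
        have := hlt _ h1
        exact .inl ⟨h1, rfl, h2, by omega⟩
    | succ v =>
      rw [encodeNum_succ, cons_prefix_drop_iff]
      constructor
      · rintro (⟨-, h1, -⟩ | ⟨h1, p', -, v', -, ⟨rfl, -⟩, ⟨hv, -⟩, h3, h4, h5⟩)
        · omega
        · obtain rfl : v = v' := by omega
          exact ⟨by omega, ⟨h1, h4⟩, by omega⟩
      · rintro ⟨h1, ⟨h2, h3⟩, h4⟩
        have h5 := hlt _ h2
        have h6 := h3.length_le
        rw [length_encodeNum, List.length_drop] at h6
        exact .inr ⟨h2, p + 1, by omega, v, by omega, ⟨rfl, by omega⟩, ⟨rfl, by omega⟩, by omega,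
          h3, by omega⟩

lemma run_cntStep (hn : 0 < n) (p c : ℕ) : cntStep.run w n s cnt [p, c] ↔
    (p = 0 ∧ c = 0) ∨ ∃ p' < n, (p = p' + 1 ∧ p < n) ∧
      ((w[p']? = some .rule ∧ ∃ c' < n, (c = c' + 1 ∧ c < n) ∧ s cnt [p', c']) ∨
        (¬ w[p']? = some .rule ∧ s cnt [p', c])) := by
  simp only [cntStep, run_assign_self, eval_tok, eval_and, eval_or, eval_ex, eval_all, eval_imp,
    eval_rel, eval_not, eval_lt, eval_same, assignEnv, List.map_cons, List.map_nil, update_apply,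
    Fin.reduceEq, ↓reduceIte, Fin.isValue, ne_eq, not_false_eq_true, eval_succ, eval_zero, hn]

lemma ruleCount_succ (w : List Token) (p : ℕ) :
    ruleCount w (p + 1) = ruleCount w p + if w[p]? = some .rule then 1 else 0 := by
  rw [ruleCount, List.take_add_one, List.count_append, ruleCount]
  congr 1
  rcases w[p]? with _ | x
  · simp
  · by_cases hx : x = .rule
    · simp [hx]
    · simp [hx]

lemma ruleCount_le (w : List Token) (p : ℕ) : ruleCount w p ≤ p :=
  List.count_le_length.trans (List.length_take_le _ _)

/-- The counts advance by one position per round; `w.length + 1` rounds reach the end of the word.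
-/
lemma iterate_cntStep (h : ∀ l, ¬ s cnt l) (k p c : ℕ) :
    (cntStep.run w (w.length + 1))^[k] s cnt [p, c] ↔
      p < k ∧ p < w.length + 1 ∧ ruleCount w p = c := by
  induction k generalizing p c with
  | zero => simpa using h _
  | succ k ih =>
    rw [iterate_succ_apply', run_cntStep (Nat.succ_pos _)]
    simp only [ih]
    cases p with
    | zero =>
      have h0 : ruleCount w 0 = 0 := by simp [ruleCount]
      rw [h0]
      constructor
      · rintro (⟨-, rfl⟩ | ⟨p', -, ⟨h1, -⟩, -⟩)
        · exact ⟨by omega, by omega, rfl⟩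
        · omega
      · rintro ⟨-, -, rfl⟩
        exact .inl ⟨rfl, rfl⟩
    | succ p =>
      rw [ruleCount_succ]
      have hle := ruleCount_le w p
      constructor
      · rintro (⟨h1, -⟩ | ⟨p', -, ⟨h1, h2⟩, ⟨h3, c', -, ⟨rfl, -⟩, h4, h5, h6⟩ | ⟨h3, h4, h5, h6⟩⟩)
        · omega
        · obtain rfl : p = p' := by omega
          rw [if_pos h3]
          exact ⟨by omega, h2, by omega⟩
        · obtain rfl : p = p' := by omega
          rw [if_neg h3]
          exact ⟨by omega, h2, by omega⟩
      · rintro ⟨h1, h2, h3⟩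
        refine .inr ⟨p, by omega, ⟨rfl, h2⟩, ?_⟩
        split_ifs at h3 with h4
        · exact .inl ⟨h4, ruleCount w p, by omega, ⟨by omega, by omega⟩, by omega, by omega, rfl⟩
        · exact .inr ⟨h4, by omega, by omega, by omega⟩

end base

end Tab

end ShExVal

/-! ### Correctness of the base relations and of the whole validation program -/

namespace ShExVal

open Function

namespace Tab

open Fml RelProg

section base

set_option linter.unusedSimpArgs false

variable {w : List Token} {s : Tab → List ℕ → Prop}

/-- The three numbers are chained by their end positions. The last of these may be `w.length`, which
lies in the domain because of its additional element. -/
lemma run_setEdge (h : ∀ p v q, s num [p, v, q] ↔ encodeNum v <+: w.drop p ∧ q = p + v + 1)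
    (p u a v : ℕ) :
    setEdge.run w (w.length + 1) s edge [p, u, a, v] ↔ EdgeAt w p u a v := by
  simp only [setEdge, run_assign_self, eval_tok, eval_and, eval_or, eval_ex, eval_all, eval_imp,
    eval_rel, eval_not, eval_lt, eval_same, assignEnv, List.map_cons, List.map_nil, update_apply,
    Fin.reduceEq, ↓reduceIte, Fin.isValue, ne_eq, not_false_eq_true, eval_succ]
  simp only [h]
  constructor
  · rintro ⟨h0, _, -, _, -, _, -, ⟨rfl, -⟩, ⟨h1, rfl⟩, ⟨h2, rfl⟩, _, -, h3, -⟩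
    rw [EdgeAt, cons_prefix_drop_iff, prefix_append_iff, prefix_append_iff]
    simp only [List.drop_drop, List.length_append, length_encodeNum]
    exact ⟨h0, ⟨h1, by convert h2 using 2; omega⟩, by convert h3 using 2; omega⟩
  · intro he
    have hlen := he.length_le
    rw [EdgeAt, cons_prefix_drop_iff, prefix_append_iff, prefix_append_iff] at he
    simp only [List.drop_drop, List.length_append, length_encodeNum, List.length_cons,
      List.length_drop] at he hlen
    obtain ⟨h0, ⟨h1, h2⟩, h3⟩ := he
    exact ⟨h0, p + 1, by omega, p + 1 + u + 1, by omega, p + 1 + u + 1 + a + 1, by omega,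
      ⟨rfl, by omega⟩, ⟨h1, rfl⟩, ⟨by convert h2 using 2; omega, rfl⟩, p + 1 + u + 1 + a + 1 + v + 1,
      by omega, by convert h3 using 2; omega, rfl⟩

lemma run_setSym (h : ∀ p v q, s num [p, v, q] ↔ encodeNum v <+: w.drop p ∧ q = p + v + 1)
    (p a r : ℕ) : setSym.run w (w.length + 1) s sym [p, a, r] ↔ SymAt w p a r := by
  simp only [setSym, run_assign_self, eval_tok, eval_and, eval_or, eval_ex, eval_all, eval_imp,
    eval_rel, eval_not, eval_lt, eval_same, assignEnv, List.map_cons, List.map_nil, update_apply,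
    Fin.reduceEq, ↓reduceIte, Fin.isValue, ne_eq, not_false_eq_true, eval_succ]
  simp only [h]
  constructor
  · rintro ⟨h0, _, -, _, -, ⟨rfl, -⟩, ⟨h1, rfl⟩, _, -, h2, -⟩
    rw [SymAt, cons_prefix_drop_iff, prefix_append_iff]
    simp only [List.drop_drop, List.length_append, length_encodeNum]
    exact ⟨h0, h1, by convert h2 using 2; omega⟩
  · intro he
    have hlen := he.length_le
    rw [SymAt, cons_prefix_drop_iff, prefix_append_iff] at he
    simp only [List.drop_drop, List.length_append, length_encodeNum, List.length_cons,
      List.length_drop] at he hlen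
    obtain ⟨h0, h1, h2⟩ := he
    exact ⟨h0, p + 1, by omega, p + 1 + a + 1, by omega, ⟨rfl, by omega⟩, ⟨h1, rfl⟩,
      p + 1 + a + 1 + r + 1, by omega, by convert h2 using 2; omega, rfl⟩

lemma run_setOut (h : ∀ p u a v, s edge [p, u, a, v] ↔ EdgeAt w p u a v) (v p : ℕ) :
    setOut.run w (w.length + 1) s out [v, p] ↔ EdgeFrom w v p := by
  simp only [setOut, run_assign_self, eval_tok, eval_and, eval_or, eval_ex, eval_all, eval_imp,
    eval_rel, eval_not, eval_lt, eval_same, assignEnv, List.map_cons, List.map_nil, update_apply,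
    Fin.reduceEq, ↓reduceIte, Fin.isValue, ne_eq, not_false_eq_true, eval_succ]
  simp only [h]
  constructor
  · rintro ⟨a, -, u, -, he⟩
    exact ⟨a, u, he⟩
  · rintro ⟨a, u, he⟩
    have := he.lt
    exact ⟨a, by omega, u, by omega, he⟩

lemma run_setRsym (h : ∀ p c, s cnt [p, c] ↔ p < w.length + 1 ∧ ruleCount w p = c) (t p : ℕ) :
    setRsym.run w (w.length + 1) s rsym [t, p] ↔ RuleSym w t p := by
  simp only [setRsym, run_assign_self, eval_tok, eval_and, eval_or, eval_ex, eval_all, eval_imp,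
    eval_rel, eval_not, eval_lt, eval_same, assignEnv, List.map_cons, List.map_nil, update_apply,
    Fin.reduceEq, ↓reduceIte, Fin.isValue, ne_eq, not_false_eq_true, eval_succ]
  simp only [h]
  constructor
  · rintro ⟨h0, _, -, ⟨rfl, -⟩, -, h1⟩
    exact ⟨h0, h1⟩
  · intro he
    have h1 := he.lt
    have h2 := ruleCount_le w p
    have h3 := he.2
    exact ⟨he.1, t + 1, by omega, ⟨rfl, by omega⟩, by omega, h3⟩

lemma run_setStar (p : ℕ) : setStar.run w (w.length + 1) s star [p] ↔ StarAt w p := by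
  simp only [setStar, run_assign_self, eval_tok, eval_and, eval_or, eval_ex, eval_all, eval_imp,
    eval_rel, eval_not, eval_lt, eval_same, assignEnv, List.map_cons, List.map_nil, update_apply,
    Fin.reduceEq, ↓reduceIte, Fin.isValue, ne_eq, not_false_eq_true, eval_succ]
  constructor
  · rintro ⟨p', -, ⟨h1, -⟩, h2⟩
    exact ⟨p', h1, h2⟩
  · rintro ⟨p', rfl, h⟩
    have := (List.getElem?_eq_some_iff.1 h).1
    exact ⟨p', by omega, ⟨rfl, by omega⟩, h⟩

lemma run_setOpt (p : ℕ) : setOpt.run w (w.length + 1) s opt [p] ↔ OptAt w p := by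
  simp only [setOpt, run_assign_self, eval_tok, eval_and, eval_or, eval_ex, eval_all, eval_imp,
    eval_rel, eval_not, eval_lt, eval_same, assignEnv, List.map_cons, List.map_nil, update_apply,
    Fin.reduceEq, ↓reduceIte, Fin.isValue, ne_eq, not_false_eq_true, eval_succ]
  constructor
  · rintro ⟨p', -, _, -, ⟨rfl, -⟩, ⟨rfl, -⟩, h⟩
    exact ⟨p', rfl, h⟩
  · rintro ⟨p', rfl, h1, h2⟩
    have := (List.getElem?_eq_some_iff.1 h2).1
    exact ⟨p', by omega, p' + 1, by omega, ⟨rfl, by omega⟩, ⟨rfl, by omega⟩, h1, h2⟩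

lemma run_setTom (ho : ∀ v p, s out [v, p] ↔ EdgeFrom w v p)
    (hr : ∀ t p, s rsym [t, p] ↔ RuleSym w t p) (hs : ∀ p, s star [p] ↔ StarAt w p) (v t p : ℕ) :
    setTom.run w (w.length + 1) s tom [v, t, p] ↔ ToMatch w v t p := by
  simp only [setTom, run_assign_self, eval_tok, eval_and, eval_or, eval_ex, eval_all, eval_imp,
    eval_rel, eval_not, eval_lt, eval_same, assignEnv, List.map_cons, List.map_nil, update_apply,
    Fin.reduceEq, ↓reduceIte, Fin.isValue, ne_eq, not_false_eq_true, eval_succ]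
  rw [ho, hr, hs]
  rfl

lemma run_setTyp (h : ∀ p c, s cnt [p, c] ↔ p < w.length + 1 ∧ ruleCount w p = c) (v t : ℕ) :
    setTyp.run w (w.length + 1) s typ [v, t] ↔ allTypes w v t := by
  simp only [setTyp, run_assign_self, eval_tok, eval_and, eval_or, eval_ex, eval_all, eval_imp,
    eval_rel, eval_not, eval_lt, eval_same, assignEnv, List.map_cons, List.map_nil, update_apply,
    Fin.reduceEq, ↓reduceIte, Fin.isValue, ne_eq, not_false_eq_true, eval_succ]
  simp only [h]
  constructor
  · rintro ⟨p, hp, _, -, ⟨-, h1⟩, rfl, -⟩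
    exact ⟨p, hp, h1⟩
  · rintro ⟨p, hp, h1⟩
    have h2 := ruleCount_le w p
    exact ⟨p, hp, t + 1, by omega, ⟨hp, h1⟩, rfl, by omega⟩

/-- The relations that describe the word are computed correctly. -/
lemma run_setBase (w : List Token) :
    let s := setBase.run w (w.length + 1) fun _ _ => False
    IsBase w s ∧ (fun v t => s typ [v, t]) = allTypes w ∧
      ∀ p v q, s num [p, v, q] ↔ encodeNum v <+: w.drop p ∧ q = p + v + 1 := by
  set n := w.length + 1 with hn
  set s₁ := (loop numStep).run w n fun _ _ => False with hs₁
  set s₂ := (loop cntStep).run w n s₁ with hs₂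
  set s₃ := setEdge.run w n s₂ with hs₃
  set s₄ := setSym.run w n s₃ with hs₄
  set s₅ := setOut.run w n s₄ with hs₅
  set s₆ := setRsym.run w n s₅ with hs₆
  set s₇ := setStar.run w n s₆ with hs₇
  set s₈ := setOpt.run w n s₇ with hs₈
  set s₉ := setTom.run w n s₈ with hs₉
  set s := setTyp.run w n s₉ with hs
  have h₁ : ∀ x ≠ num, ∀ l, ¬ s₁ x l := fun x hx l => by
    rw [hs₁, run_of_notMem (by simpa [numStep, targets])]
    exact id
  have h₂ : ∀ x ≠ cnt, s₂ x = s₁ x := fun x hx => run_of_notMem (by simpa [cntStep, targets]) _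
  have h₃ : ∀ x ≠ edge, s₃ x = s₂ x := fun x hx => run_of_notMem (by simpa [setEdge, targets]) _
  have h₄ : ∀ x ≠ sym, s₄ x = s₃ x := fun x hx => run_of_notMem (by simpa [setSym, targets]) _
  have h₅ : ∀ x ≠ out, s₅ x = s₄ x := fun x hx => run_of_notMem (by simpa [setOut, targets]) _
  have h₆ : ∀ x ≠ rsym, s₆ x = s₅ x := fun x hx => run_of_notMem (by simpa [setRsym, targets]) _
  have h₇ : ∀ x ≠ star, s₇ x = s₆ x := fun x hx => run_of_notMem (by simpa [setStar, targets]) _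
  have h₈ : ∀ x ≠ opt, s₈ x = s₇ x := fun x hx => run_of_notMem (by simpa [setOpt, targets]) _
  have h₉ : ∀ x ≠ tom, s₉ x = s₈ x := fun x hx => run_of_notMem (by simpa [setTom, targets]) _
  have h₀ : ∀ x ≠ typ, s x = s₉ x := fun x hx => run_of_notMem (by simpa [setTyp, targets]) _
  have knum : ∀ p v q, s₂ num [p, v, q] ↔ encodeNum v <+: w.drop p ∧ q = p + v + 1 := by
    intro p v q
    rw [h₂ num (by simp), hs₁, run_loop, hn, iterate_numStep (fun _ => id)]
    refine and_iff_right_of_imp fun h => ?_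
    have := h.1.length_le
    rw [length_encodeNum, List.length_drop] at this
    omega
  have kcnt : ∀ p c, s₂ cnt [p, c] ↔ p < w.length + 1 ∧ ruleCount w p = c := by
    intro p c
    rw [hs₂, run_loop, hn, iterate_cntStep (h₁ cnt (by simp))]
    tauto
  have kedge : ∀ p u a v, s₃ edge [p, u, a, v] ↔ EdgeAt w p u a v := run_setEdge knum
  have ksym : ∀ p a r, s₄ sym [p, a, r] ↔ SymAt w p a r := run_setSym (by
    rwa [h₃ num (by simp)])
  have kout : ∀ v p, s₅ out [v, p] ↔ EdgeFrom w v p := run_setOut (by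
    rwa [h₄ edge (by simp)])
  have kcnt' : ∀ p c, s₅ cnt [p, c] ↔ p < w.length + 1 ∧ ruleCount w p = c := by
    rwa [h₅ cnt (by simp), h₄ cnt (by simp), h₃ cnt (by simp)]
  have krsym : ∀ t p, s₆ rsym [t, p] ↔ RuleSym w t p := run_setRsym kcnt'
  have kstar : ∀ p, s₇ star [p] ↔ StarAt w p := run_setStar
  have kopt : ∀ p, s₈ opt [p] ↔ OptAt w p := run_setOpt
  have ktom : ∀ v t p, s₉ tom [v, t, p] ↔ ToMatch w v t p := run_setTom
    (by rwa [h₈ out (by simp), h₇ out (by simp), h₆ out (by simp)])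
    (by rwa [h₈ rsym (by simp), h₇ rsym (by simp)]) (by rwa [h₈ star (by simp)])
  have ktyp : ∀ v t, s typ [v, t] ↔ allTypes w v t := run_setTyp (by
    rwa [h₉ cnt (by simp), h₈ cnt (by simp), h₇ cnt (by simp), h₆ cnt (by simp)])
  change IsBase w s ∧ (fun v t => s typ [v, t]) = allTypes w ∧
    ∀ p v q, s num [p, v, q] ↔ encodeNum v <+: w.drop p ∧ q = p + v + 1
  refine ⟨⟨?_, ?_, ?_, ?_, ?_, ?_, ?_⟩, ?_, ?_⟩
  · rwa [h₀ edge (by simp), h₉ edge (by simp), h₈ edge (by simp), h₇ edge (by simp),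
      h₆ edge (by simp), h₅ edge (by simp), h₄ edge (by simp)]
  · rwa [h₀ sym (by simp), h₉ sym (by simp), h₈ sym (by simp), h₇ sym (by simp),
      h₆ sym (by simp), h₅ sym (by simp)]
  · rwa [h₀ out (by simp), h₉ out (by simp), h₈ out (by simp), h₇ out (by simp),
      h₆ out (by simp)]
  · rwa [h₀ rsym (by simp), h₉ rsym (by simp), h₈ rsym (by simp), h₇ rsym (by simp)]
  · rwa [h₀ star (by simp), h₉ star (by simp), h₈ star (by simp)]
  · rwa [h₀ opt (by simp), h₉ opt (by simp)]
  · rwa [h₀ tom (by simp)]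
  · funext v t
    exact propext (ktyp v t)
  · rwa [h₀ num (by simp), h₉ num (by simp), h₈ num (by simp), h₇ num (by simp),
      h₆ num (by simp), h₅ num (by simp), h₄ num (by simp), h₃ num (by simp)]

/-- The types that the validation program computes. -/
lemma run_validate (w : List Token) :
    let s := validate.run w (w.length + 1) fun _ _ => False
    (fun v t => s typ [v, t]) =
        (refineTypes w)^[(w.length + 1) * (w.length + 1)] (allTypes w) ∧
      ∀ p v q, s num [p, v, q] ↔ encodeNum v <+: w.drop p ∧ q = p + v + 1 := by
  obtain ⟨hb, ht, hnum⟩ := run_setBase w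
  set s₀ := setBase.run w (w.length + 1) fun _ _ => False with hs₀
  -- `IsBase` is carried along because `run_refine` presupposes it in every round.
  have key : ∀ k, IsBase w ((refine.run w (w.length + 1))^[k] s₀) ∧
      (fun v t => (refine.run w (w.length + 1))^[k] s₀ typ [v, t]) =
        (refineTypes w)^[k] (allTypes w) := by
    intro k
    induction k with
    | zero => exact ⟨hb, ht⟩
    | succ k ih =>
      rw [iterate_succ_apply', iterate_succ_apply', run_refine ih.1, ih.2]
      exact ⟨ih.1.of_eq fun x hx => run_of_notMem hx _, rfl⟩
  change (fun v t => (loop (loop refine)).run w (w.length + 1) s₀ typ [v, t]) = _ ∧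
    ∀ p v q, (loop (loop refine)).run w (w.length + 1) s₀ num [p, v, q] ↔ _
  rw [run_of_notMem (p := loop (loop refine)) (x := num) (by decide), run_loop_loop]
  exact ⟨(key _).2, hnum⟩

/-- Variable `3` is bound nowhere in `accept` and so has the value `0`. Hence `m` is the number
written at the beginning of the word. -/
lemma eval_accept {n : ℕ} : accept.eval w n s (fun _ => 0) ↔
    ∀ v < n, (∃ m < n, ∃ q < n, s num [0, m, q] ∧ v < m) → ∃ t < n, s typ [v, t] := by
  simp only [accept, run_assign_self, eval_tok, eval_and, eval_or, eval_ex, eval_all, eval_imp,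
    eval_rel, eval_not, eval_lt, eval_same, assignEnv, List.map_cons, List.map_nil, update_apply,
    Fin.reduceEq, ↓reduceIte, Fin.isValue, ne_eq, not_false_eq_true, eval_succ]

end base

end Tab

/-- The validation program decides validity. -/
lemma ValidationInput.mValid_iff_accept (I : ValidationInput rbeMultConc) :
    MValid I.graph I.schema ↔ Tab.accept.eval I.encode (I.encode.length + 1)
      (Tab.validate.run I.encode (I.encode.length + 1) fun _ _ => False) fun _ => 0 := by
  obtain ⟨ht, hnum⟩ := Tab.run_validate I.encode
  have ht' := fun v t => congrFun (congrFun ht v) t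
  rw [I.mValid_iff, Tab.eval_accept]
  simp only [hnum, ht', List.drop_zero]
  have hle := I.encodeNum_prefix_encode.length_le
  rw [length_encodeNum] at hle
  constructor
  · rintro h v - ⟨m, -, q, -, ⟨hm, -⟩, hv⟩
    -- The number at position `0` can only be the number of nodes.
    obtain rfl := encodeNum_prefix_inj hm I.encodeNum_prefix_encode
    exact h v hv
  · intro h v hv
    exact h v (by omega) ⟨I.numNodes, by omega, 0 + I.numNodes + 1, by omega,
      ⟨I.encodeNum_prefix_encode, rfl⟩, hv⟩

end ShExVal

/-- Multi-type validation for `ShEx(RBE(a^M, ∥))` is in PTIME. -/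
theorem mainTheorem5 :
    ShExVal.InPTIME
      (fun I : ShExVal.ValidationInput ShExVal.rbeMultConc => I.encode)
      (fun I => ShExVal.MValid I.graph I.schema) :=
  ShExVal.StackProg.inPTIME_of_relProg ShExVal.Tab.arity ShExVal.Tab.validate ShExVal.Tab.accept
    ShExVal.Tab.validate_wf ShExVal.Tab.accept_wf fun I => I.mValid_iff_accept
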